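/- Let $(\theta_j)_{j\ge1}$ and $(\kappa_j)_{j\ge 1}$ be sequences of non-negative reals. For $N\ge1$ consider on the symmetric group $\mathfrak S_N$ the probability measure $$\tilde{\mathbb P}_N(\sigma)=\frac{1}{N!\,H_N}\prod_{j=1}^N(\theta_j+N\kappa_j)^{C_j(\sigma)},\qquad H_N=\frac1{N!}\sum_{\sigma\in\mathfrak S_N}\prod_{j=1}^N(\theta_j+N\kappa_j)^{C_j(\sigma)},$$ where $C_j(\sigma)$ is the number of cycles of length $j$ of $\sigma$ (the measure is well defined, i.e. $H_N>0$, for all large $N$ under the assumptions below). Let $L^{(1)}(\sigma)\ge L^{(2)}(\sigma)\ge\cdots$ be the cycle lengths of $\sigma$ in descending order, continued by $0$ after the last cycle. Put $g_\theta(z)=\sum_{j\ge1}\frac{\theta_j}{j}z^j$, $g_\kappa(z)=\sum_{j\ge1}\frac{\kappa_j}{j}z^j$. For $n\ge0$ write $g^{\{n\}}(z)=z^n\,\frac{d^n g}{dz^n}(z)$, and let $g_\kappa^{\{n\}}(R)=\lim_{r\uparrow R}g_\kappa^{\{n\}}(r)\in[0,+\infty]$. For $R,\eta>0$, $\varphi\in(0,\pi/2)$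 let $$\Delta_0=\{z\in\mathbb C:\ |z|<|R(1+\eta e^{i\varphi})|,\ z\ne R,\ |\arg(z-R)|>\varphi\}.$$ Assume the following. 1. $(\kappa_j)$ is non-arithmetic (there is no integer $j_0>1$ dividing every $j$ with $\kappa_j\neq0$), and $\kappa_j>0$ for some $j\ge2$. 2. Both power series have the same radius of convergence $R\in(0,\infty)$, and $g_\theta,g_\kappa$ extend holomorphically to some domain $\Delta_0=\Delta_0(R,\eta,\varphi)$; the extensions are denoted by the same letters. 3. $g_\kappa^{\{1\}}(R)<1$ (supercritical regime). 4. For some $\theta^*>0$, $\delta>0$, as $z\to R$, $z\in\Delta_0$, $$g_\theta(z)=-\theta^*\log(1-z/R)+O\bigl(|1-z/R|^{\delta}\bigr),\qquad g_\kappa(z)=g_\kappa(R)-g_\kappa^{\{1\}}(R)(1-z/R)+O\bigl(|1-z/R|^{1+\delta}\bigr).$$ 5. There are a non-integer $s>1$, a real $a_s\neq0$ and numbers $\delta_n>0$ such that $g_\kappa^{\{n\}}(R)<\infty$ for integers $0\le n<s$ and $g_\kappa^{\{n\}}(R)=\infty$ for integers $n>s$, and, as $z\to R$, $z\in\Delta_0$,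 $$g_\kappa^{\{n\}}(z)=g_\kappa^{\{n\}}(R)\bigl\{1+O(|1-z/R|^{\delta_n})\bigr\}\quad(n<s),$$ $$g_\kappa^{\{n\}}(z)=\frac{\Gamma(n-s)\,a_s}{\Gamma(-s)}(1-z/R)^{s-n}\bigl\{1+O(|1-z/R|^{\delta_n})\bigr\}\quad(n>s),$$ $$g_\theta^{\{n\}}(z)=\frac{\theta^*(n-1)!}{(1-z/R)^n}\bigl\{1+O(|1-z/R|^{\delta_n})\bigr\}\quad(n\ge1).$$ (Logarithm and powers are principal branches.) Let $\tilde\nu=1-g_\kappa^{\{1\}}(R)>0$. Then, as $N\to\infty$, in the sense of convergence of finite-dimensional distributions, $$\frac1{N\tilde\nu}\bigl(L^{(1)},L^{(2)},\dots\bigr)\ \xrightarrow{\ d\ }\ \mathrm{PD}(\theta^*),$$ that is, for each $m$ the law of $(N\tilde\nu)^{-1}(L^{(1)},\dots,L^{(m)})$ under $\tilde{\mathbb P}_N$ converges weakly to the law of the first $m$ coordinates of $\mathrm{PD}(\theta^*)$. Here $\mathrm{PD}(\theta)$ is the law of $(\sigma_1/\sigma,\sigma_2/\sigma,\dots)$,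 where $\sigma_1>\sigma_2>\cdots$ are the points of a Poisson process on $(0,\infty)$ with rate $\theta x^{-1}e^{-x}$ and $\sigma=\sum_j\sigma_j$. -/

import Mathlib

open MeasureTheory ProbabilityTheory Filter Topology Asymptotics
open scoped BoundedContinuousFunction ENNReal

noncomputable section

namespace SurrogateSpatial

/-! ### The surrogate-spatial measure on permutations -/

/-- The number `C_j(σ)` of cycles of length `j` in `σ` (fixed points are the cycles of length 1;
`Equiv.Perm.partition` is the multiset of all cycle lengths, fixed points included). -/
def cycleCount {N : ℕ} (σ : Equiv.Perm (Fin N)) (j : ℕ) : ℕ :=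
  σ.partition.parts.count j

/-- The multiplicative weight `∏_{j=1}^N (θ_j + N κ_j)^{C_j(σ)}` of a permutation. -/
def cycleWeight (θ κ : ℕ → ℝ) (N : ℕ) (σ : Equiv.Perm (Fin N)) : ℝ :=
  ∏ j ∈ Finset.Icc 1 N, (θ j + N * κ j) ^ cycleCount σ j

/-- The normalization constant `H_N`. -/
def normConst (θ κ : ℕ → ℝ) (N : ℕ) : ℝ :=
  1 / (N.factorial : ℝ) * ∑ σ : Equiv.Perm (Fin N), cycleWeight θ κ N σ

/-- The surrogate-spatial probability of the permutation `σ`. -/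
def permProb (θ κ : ℕ → ℝ) (N : ℕ) (σ : Equiv.Perm (Fin N)) : ℝ :=
  1 / ((N.factorial : ℝ) * normConst θ κ N) * cycleWeight θ κ N σ

/-- The expectation of `F` under the surrogate-spatial measure on permutations of `N` elements. -/
def permExpect (θ κ : ℕ → ℝ) (N : ℕ) (F : Equiv.Perm (Fin N) → ℝ) : ℝ :=
  ∑ σ : Equiv.Perm (Fin N), permProb θ κ N σ * F σ

/-- Cycle lengths in descending order: `orderedCycleLength σ k` is the length `L^{(k+1)}(σ)` of the
`(k+1)`-st longest cycle of `σ`, and `0` if `σ` has at most `k` cycles. -/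
def orderedCycleLength {N : ℕ} (σ : Equiv.Perm (Fin N)) (k : ℕ) : ℕ :=
  (σ.partition.parts.sort (· ≥ ·)).getD k 0

/-! ### Generating functions -/

/-- The power series `∑_{j ≥ 1} (a_j / j) z^j` (the coefficient at `j = 0` is `a 0 / 0 = 0`). -/
def cycleSeries (a : ℕ → ℝ) : FormalMultilinearSeries ℂ ℂ ℂ :=
  FormalMultilinearSeries.ofScalars ℂ (fun j : ℕ => ((a j / j : ℝ) : ℂ))

/-- `G` is given on the disc `|z| < R` by the generating function `∑_{j ≥ 1} (a_j / j) z^j`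
(the term with `j = 0` is zero). -/
def IsGeneratingFunctionOn (a : ℕ → ℝ) (R : ℝ) (G : ℂ → ℂ) : Prop :=
  ∀ z : ℂ, ‖z‖ < R → HasSum (fun j : ℕ => ((a j / j : ℝ) : ℂ) * z ^ j) (G z)

/-- The modified derivative `g^{\{n\}}(z) = z^n g^{(n)}(z)`. -/
def modDeriv (n : ℕ) (g : ℂ → ℂ) (z : ℂ) : ℂ :=
  z ^ n * iteratedDeriv n g z

/-- The boundary value `g^{\{n\}}(R) = lim_{r ↑ R} g^{\{n\}}(r)`, possibly `+∞`. It is used for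
functions given on `|z| < R` by a power series with non-negative coefficients, where
`g^{\{n\}}(r)` is real and nondecreasing in `r ∈ (0, R)`, so that the limit exists. -/
def modDerivAt (n : ℕ) (g : ℂ → ℂ) (R : ℝ) : EReal :=
  limUnder (𝓝[<] R) (fun r : ℝ => (((modDeriv n g (r : ℂ)).re : ℝ) : EReal))

/-- The indented disc: `|z| < |R (1 + η e^{iφ})|`, `z ≠ R`, `|arg (z - R)| > φ`. -/
def Delta0 (R η φ : ℝ) : Set ℂ :=
  {z : ℂ | ‖z‖ < ‖(R : ℂ) * (1 + (η : ℂ) * Complex.exp ((φ : ℂ) * Complex.I))‖ ∧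
    z ≠ (R : ℂ) ∧ φ < |Complex.arg (z - (R : ℂ))|}

/-- The sequence `κ` is non-arithmetic (its support is not contained in `j₀ ℕ` for any `j₀ > 1`)
and non-degenerate (`κ_j > 0` for some `j ≥ 2`). -/
def NonArithmetic (κ : ℕ → ℝ) : Prop :=
  (∀ j₀ : ℕ, 1 < j₀ → ∃ j : ℕ, 1 ≤ j ∧ κ j ≠ 0 ∧ ¬ j₀ ∣ j) ∧ ∃ j : ℕ, 2 ≤ j ∧ 0 < κ j

/-! ### The Poisson–Dirichlet distribution -/

/-- The tail `∫_x^∞ θ t⁻¹ e^{-t} dt` of the intensity measure. -/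
def gammaTail (θ x : ℝ) : ℝ :=
  θ * ∫ t in Set.Ioi x, t⁻¹ * Real.exp (-t)

/-- The inverse of the tail of the intensity: for `θ, u > 0`, the unique `x > 0` for which
`∫_x^∞ θ t⁻¹ e^{-t} dt = u`. -/
def gammaTailInv (θ u : ℝ) : ℝ :=
  sInf {x : ℝ | 0 < x ∧ gammaTail θ x ≤ u}

/-- The points `σ_1 > σ_2 > ⋯` (indexed from `0`) of the Poisson process on `(0, ∞)` with rate
`θ x⁻¹ e^{-x}`, as a function of i.i.d. standard exponential variables `e`: the partial sums
`e_0 + ⋯ + e_k` are the points of a Poisson process of unit rate on `(0, ∞)`, and the decreasing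
bijection `gammaTailInv θ` of `(0, ∞)` carries Lebesgue measure to `θ x⁻¹ e^{-x} dx`. -/
def poissonPoint (θ : ℝ) (e : ℕ → ℝ) (k : ℕ) : ℝ :=
  gammaTailInv θ (∑ i ∈ Finset.range (k + 1), e i)

/-- The Poisson–Dirichlet distribution `PD(θ)`: the law of `(σ_1/σ, σ_2/σ, …)`, where
`σ_1 > σ_2 > ⋯` are the points of a Poisson process on `(0, ∞)` with rate `θ x⁻¹ e^{-x}`
and `σ = ∑ σ_j`. -/
def poissonDirichlet (θ : ℝ) : Measure (ℕ → ℝ) :=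
  (Measure.infinitePi (fun _ : ℕ => expMeasure 1)).map
    (fun e k => poissonPoint θ e k / ∑' i, poissonPoint θ e i)

lemma measurable_gammaTailInv (θ : ℝ) : Measurable (gammaTailInv θ) := by
  refine measurable_of_Iio fun c => ?_
  have hb : ∀ u, BddBelow {x : ℝ | 0 < x ∧ gammaTail θ x ≤ u} := fun u => ⟨0, fun x hx => hx.1.le⟩
  have hS : MeasurableSet {u : ℝ | ∃ x, 0 < x ∧ gammaTail θ x ≤ u} := by
    apply Set.OrdConnected.measurableSet
    exact ⟨fun a ha b _ y hy => by
      obtain ⟨x, hx, hxa⟩ := ha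
      exact ⟨x, hx, hxa.trans hy.1⟩⟩
  have hT : MeasurableSet {u : ℝ | ∃ x, (0 < x ∧ gammaTail θ x ≤ u) ∧ x < c} := by
    apply Set.OrdConnected.measurableSet
    exact ⟨fun a ha b _ y hy => by
      obtain ⟨x, ⟨hx, hxa⟩, hc⟩ := ha
      exact ⟨x, ⟨hx, hxa.trans hy.1⟩, hc⟩⟩
  have key : gammaTailInv θ ⁻¹' Set.Iio c =
      {u : ℝ | ∃ x, (0 < x ∧ gammaTail θ x ≤ u) ∧ x < c} ∪
        ({u : ℝ | ∃ x, 0 < x ∧ gammaTail θ x ≤ u}ᶜ ∩ {_u : ℝ | 0 < c}) := by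
    ext u
    simp only [Set.mem_preimage, Set.mem_Iio, Set.mem_union, Set.mem_inter_iff,
      Set.mem_compl_iff, Set.mem_ofPred_eq]
    by_cases h : ∃ x, 0 < x ∧ gammaTail θ x ≤ u
    · have : gammaTailInv θ u < c ↔ ∃ x, (0 < x ∧ gammaTail θ x ≤ u) ∧ x < c := by
        unfold gammaTailInv
        rw [csInf_lt_iff (hb u) h]
        rfl
      rw [this]
      exact ⟨fun h' => Or.inl h', fun h' => h'.elim id fun h'' => absurd h h''.1⟩
    · have he : {x : ℝ | 0 < x ∧ gammaTail θ x ≤ u} = ∅ := by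
        ext x
        simp only [Set.mem_ofPred_eq, Set.mem_empty_iff_false, iff_false]
        exact fun hx => h ⟨x, hx⟩
      have h0 : gammaTailInv θ u = 0 := by
        unfold gammaTailInv
        rw [he, Real.sInf_empty]
      rw [h0]
      exact ⟨fun h' => Or.inr ⟨h, h'⟩, fun h' => h'.elim
        (fun ⟨x, hx, _⟩ => absurd ⟨x, hx⟩ h) fun h'' => h''.2⟩
  rw [key]
  exact hT.union (hS.compl.inter (MeasurableSet.const _))

lemma measurable_poissonPoint (θ : ℝ) (k : ℕ) :
    Measurable (fun e : ℕ → ℝ => poissonPoint θ e k) := by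
  unfold poissonPoint
  exact (measurable_gammaTailInv θ).comp
    (Finset.measurable_sum _ fun i _ => measurable_pi_apply i)

lemma measurable_normalizedPoints (θ : ℝ) :
    Measurable (fun (e : ℕ → ℝ) (k : ℕ) => poissonPoint θ e k / ∑' i, poissonPoint θ e i) := by
  refine measurable_pi_lambda _ fun k => ?_
  exact (measurable_poissonPoint θ k).div (Measurable.tsum fun i => measurable_poissonPoint θ i)

instance isProbabilityMeasure_poissonDirichlet (θ : ℝ) :
    IsProbabilityMeasure (poissonDirichlet θ) := by
  have : IsProbabilityMeasure (expMeasure 1) := isProbabilityMeasure_expMeasure one_pos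
  unfold poissonDirichlet
  exact Measure.isProbabilityMeasure_map (measurable_normalizedPoints θ).aemeasurable

end SurrogateSpatial

end

/-! Write `κ₁` for `g_κ^{1}(R)` and `ν = 1 - κ₁`. Since the cycle lengths add up to `N`, multiplying
the weight at `j` by `R ^ j` does not change the measure (`permProb_scale`), so one may take `R =
1`. Then `H_N` is the coefficient of `z ^ N` in `exp (g_θ) · exp (N g_κ)`. Normalized, the second
factor is a compound Poisson law (`bulkProb`) whose mean is asymptotic to `κ₁ N` and whose variance
is `o(N²)`. As `κ₁ < 1`, the bulk cycles, those due to `N κ_j`, use up about `κ₁ N` points and leave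
`ν N` points to cycles with weights `θ_j → θ*`. The latter behave like an Ewens permutation, which
is where `PD(θ*)` comes from.

The proof is by moments. The statistics are the power sums of the cycle lengths of orders at least
`s + 1`. Because `κ_j = O(j ^ (-s))` after scaling, the bulk contributes only a fraction `O(N ^ (1 -
s))` to the sums of these orders (`powWeight_bulk_le`, `exists_normMoment_sub_le`), so no limit law
for the bulk cycles themselves is needed. Singling out one cycle gives a recursion for the joint
moments (`sum_partWeight_mul_sum`, `partMoment_insert`), and convolution of regularly varying
sequences solves it asymptotically (`tendsto_partMoment`). What remains is to average a sequence of
order `n ^ p` over the bulk. This is a law of large numbers, except that for `p < 0` the values near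
`m = N` are large; the local estimate `local_bound_of_recursion` shows that the point probabilities
there are `o(1/N)` (`tendsto_conv_bulkProb`).

On the limit side, the Mecke formula gives the same recursion for the Poisson process with rate `θ
x⁻¹ e^{-x}`; an exponential tilt and a beta integral pass from the points to their normalized values
(`integral_prod_poissonDirichlet`). Power sums of high order separate decreasing summable sequences,
so by Stone–Weierstrass their polynomials are dense in the continuous functions on a compact set
carrying all the laws (`exists_powSumPoly_near`), and convergence of moments becomes convergence in
law.

The singular expansions enter through two coefficient estimates, `exists_coeff_sub_le` for `θ_j` and
`exists_coeff_le` for `κ_j`, both obtained by integrating over a circle inside the disc of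
convergence. -/

noncomputable section

namespace SurrogateSpatial

/-! ### Convolution of sequences and exponential coefficients -/

/-- The Cauchy product of two sequences. -/
def conv (x y : ℕ → ℝ) (n : ℕ) : ℝ :=
  ∑ p ∈ Finset.HasAntidiagonal.antidiagonal n, x p.1 * y p.2

lemma mk_conv (x y : ℕ → ℝ) :
    PowerSeries.mk (conv x y) = PowerSeries.mk x * PowerSeries.mk y := by
  ext n
  simp [conv, PowerSeries.coeff_mul]

lemma powerSeries_mk_injective {x y : ℕ → ℝ} (h : PowerSeries.mk x = PowerSeries.mk y) : x = y := by
  ext n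
  simpa using congrArg (PowerSeries.coeff n) h

lemma conv_comm (x y : ℕ → ℝ) : conv x y = conv y x :=
  powerSeries_mk_injective (by rw [mk_conv, mk_conv, mul_comm])

lemma conv_assoc (x y z : ℕ → ℝ) : conv (conv x y) z = conv x (conv y z) :=
  powerSeries_mk_injective (by simp only [mk_conv, mul_assoc])

lemma conv_left_comm (x y z : ℕ → ℝ) : conv x (conv y z) = conv y (conv x z) :=
  powerSeries_mk_injective (by simp only [mk_conv, mul_left_comm])

lemma conv_add_left (x y z : ℕ → ℝ) : conv (x + y) z = conv x z + conv y z := by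
  ext n
  simp [conv, add_mul, Finset.sum_add_distrib]

lemma conv_sub_left (x y z : ℕ → ℝ) : conv (x - y) z = conv x z - conv y z := by
  ext n
  simp [conv, sub_mul, Finset.sum_sub_distrib]

lemma conv_sub_right (x y z : ℕ → ℝ) : conv z (x - y) = conv z x - conv z y := by
  rw [conv_comm, conv_sub_left, conv_comm x, conv_comm y]

lemma conv_smul_left (c : ℝ) (x y : ℕ → ℝ) : conv (c • x) y = c • conv x y := by
  ext n
  simp [conv, Finset.mul_sum, mul_assoc]

lemma conv_sum_right {ι : Type*} (s : Finset ι) (x : ℕ → ℝ) (y : ι → ℕ → ℝ) :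
    conv x (∑ i ∈ s, y i) = ∑ i ∈ s, conv x (y i) := by
  ext n
  simp only [conv, Finset.sum_apply, Finset.mul_sum]
  rw [Finset.sum_comm]

lemma conv_smul_right (c : ℝ) (x y : ℕ → ℝ) : conv x (c • y) = c • conv x y := by
  rw [conv_comm, conv_smul_left, conv_comm]

lemma conv_apply (x y : ℕ → ℝ) (n : ℕ) :
    conv x y n = ∑ j ∈ Finset.range (n + 1), x j * y (n - j) :=
  Finset.Nat.sum_antidiagonal_eq_sum_range_succ (fun i j => x i * y j) n

lemma abs_conv_le (x y : ℕ → ℝ) (n : ℕ) :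
    |conv x y n| ≤ conv (fun i => |x i|) (fun i => |y i|) n := by
  refine (Finset.abs_sum_le_sum_abs _ _).trans (le_of_eq ?_)
  simp [conv, abs_mul]

lemma conv_le_conv {x x' y y' : ℕ → ℝ} {n : ℕ} (hx' : ∀ i ≤ n, 0 ≤ x' i)
    (hy : ∀ i ≤ n, 0 ≤ y i)
    (hxx : ∀ i ≤ n, x i ≤ x' i) (hyy : ∀ i ≤ n, y i ≤ y' i) : conv x y n ≤ conv x' y' n := by
  refine Finset.sum_le_sum fun p hp => ?_
  have := Finset.HasAntidiagonal.mem_antidiagonal.1 hp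
  exact mul_le_mul (hxx _ (by omega)) (hyy _ (by omega)) (hy _ (by omega)) (hx' _ (by omega))

/-- The left side sums `x i * y j` over the triangle `i + j < N`, which lies in the square on the
right. -/
lemma sum_conv_le {x y : ℕ → ℝ} (hx : ∀ n, 0 ≤ x n) (hy : ∀ n, 0 ≤ y n) (N : ℕ) :
    ∑ n ∈ Finset.range N, conv x y n ≤
      (∑ n ∈ Finset.range N, x n) * ∑ n ∈ Finset.range N, y n := by
  have : ∑ n ∈ Finset.range N, conv x y n =
      ∑ j ∈ Finset.range N, ∑ n ∈ Finset.range (N - j), x j * y n := by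
    simp only [conv_apply]
    exact Finset.sum_sigma' _ _ _ |>.trans (by
      rw [Finset.sum_sigma']
      refine Finset.sum_bij' (fun p _ => ⟨p.2, p.1 - p.2⟩) (fun p _ => ⟨p.1 + p.2, p.1⟩) ?_ ?_ ?_ ?_ ?_
      · rintro ⟨a, b⟩ h; simp at h ⊢; omega
      · rintro ⟨a, b⟩ h; simp at h ⊢; omega
      · rintro ⟨a, b⟩ h; simp at h ⊢; omega
      · rintro ⟨a, b⟩ h; simp at h ⊢
      · rintro ⟨a, b⟩ h; simp)
  rw [this, Finset.sum_mul_sum]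
  refine Finset.sum_le_sum fun j _ => ?_
  refine Finset.sum_le_sum_of_subset_of_nonneg ?_ fun i _ _ => mul_nonneg (hx _) (hy _)
  exact Finset.range_subset_range.2 (Nat.sub_le _ _)

/-- The sequence `w` with its value at `0` replaced by `0`. -/
def dropZero (w : ℕ → ℝ) (j : ℕ) : ℝ := if j = 0 then 0 else w j

@[simp] lemma dropZero_zero (w : ℕ → ℝ) : dropZero w 0 = 0 := rfl

@[simp] lemma dropZero_succ (w : ℕ → ℝ) (j : ℕ) : dropZero w (j + 1) = w (j + 1) := rfl

lemma dropZero_of_ne (w : ℕ → ℝ) {j : ℕ} (hj : j ≠ 0) : dropZero w j = w j := if_neg hj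

lemma dropZero_nonneg {w : ℕ → ℝ} (hw : ∀ j, 1 ≤ j → 0 ≤ w j) (j : ℕ) : 0 ≤ dropZero w j := by
  cases j with
  | zero => simp
  | succ j => simpa using hw _ (by omega)

/-- The coefficients of `exp (∑_{j ≥ 1} (w j / j) z ^ j)`. -/
def expCoeff (w : ℕ → ℝ) : ℕ → ℝ
  | 0 => 1
  | n + 1 => (∑ j : Fin (n + 1), w (j + 1) * expCoeff w (n - j)) / (n + 1)
decreasing_by omega

@[simp] lemma expCoeff_zero (w : ℕ → ℝ) : expCoeff w 0 = 1 := by simp [expCoeff]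

/-- Coefficient form of `z f' = (∑ w_j z ^ j) f`. With the value at `0` this equation determines the
sequence (`eq_expCoeff`), and the identities for `expCoeff` below are proved by checking it. -/
lemma nat_mul_expCoeff (w : ℕ → ℝ) (n : ℕ) :
    n * expCoeff w n = conv (dropZero w) (expCoeff w) n := by
  cases n with
  | zero => simp [conv]
  | succ n =>
    rw [conv_apply, Finset.sum_range_succ', expCoeff]
    have : ((n : ℝ) + 1) ≠ 0 := by positivity
    push_cast
    rw [mul_div_cancel₀ _ this, Finset.sum_range]
    simp

lemma eq_expCoeff {w x : ℕ → ℝ} (h0 : x 0 = 1)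
    (h : ∀ n : ℕ, n * x n = conv (dropZero w) x n) : x = expCoeff w := by
  ext n
  induction n using Nat.strong_induction_on with
  | _ n ih =>
    cases n with
    | zero => simp [h0]
    | succ n =>
      have h1 := h (n + 1)
      have h2 := nat_mul_expCoeff w (n + 1)
      have : ((n + 1 : ℕ) : ℝ) ≠ 0 := by positivity
      apply mul_left_cancel₀ this
      rw [h1, h2, conv_apply, conv_apply]
      refine Finset.sum_congr rfl fun j _ => ?_
      cases j with
      | zero => simp
      | succ j => rw [ih _ (by omega)]

lemma expCoeff_congr {w w' : ℕ → ℝ} {n : ℕ} (h : ∀ j, 1 ≤ j → j ≤ n → w j = w' j) :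
    expCoeff w n = expCoeff w' n := by
  induction n using Nat.strong_induction_on with
  | _ n ih =>
    cases n with
    | zero => simp
    | succ n =>
      rw [expCoeff, expCoeff]
      congr 1
      refine Finset.sum_congr rfl fun j _ => ?_
      rw [h _ (by omega) (by omega), ih (n - j) (by omega) fun i hi hi' => h i hi (by omega)]

lemma expCoeff_nonneg {w : ℕ → ℝ} (hw : ∀ j, 1 ≤ j → 0 ≤ w j) (n : ℕ) : 0 ≤ expCoeff w n := by
  induction n using Nat.strong_induction_on with
  | _ n ih =>
    cases n with
    | zero => simp
    | succ n =>
      rw [expCoeff]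
      have : 0 ≤ ∑ j : Fin (n + 1), w (j + 1) * expCoeff w (n - j) :=
        Finset.sum_nonneg fun j _ => mul_nonneg (hw _ (by omega)) (ih _ (by omega))
      positivity

lemma abs_expCoeff_le {w w' : ℕ → ℝ} (hw : ∀ j, 1 ≤ j → |w j| ≤ w' j) (n : ℕ) :
    |expCoeff w n| ≤ expCoeff w' n := by
  induction n using Nat.strong_induction_on with
  | _ n ih =>
    cases n with
    | zero => simp
    | succ n =>
      have h1 : (0 : ℝ) < n + 1 := by positivity
      rw [expCoeff, expCoeff, abs_div, abs_of_pos h1]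
      refine div_le_div_of_nonneg_right ((Finset.abs_sum_le_sum_abs _ _).trans ?_) h1.le
      refine Finset.sum_le_sum fun j _ => ?_
      rw [abs_mul]
      have := hw (j + 1) (by omega)
      exact mul_le_mul this (ih _ (by omega)) (abs_nonneg _) ((abs_nonneg _).trans this)

/-- Multiplication by the index is a derivation of the Cauchy product, so the product satisfies the
equation of `nat_mul_expCoeff` for the sum of the weights. -/
lemma expCoeff_add (w w' : ℕ → ℝ) :
    expCoeff (w + w') = conv (expCoeff w) (expCoeff w') := by
  symm
  apply eq_expCoeff
  · simp [conv]
  · intro n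
    have e : dropZero (w + w') = dropZero w + dropZero w' := by
      ext j; cases j <;> simp
    have h1 : (n : ℝ) * conv (expCoeff w) (expCoeff w') n =
        conv (fun i => i * expCoeff w i) (expCoeff w') n +
          conv (expCoeff w) (fun i => i * expCoeff w' i) n := by
      simp only [conv, Finset.mul_sum, ← Finset.sum_add_distrib]
      refine Finset.sum_congr rfl fun p hp => ?_
      rw [← Finset.HasAntidiagonal.mem_antidiagonal.1 hp]
      push_cast
      ring
    rw [h1, funext (nat_mul_expCoeff w), funext (nat_mul_expCoeff w'), e, conv_add_left]
    simp only [Pi.add_apply]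
    rw [conv_assoc, conv_left_comm (expCoeff w)]

lemma expCoeff_scale (w : ℕ → ℝ) (ρ : ℝ) (n : ℕ) :
    expCoeff (fun j => w j * ρ ^ j) n = ρ ^ n * expCoeff w n := by
  have : (fun n => ρ ^ n * expCoeff w n) = expCoeff (fun j => w j * ρ ^ j) := by
    apply eq_expCoeff
    · simp
    · intro n
      rw [mul_left_comm, nat_mul_expCoeff]
      simp only [conv, Finset.mul_sum]
      refine Finset.sum_congr rfl fun p hp => ?_
      rw [← Finset.HasAntidiagonal.mem_antidiagonal.1 hp]
      rcases p with ⟨_ | i, j⟩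
      · simp
      · simp only [dropZero_succ, pow_add]
        ring
  exact (congrFun this n).symm

/-- The coefficients of `exp ((c / j) z ^ j)`. -/
lemma hasSum_expCoeff_single (j : ℕ) (hj : 1 ≤ j) (c : ℝ) :
    HasSum (expCoeff (Pi.single j c)) (Real.exp (c / j)) := by
  have key : (fun n : ℕ => if j ∣ n then (c / j) ^ (n / j) / ((n / j).factorial : ℝ) else 0) =
      expCoeff (Pi.single j c) := by
    apply eq_expCoeff
    · simp
    · intro n
      have hd : dropZero (Pi.single j c) = Pi.single j c := by
        ext i
        by_cases h : i = 0
        · subst h; simp [Pi.single_apply]; intro h; omega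
        · rw [dropZero_of_ne _ h]
      have hj0 : (j : ℝ) ≠ 0 := by positivity
      rw [hd, conv_apply]
      simp only [Pi.single_apply, ite_mul, zero_mul]
      rw [Finset.sum_ite_eq']
      simp only [Finset.mem_range]
      by_cases h : j ∣ n
      · obtain ⟨q, rfl⟩ := h
        cases q with
        | zero => simp; intro h; omega
        | succ q =>
          have h2 : j < j * (q + 1) + 1 := by nlinarith
          have h3 : j * (q + 1) - j = j * q := by rw [Nat.mul_succ]; omega
          rw [if_pos h2, h3]
          simp only [Nat.dvd_mul_right, if_true, Nat.mul_div_cancel_left _ hj, Nat.factorial_succ]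
          push_cast
          rw [pow_succ]
          field_simp
      · have : j < n + 1 → ¬ j ∣ n - j := fun h1 h2 =>
          h (by simpa [Nat.sub_add_cancel (Nat.lt_succ_iff.1 h1)] using dvd_add h2 (dvd_refl j))
        simp only [h, if_false, mul_zero]
        split_ifs with h1 h2
        · exact absurd h2 (this h1)
        · simp
        · rfl
  rw [← key]
  have hinj : Function.Injective (fun q : ℕ => j * q) := fun a b h =>
    Nat.eq_of_mul_eq_mul_left (by omega) h
  rw [← hinj.hasSum_iff]
  · have := NormedSpace.expSeries_div_hasSum_exp (c / j : ℝ)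
    rw [← Real.exp_eq_exp_ℝ] at this
    refine this.congr_fun ?_ |> fun h => h
    intro q
    simp [Nat.mul_div_cancel_left _ (show 0 < j by omega)]
  · intro n hn
    have : ¬ j ∣ n := fun ⟨q, hq⟩ => hn ⟨q, hq.symm⟩
    simp [this]

lemma summable_conv {x y : ℕ → ℝ} (hx : Summable fun n => |x n|) (hy : Summable fun n => |y n|) :
    Summable fun n => |conv x y n| := by
  simp only [← Real.norm_eq_abs] at hx hy ⊢
  exact summable_norm_sum_mul_antidiagonal_of_summable_norm hx hy

lemma tsum_conv {x y : ℕ → ℝ} (hx : Summable fun n => |x n|) (hy : Summable fun n => |y n|) :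
    ∑' n, conv x y n = (∑' n, x n) * ∑' n, y n := by
  simp only [← Real.norm_eq_abs] at hx hy
  exact (tsum_mul_tsum_eq_tsum_sum_antidiagonal_of_summable_norm hx hy).symm

lemma hasSum_expCoeff_finset {w : ℕ → ℝ} (hw : ∀ j, 1 ≤ j → 0 ≤ w j) (J : ℕ) :
    HasSum (expCoeff (fun j => if j ≤ J then w j else 0))
      (Real.exp (∑ j ∈ Finset.Icc 1 J, w j / j)) := by
  induction J with
  | zero =>
    have : expCoeff (fun j => if j ≤ 0 then w j else 0) = Pi.single 0 1 := by
      symm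
      apply eq_expCoeff
      · simp
      · intro n
        have : dropZero (fun j => if j ≤ 0 then w j else 0) = 0 := by
          ext j; cases j <;> simp
        rw [this]
        cases n <;> simp [conv]
    rw [this]
    simpa using hasSum_pi_single (0 : ℕ) (1 : ℝ)
  | succ J ih =>
    have e : (fun j => if j ≤ J + 1 then w j else 0) =
        (fun j => if j ≤ J then w j else 0) + Pi.single (J + 1) (w (J + 1)) := by
      ext j
      simp only [Pi.add_apply, Pi.single_apply]
      rcases lt_trichotomy j (J + 1) with h | h | h
      · simp [h.le, h.ne, Nat.lt_succ_iff.1 h]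
      · subst h; simp
      · have h1 : ¬ j ≤ J + 1 := by omega
        have h2 : ¬ j ≤ J := by omega
        simp [h1, h2, h.ne']
    have h1 := hasSum_expCoeff_single (J + 1) (by omega) (w (J + 1))
    have n1 : ∀ n, 0 ≤ expCoeff (Pi.single (J + 1) (w (J + 1))) n := by
      intro n
      apply expCoeff_nonneg
      intro j _
      rw [Pi.single_apply]
      split_ifs
      · exact hw _ (by omega)
      · exact le_rfl
    have n2 : ∀ n, 0 ≤ expCoeff (fun j => if j ≤ J then w j else 0) n := by
      intro n
      apply expCoeff_nonneg
      intro j hj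
      split_ifs
      · exact hw _ hj
      · exact le_rfl
    have s1 : Summable fun n => |expCoeff (Pi.single (J + 1) (w (J + 1))) n| := by
      simpa only [abs_of_nonneg (n1 _)] using h1.summable
    have s2 : Summable fun n => |expCoeff (fun j => if j ≤ J then w j else 0) n| := by
      simpa only [abs_of_nonneg (n2 _)] using ih.summable
    rw [e, expCoeff_add, Finset.sum_Icc_succ_top (by omega), Real.exp_add,
      ← h1.tsum_eq, ← ih.tsum_eq, ← tsum_conv s2 s1]
    exact (summable_abs_iff.1 (summable_conv s2 s1)).hasSum

/-- The coefficients below index `n` only see the weights up to `n`, so each partial sum is at most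
the total mass for truncated weights, which is an explicit exponential. -/
lemma summable_expCoeff {w : ℕ → ℝ} (hw : ∀ j, 1 ≤ j → 0 ≤ w j)
    (hs : Summable fun j : ℕ => w j / j) : Summable (expCoeff w) := by
  refine summable_of_sum_range_le (c := Real.exp (∑' j : ℕ, w j / j)) (expCoeff_nonneg hw) ?_
  intro n
  have n2 : ∀ m, 0 ≤ expCoeff (fun j => if j ≤ n then w j else 0) m := by
    intro m
    apply expCoeff_nonneg
    intro j hj
    split_ifs
    · exact hw _ hj
    · exact le_rfl
  have h := hasSum_expCoeff_finset hw n
  calc ∑ m ∈ Finset.range n, expCoeff w m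
      = ∑ m ∈ Finset.range n, expCoeff (fun j => if j ≤ n then w j else 0) m := by
        refine Finset.sum_congr rfl fun m hm => expCoeff_congr fun j _ hj => ?_
        have := Finset.mem_range.1 hm
        rw [if_pos (by omega)]
    _ ≤ Real.exp (∑ j ∈ Finset.Icc 1 n, w j / j) := by
        rw [← h.tsum_eq]
        exact h.summable.sum_le_tsum _ fun m _ => n2 m
    _ ≤ _ := by
        apply Real.exp_le_exp.2
        refine hs.sum_le_tsum _ fun j _ => ?_
        rcases Nat.eq_zero_or_pos j with h | h
        · simp [h]
        · exact div_nonneg (hw j h) (by positivity)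

/-! ### Regularly varying sequences and their convolutions -/

lemma tendsto_natCast_sub_div (j : ℕ) :
    Tendsto (fun n : ℕ => ((n - j : ℕ) : ℝ) / n) atTop (𝓝 1) := by
  have h : Tendsto (fun n : ℕ => 1 - (j : ℝ) / n) atTop (𝓝 (1 - 0)) :=
    tendsto_const_nhds.sub (tendsto_const_div_atTop_nhds_zero_nat _)
  rw [sub_zero] at h
  refine h.congr' ?_
  filter_upwards [eventually_gt_atTop j] with n hn
  have : (n : ℝ) ≠ 0 := by
    have : n ≠ 0 := by omega
    exact_mod_cast this
  rw [Nat.cast_sub hn.le]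
  field_simp

lemma tendsto_div_rpow_shift {x : ℕ → ℝ} {p A : ℝ}
    (hx : Tendsto (fun n : ℕ => x n / (n : ℝ) ^ p) atTop (𝓝 A)) (j : ℕ) :
    Tendsto (fun n : ℕ => x (n - j) / (n : ℝ) ^ p) atTop (𝓝 A) := by
  have h1 := hx.comp (tendsto_sub_atTop_nat j)
  have h2 : Tendsto (fun n : ℕ => (((n - j : ℕ) : ℝ) / n) ^ p) atTop (𝓝 (1 ^ p)) :=
    (tendsto_natCast_sub_div j).rpow_const (Or.inl one_ne_zero)
  rw [Real.one_rpow] at h2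
  have h3 := h1.mul h2
  rw [mul_one] at h3
  refine h3.congr' ?_
  filter_upwards [eventually_gt_atTop j] with n hn
  have hp : (0 : ℝ) < ((n - j : ℕ) : ℝ) := by
    have : 0 < n - j := by omega
    exact_mod_cast this
  have : (0 : ℝ) < ((n - j : ℕ) : ℝ) ^ p := Real.rpow_pos_of_pos hp _
  simp only [Function.comp]
  rw [Real.div_rpow (by positivity) (by positivity)]
  field_simp

lemma exists_abs_le_rpow {x : ℕ → ℝ} {p A : ℝ} (hp : 0 ≤ p)
    (hx : Tendsto (fun n : ℕ => x n / (n : ℝ) ^ p) atTop (𝓝 A)) :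
    ∃ C, 0 ≤ C ∧ ∀ n : ℕ, 1 ≤ n → ∀ i ≤ n, |x i| ≤ C * (n : ℝ) ^ p := by
  obtain ⟨C, hC⟩ := (Metric.isBounded_range_of_tendsto _ hx).exists_norm_le
  have hC0 : 0 ≤ C := (norm_nonneg _).trans (hC _ ⟨0, rfl⟩)
  -- The term `|x 0|` covers `i = 0`, where the bounded quotient says nothing when `p > 0`, since
  -- then `0 ^ p = 0`.
  refine ⟨C + |x 0|, by positivity, fun n hn i hi => ?_⟩
  have hn1 : (1 : ℝ) ≤ n := by exact_mod_cast hn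
  have hn' : 1 ≤ (n : ℝ) ^ p := Real.one_le_rpow hn1 hp
  rcases Nat.eq_zero_or_pos i with h | h
  · subst h
    nlinarith [abs_nonneg (x 0)]
  · have h1 := hC _ ⟨i, rfl⟩
    have h2 : (0 : ℝ) < (i : ℝ) ^ p := Real.rpow_pos_of_pos (by exact_mod_cast h) _
    simp only [Real.norm_eq_abs, abs_div, abs_of_pos h2] at h1
    rw [div_le_iff₀ h2] at h1
    have h3 : (i : ℝ) ^ p ≤ (n : ℝ) ^ p :=
      Real.rpow_le_rpow (by positivity) (by exact_mod_cast hi) hp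
    nlinarith [abs_nonneg (x 0)]

lemma summable_conv_term_eq (e y : ℕ → ℝ) (n : ℕ) :
    conv e y n = ∑' j, if j ≤ n then e j * y (n - j) else 0 := by
  rw [conv_apply, tsum_eq_sum (s := Finset.range (n + 1))]
  · refine Finset.sum_congr rfl fun j hj => ?_
    rw [if_pos (by simpa [Nat.lt_succ_iff] using hj)]
  · intro j hj
    rw [if_neg (by simpa [Nat.lt_succ_iff] using hj)]

/-- Dominated convergence in the sum over `j` of `e j * y (n - j) / n ^ p`. The sign condition on
`p` gives the domination: all of `y 0, …, y n` are then `O(n ^ p)`. -/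
lemma tendsto_conv_summable_div_rpow {e y : ℕ → ℝ} {p A : ℝ} (hp : 0 ≤ p)
    (he : Summable fun n => |e n|)
    (hy : Tendsto (fun n : ℕ => y n / (n : ℝ) ^ p) atTop (𝓝 A)) :
    Tendsto (fun n : ℕ => conv e y n / (n : ℝ) ^ p) atTop (𝓝 ((∑' j, e j) * A)) := by
  obtain ⟨C, hC0, hC⟩ := exists_abs_le_rpow hp hy
  have key : Tendsto (fun n : ℕ => ∑' j, (if j ≤ n then e j * (y (n - j) / (n : ℝ) ^ p) else 0))
      atTop (𝓝 (∑' j, e j * A)) := by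
    refine tendsto_tsum_of_dominated_convergence (bound := fun j => |e j| * C)
      (he.mul_right C) ?_ ?_
    · intro j
      refine ((tendsto_div_rpow_shift hy j).const_mul (e j)).congr' ?_
      filter_upwards [eventually_ge_atTop j] with n hn
      rw [if_pos hn]
    · filter_upwards [eventually_ge_atTop 1] with n hn j
      have h2 : (0 : ℝ) < (n : ℝ) ^ p := Real.rpow_pos_of_pos (by exact_mod_cast hn) _
      split_ifs with h
      · rw [Real.norm_eq_abs, abs_mul, abs_div, abs_of_pos h2]
        refine mul_le_mul_of_nonneg_left ?_ (abs_nonneg _)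
        rw [div_le_iff₀ h2]
        exact hC n hn _ (Nat.sub_le _ _)
      · simp only [norm_zero]; positivity
  rw [tsum_mul_right] at key
  refine key.congr fun n => ?_
  rw [summable_conv_term_eq, ← tsum_div_const]
  refine tsum_congr fun j => ?_
  split_ifs <;> ring

/-- The coefficients `Γ(n + α) / (Γ(α) n!)` of `(1 - z) ^ (-α)`. -/
def powCoeff (α : ℝ) : ℕ → ℝ := expCoeff fun _ => α

lemma powCoeff_succ (α : ℝ) (n : ℕ) :
    (n + 1) * powCoeff α (n + 1) = (n + α) * powCoeff α n := by
  have h (n : ℕ) : n * powCoeff α n = α * ∑ j ∈ Finset.range n, powCoeff α j := by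
    rw [powCoeff, nat_mul_expCoeff, conv_comm, conv_apply, Finset.sum_range_succ, Finset.mul_sum]
    simp only [Nat.sub_self, dropZero_zero, mul_zero, add_zero]
    refine Finset.sum_congr rfl fun j hj => ?_
    have := Finset.mem_range.1 hj
    rw [dropZero_of_ne _ (by omega)]
    ring
  have h1 := h (n + 1)
  rw [Finset.sum_range_succ, mul_add, ← h n] at h1
  push_cast at h1
  rw [h1]
  ring

lemma powCoeff_add (α β : ℝ) : conv (powCoeff α) (powCoeff β) = powCoeff (α + β) := by
  rw [powCoeff, powCoeff, powCoeff, ← expCoeff_add]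
  rfl

lemma powCoeff_eq (α : ℝ) (n : ℕ) :
    powCoeff α n = (∏ i ∈ Finset.range n, (α + i)) / n.factorial := by
  induction n with
  | zero => simp [powCoeff]
  | succ n ih =>
    have h := powCoeff_succ α n
    have h1 : ((n : ℝ) + 1) ≠ 0 := by positivity
    apply mul_left_cancel₀ h1
    rw [h, ih, Finset.prod_range_succ, Nat.factorial_succ]
    push_cast
    field_simp
    ring

lemma powCoeff_pos {α : ℝ} (hα : 0 < α) (n : ℕ) : 0 < powCoeff α n := by
  rw [powCoeff_eq]
  have : 0 < ∏ i ∈ Finset.range n, (α + i) := Finset.prod_pos fun i _ => by positivity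
  positivity

/-- Euler's limit formula for `Γ`: the quotient equals `1 / (GammaSeq α n * (1 + α / n))`. -/
lemma tendsto_powCoeff {α : ℝ} (hα : 0 < α) :
    Tendsto (fun n : ℕ => powCoeff α n / (n : ℝ) ^ (α - 1)) atTop (𝓝 (1 / Real.Gamma α)) := by
  have h1 := Real.GammaSeq_tendsto_Gamma α
  have h2 : Tendsto (fun n : ℕ => 1 + α / n) atTop (𝓝 (1 + 0)) :=
    tendsto_const_nhds.add (tendsto_const_div_atTop_nhds_zero_nat _)
  have hΓ := (Real.Gamma_pos_of_pos hα).ne'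
  have h3 := tendsto_const_nhds (x := (1 : ℝ)) |>.div (h1.mul h2) (by simpa using hΓ)
  simp only [add_zero, mul_one] at h3
  refine h3.congr' ?_
  filter_upwards [eventually_ge_atTop 1] with n hn
  have hn' : (0 : ℝ) < n := by exact_mod_cast hn
  have hprod : 0 < ∏ i ∈ Finset.range n, (α + i) := Finset.prod_pos fun i _ => by positivity
  have hfac : (0 : ℝ) < n.factorial := by positivity
  simp only [Pi.div_apply, Real.GammaSeq]
  rw [powCoeff_eq, Finset.prod_range_succ, Real.rpow_sub hn', Real.rpow_one]
  have : 0 < (n : ℝ) ^ α := Real.rpow_pos_of_pos hn' _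
  have h4 : α + n ≠ 0 := by positivity
  field_simp
  ring

lemma isBigO_powCoeff {x : ℕ → ℝ} {α A : ℝ} (hα : 0 < α)
    (hx : Tendsto (fun n : ℕ => x n / (n : ℝ) ^ (α - 1)) atTop (𝓝 A)) :
    ∃ C, 0 ≤ C ∧ ∀ n, |x n| ≤ C * powCoeff α n := by
  have hΓ := Real.Gamma_pos_of_pos hα
  have h := hx.div (tendsto_powCoeff hα) (by positivity)
  have h' : Tendsto (fun n => x n / powCoeff α n) atTop (𝓝 (A / (1 / Real.Gamma α))) := by
    refine h.congr' ?_
    filter_upwards [eventually_ge_atTop 1] with n hn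
    have : 0 < (n : ℝ) ^ (α - 1) := Real.rpow_pos_of_pos (by exact_mod_cast hn) _
    simp only [Pi.div_apply]
    field_simp
  obtain ⟨C, hC⟩ := (Metric.isBounded_range_of_tendsto _ h').exists_norm_le
  refine ⟨C, (norm_nonneg _).trans (hC _ ⟨0, rfl⟩), fun n => ?_⟩
  have h1 := hC _ ⟨n, rfl⟩
  rw [Real.norm_eq_abs, abs_div, abs_of_pos (powCoeff_pos hα n)] at h1
  rwa [div_le_iff₀ (powCoeff_pos hα n)] at h1

/-- Comparison with the exact model `powCoeff`, for which convolution adds the exponents. Up to a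
finitely supported `z`, `|x|` is at most a small multiple of `powCoeff α`, and `|y|` is at most a
multiple of `powCoeff β`. The finitely many terms of `z` contribute only `O(n ^ (β - 1))`. Working
with the model avoids estimates near the two ends of the sum, where the powers may be singular. -/
lemma tendsto_conv_zero {x y : ℕ → ℝ} {α β B : ℝ} (hα : 0 < α) (hβ : 0 < β)
    (hx : Tendsto (fun n : ℕ => x n / (n : ℝ) ^ (α - 1)) atTop (𝓝 0))
    (hy : Tendsto (fun n : ℕ => y n / (n : ℝ) ^ (β - 1)) atTop (𝓝 B)) :
    Tendsto (fun n : ℕ => conv x y n / (n : ℝ) ^ (α + β - 1)) atTop (𝓝 0) := by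
  obtain ⟨C, hC0, hC⟩ := isBigO_powCoeff hβ hy
  have hΓ := Real.Gamma_pos_of_pos hα
  have hαβ : 0 < α + β := by positivity
  obtain ⟨K, hK0, hK⟩ := exists_abs_le_rpow (x := fun n => powCoeff (α + β) n / (n : ℝ) ^ (α + β - 1))
    (p := 0) le_rfl (by simpa using tendsto_powCoeff hαβ)
  rw [Metric.tendsto_atTop]
  intro ε hε
  -- choose the proportion for the tail of `x`
  set ε' := ε / (2 * (C * K + 1)) with hε'
  have hε'0 : 0 < ε' := by positivity
  have hev : ∀ᶠ n : ℕ in atTop, |x n| ≤ ε' * powCoeff α n := by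
    have h := hx.div (tendsto_powCoeff hα) (by positivity)
    rw [zero_div] at h
    have := (h.abs).eventually (gt_mem_nhds (show |(0 : ℝ)| < ε' by simpa using hε'0))
    filter_upwards [this, eventually_ge_atTop 1] with n h hn
    have h2 : 0 < (n : ℝ) ^ (α - 1) := Real.rpow_pos_of_pos (by exact_mod_cast hn) _
    have h3 := powCoeff_pos hα n
    have e : (x n / (n : ℝ) ^ (α - 1)) / (powCoeff α n / (n : ℝ) ^ (α - 1)) = x n / powCoeff α n := by
      field_simp
    simp only [Pi.div_apply] at h
    rw [e, abs_div, abs_of_pos h3, div_lt_iff₀ h3] at h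
    exact h.le
  obtain ⟨n₀, hn₀⟩ := eventually_atTop.1 hev
  set z : ℕ → ℝ := fun j => if j < n₀ then |x j| else 0 with hz
  have hxz : ∀ n, |x n| ≤ (ε' • powCoeff α + z) n := by
    intro n
    have h1 := powCoeff_pos hα n
    simp only [Pi.add_apply, Pi.smul_apply, smul_eq_mul, hz]
    split_ifs with h
    · nlinarith
    · simpa using hn₀ n (not_lt.1 h)
  have hz0 : ∀ n, 0 ≤ z n := fun n => by simp only [hz]; split_ifs <;> positivity
  have hle : ∀ n, |conv x y n| ≤ C * (ε' * powCoeff (α + β) n + conv z (powCoeff β) n) := by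
    intro n
    have : conv (ε' • powCoeff α + z) (C • powCoeff β) n =
        C * (ε' * powCoeff (α + β) n + conv z (powCoeff β) n) := by
      rw [conv_add_left, conv_smul_right, conv_smul_left, conv_smul_right, powCoeff_add]
      simp only [Pi.add_apply, Pi.smul_apply, smul_eq_mul]
      ring
    rw [← this]
    refine (abs_conv_le x y n).trans (conv_le_conv ?_ ?_ ?_ ?_)
    · exact fun i _ => (abs_nonneg _).trans (hxz i)
    · exact fun i _ => abs_nonneg _
    · exact fun i _ => hxz i
    · exact fun i _ => hC i
  have hzt : Tendsto (fun n : ℕ => conv z (powCoeff β) n / (n : ℝ) ^ (α + β - 1)) atTop (𝓝 0) := by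
    have h1 : ∀ j, Tendsto (fun n : ℕ => powCoeff β (n - j) / (n : ℝ) ^ (α + β - 1)) atTop
        (𝓝 0) := by
      intro j
      have h1 := tendsto_div_rpow_shift (tendsto_powCoeff hβ) j
      have h2 := (tendsto_rpow_neg_atTop hα).comp tendsto_natCast_atTop_atTop
      have h3 := h1.mul h2
      rw [mul_zero] at h3
      refine h3.congr' ?_
      filter_upwards [eventually_ge_atTop 1] with n hn
      have hn' : (0 : ℝ) < n := by exact_mod_cast hn
      have : α + β - 1 = (β - 1) + α := by ring
      simp only [Function.comp]
      rw [this, Real.rpow_add hn', Real.rpow_neg hn'.le]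
      field_simp
    have h2 : Tendsto (fun n : ℕ => ∑ j ∈ Finset.range n₀,
        z j * (powCoeff β (n - j) / (n : ℝ) ^ (α + β - 1))) atTop (𝓝 0) := by
      have := tendsto_finsetSum (Finset.range n₀) fun j _ => (h1 j).const_mul (z j)
      simpa using this
    refine h2.congr' ?_
    filter_upwards [eventually_ge_atTop n₀] with n hn
    rw [conv_apply, Finset.sum_div]
    have hsub : Finset.range n₀ ⊆ Finset.range (n + 1) := Finset.range_subset_range.2 (by omega)
    rw [← Finset.sum_subset hsub]
    · exact Finset.sum_congr rfl fun j _ => by ring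
    · intro j _ hj
      have : ¬ j < n₀ := by simpa using hj
      simp [hz, this]
  have hzt' := (hzt.const_mul C).eventually (gt_mem_nhds (show C * 0 < ε / 2 by simpa using by positivity))
  obtain ⟨n₁, hn₁⟩ := eventually_atTop.1 (hzt'.and (eventually_ge_atTop 1))
  refine ⟨n₁, fun n hn => ?_⟩
  obtain ⟨ha, hb⟩ := hn₁ n hn
  have hpos : 0 < (n : ℝ) ^ (α + β - 1) := Real.rpow_pos_of_pos (by exact_mod_cast hb) _
  rw [Real.dist_eq, sub_zero, abs_div, abs_of_pos hpos]
  have hb1 : powCoeff (α + β) n / (n : ℝ) ^ (α + β - 1) ≤ K := by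
    have := hK n hb n le_rfl
    rw [Real.rpow_zero, mul_one] at this
    exact (le_abs_self _).trans this
  calc |conv x y n| / (n : ℝ) ^ (α + β - 1)
      ≤ C * (ε' * powCoeff (α + β) n + conv z (powCoeff β) n) / (n : ℝ) ^ (α + β - 1) := by
        gcongr
        exact hle n
    _ = (C * ε') * (powCoeff (α + β) n / (n : ℝ) ^ (α + β - 1)) +
        C * (conv z (powCoeff β) n / (n : ℝ) ^ (α + β - 1)) := by ring
    _ < (C * ε') * K + ε / 2 := by
        refine add_lt_add_of_le_of_lt ?_ ha
        gcongr
    _ ≤ ε := by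
        have : C * ε' * K = ε / 2 * (C * K / (C * K + 1)) := by
          rw [hε']; field_simp
        rw [this]
        have h5 : C * K / (C * K + 1) ≤ 1 := by
          rw [div_le_one (by positivity)]; linarith
        nlinarith

/-- Subtract from each sequence its multiple of `powCoeff`: the remainders are negligible by
`tendsto_conv_zero`, and the product of the models is exact by `powCoeff_add`. -/
lemma tendsto_conv_div_rpow {x y : ℕ → ℝ} {α β A B : ℝ} (hα : 0 < α) (hβ : 0 < β)
    (hx : Tendsto (fun n : ℕ => x n / (n : ℝ) ^ (α - 1)) atTop (𝓝 (A / Real.Gamma α)))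
    (hy : Tendsto (fun n : ℕ => y n / (n : ℝ) ^ (β - 1)) atTop (𝓝 (B / Real.Gamma β))) :
    Tendsto (fun n : ℕ => conv x y n / (n : ℝ) ^ (α + β - 1)) atTop
      (𝓝 (A * B / Real.Gamma (α + β))) := by
  have hd {x : ℕ → ℝ} {α A : ℝ} (hα : 0 < α)
      (hx : Tendsto (fun n : ℕ => x n / (n : ℝ) ^ (α - 1)) atTop (𝓝 (A / Real.Gamma α))) :
      Tendsto (fun n : ℕ => (x - A • powCoeff α) n / (n : ℝ) ^ (α - 1)) atTop (𝓝 0) := by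
    have h := hx.sub ((tendsto_powCoeff hα).const_mul A)
    rw [mul_one_div, sub_self] at h
    refine h.congr fun n => ?_
    simp only [Pi.sub_apply, Pi.smul_apply, smul_eq_mul]
    ring
  have h1 := tendsto_conv_zero hα hβ (hd hα hx) hy
  have h2 := tendsto_conv_zero hβ hα (hd hβ hy) (tendsto_powCoeff hα)
  have h3 := tendsto_powCoeff (show 0 < α + β by positivity)
  have h4 := (h1.add (h2.const_mul A)).add (h3.const_mul (A * B))
  rw [mul_zero, zero_add, zero_add, mul_one_div] at h4
  refine h4.congr fun n => ?_
  have e : conv x y n = conv (x - A • powCoeff α) y n + A * conv (y - B • powCoeff β) (powCoeff α) n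
      + A * B * powCoeff (α + β) n := by
    rw [conv_sub_left, conv_sub_left, conv_smul_left, conv_smul_left, powCoeff_add, conv_comm y,
      add_comm β]
    simp only [Pi.sub_apply, Pi.smul_apply, smul_eq_mul]
    ring
  rw [e, add_comm β]
  ring

/-- The recursion writes `n * expCoeff c n` as the convolution of a null sequence with a summable
one. -/
lemma tendsto_expCoeff_nat_mul {c : ℕ → ℝ} (hc : Tendsto c atTop (𝓝 0))
    (hs : Summable fun j : ℕ => |c j| / j) :
    Tendsto (fun n : ℕ => (n : ℝ) * expCoeff c n) atTop (𝓝 0) := by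
  have hsum : Summable (fun n => |expCoeff c n|) :=
    Summable.of_nonneg_of_le (fun n => abs_nonneg _)
      (abs_expCoeff_le (w' := fun j => |c j|) fun j _ => le_rfl)
      (summable_expCoeff (fun j _ => abs_nonneg _) hs)
  have hd : Tendsto (dropZero c) atTop (𝓝 0) := by
    refine hc.congr' ?_
    filter_upwards [eventually_gt_atTop 0] with n hn
    rw [dropZero_of_ne _ hn.ne']
  have h := tendsto_conv_summable_div_rpow (p := 0) le_rfl hsum (y := dropZero c) (A := 0)
    (by simpa using hd)
  simp only [Real.rpow_zero, div_one, mul_zero] at h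
  refine h.congr fun n => ?_
  rw [conv_comm, nat_mul_expCoeff]

/-- If `b j → θ` fast enough, the coefficients of `exp (∑ (b j / j) z ^ j)` behave like a
positive multiple of `n ^ (θ - 1)`. -/
theorem exists_tendsto_expCoeff_div_rpow {b : ℕ → ℝ} {θ : ℝ} (hθ : 0 < θ)
    (hb0 : ∀ j, 1 ≤ j → 0 ≤ b j) (hb : Tendsto b atTop (𝓝 θ))
    (hs : Summable fun j : ℕ => |b j - θ| / j) :
    ∃ c, 0 < c ∧ Tendsto (fun n : ℕ => expCoeff b n / (n : ℝ) ^ (θ - 1)) atTop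
      (𝓝 (c / Real.Gamma θ)) := by
  -- Factor the exponential as `(1 - z) ^ (-θ)` times `∑ e n z ^ n`. The second series converges
  -- absolutely at `1`, and its value there is the constant `c` of the statement.
  set e := expCoeff fun j => b j - θ with he
  have hΓ := Real.Gamma_pos_of_pos hθ
  have habs {c : ℕ → ℝ} (hs : Summable fun j : ℕ => |c j| / j) :
      Summable (fun n => |expCoeff c n|) :=
    Summable.of_nonneg_of_le (fun n => abs_nonneg _)
      (abs_expCoeff_le (w' := fun j => |c j|) fun j _ => le_rfl)
      (summable_expCoeff (fun j _ => abs_nonneg _) hs)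
  have hsum : Summable fun n => |e n| := habs hs
  -- The series of the opposite weights also converges absolutely, and the product of the two values
  -- is `1`.
  have hne : ∑' n, e n ≠ 0 := by
    intro h0
    have hsum' : Summable fun n => |expCoeff (fun j => -(b j - θ)) n| :=
      habs (by simpa only [abs_neg] using hs)
    have h := tsum_conv hsum hsum'
    have hz : (fun j => b j - θ) + (fun j => -(b j - θ)) = fun j => 0 := by ext; simp
    rw [h0, zero_mul, he, ← expCoeff_add, hz] at h
    have h1 : expCoeff (fun _ => (0 : ℝ)) = Pi.single 0 1 := by
      symm
      apply eq_expCoeff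
      · simp
      · intro n
        have : dropZero (fun _ => (0 : ℝ)) = 0 := by ext j; cases j <;> simp
        rw [this]
        cases n <;> simp [conv]
    rw [h1] at h
    have h2 := (hasSum_pi_single (0 : ℕ) (1 : ℝ)).tsum_eq
    linarith
  have hconv : expCoeff b = conv e (powCoeff θ) := by
    rw [he, powCoeff, ← expCoeff_add]
    congr 1
    ext j
    simp
  have hlim : Tendsto (fun n : ℕ => expCoeff b n / (n : ℝ) ^ (θ - 1)) atTop
      (𝓝 ((∑' n, e n) / Real.Gamma θ)) := by
    -- `θ - 1` may be negative, outside the range of `tendsto_conv_summable_div_rpow`. The sequence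
    -- is therefore multiplied by `n`, which is spread over the two factors by the Leibniz rule.
    have h1 : Tendsto (fun n : ℕ => ((n : ℝ) * powCoeff θ n) / (n : ℝ) ^ θ) atTop
        (𝓝 (1 / Real.Gamma θ)) := by
      refine (tendsto_powCoeff hθ).congr' ?_
      filter_upwards [eventually_ge_atTop 1] with n hn
      have hn' : (0 : ℝ) < n := by exact_mod_cast hn
      rw [Real.rpow_sub hn', Real.rpow_one]
      field_simp
    have h2 := tendsto_conv_summable_div_rpow hθ.le hsum h1
    have h3 : Tendsto (fun n : ℕ => ((n : ℝ) * e n) / (n : ℝ) ^ ((1 : ℝ) - 1)) atTop (𝓝 0) := by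
      simp only [sub_self, Real.rpow_zero, div_one]
      refine tendsto_expCoeff_nat_mul ?_ hs
      simpa using hb.sub_const θ
    have h4 := tendsto_conv_zero one_pos hθ h3 (tendsto_powCoeff hθ)
    have h5 := h2.add h4
    rw [add_zero, mul_one_div] at h5
    refine h5.congr' ?_
    filter_upwards [eventually_ge_atTop 1] with n hn
    have hn' : (0 : ℝ) < n := by exact_mod_cast hn
    have e1 : (n : ℝ) * expCoeff b n = conv e (fun n => (n : ℝ) * powCoeff θ n) n +
        conv (fun n => (n : ℝ) * e n) (powCoeff θ) n := by
      rw [hconv]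
      simp only [conv, Finset.mul_sum, ← Finset.sum_add_distrib]
      refine Finset.sum_congr rfl fun p hp => ?_
      rw [← Finset.HasAntidiagonal.mem_antidiagonal.1 hp]
      push_cast
      ring
    have e2 : (1 : ℝ) + θ - 1 = θ := by ring
    rw [e2, ← add_div, ← e1, Real.rpow_sub hn', Real.rpow_one]
    field_simp
  refine ⟨_, ?_, hlim⟩
  -- The sign of the limit comes from the nonnegativity of the coefficients; it is nonzero by `hne`.
  have hge : 0 ≤ (∑' n, e n) / Real.Gamma θ := by
    refine ge_of_tendsto' hlim fun n => ?_
    have := expCoeff_nonneg hb0 n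
    positivity
  rcases (div_nonneg_iff.1 hge) with h | h
  · exact lt_of_le_of_ne h.1 (Ne.symm hne)
  · exact absurd h.2 (not_le.2 hΓ)

/-! ### Concentration of compound Poisson sequences -/

lemma sq_le_two_mul_two_pow (m : ℕ) : m ^ 2 ≤ 2 * 2 ^ m := by
  induction m with
  | zero => simp
  | succ m ih =>
    rcases Nat.lt_or_ge m 3 with h | h
    · interval_cases m <;> norm_num
    · rw [pow_succ 2]
      nlinarith

section FiniteSupport

variable {w : ℕ → ℝ} {J : ℕ}

lemma expCoeff_eq_truncate (hJ : ∀ j, J < j → w j = 0) :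
    expCoeff w = expCoeff (fun j => if j ≤ J then w j else 0) := by
  congr 1
  ext j
  split_ifs with h
  · rfl
  · exact hJ j (not_le.1 h)

lemma summable_expCoeff_of_finite (hw : ∀ j, 1 ≤ j → 0 ≤ w j) (hJ : ∀ j, J < j → w j = 0) :
    Summable (expCoeff w) := by
  rw [expCoeff_eq_truncate hJ]
  exact (hasSum_expCoeff_finset hw J).summable

/-- Replacing `w j` by `w j * 2 ^ j` multiplies the `m`-th coefficient by `2 ^ m`, which dominates
`m ^ 2` up to a factor `2`. -/
lemma summable_sq_mul_expCoeff (hw : ∀ j, 1 ≤ j → 0 ≤ w j) (hJ : ∀ j, J < j → w j = 0) :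
    Summable fun m : ℕ => (m : ℝ) ^ 2 * expCoeff w m := by
  have h := summable_expCoeff_of_finite (w := fun j => w j * 2 ^ j) (J := J)
    (fun j hj => mul_nonneg (hw j hj) (by positivity)) fun j hj => by simp [hJ j hj]
  refine Summable.of_nonneg_of_le (fun m => mul_nonneg (by positivity) (expCoeff_nonneg hw m))
    (fun m => ?_) (h.mul_left 2)
  rw [expCoeff_scale, ← mul_assoc]
  refine mul_le_mul_of_nonneg_right ?_ (expCoeff_nonneg hw m)
  exact_mod_cast sq_le_two_mul_two_pow m

lemma summable_mul_expCoeff (hw : ∀ j, 1 ≤ j → 0 ≤ w j) (hJ : ∀ j, J < j → w j = 0) :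
    Summable fun m : ℕ => (m : ℝ) * expCoeff w m := by
  refine Summable.of_nonneg_of_le (fun m => mul_nonneg (by positivity) (expCoeff_nonneg hw m))
    (fun m => ?_) (summable_sq_mul_expCoeff hw hJ)
  refine mul_le_mul_of_nonneg_right ?_ (expCoeff_nonneg hw m)
  exact_mod_cast Nat.le_self_pow (by norm_num) m

lemma summable_dropZero_mul (hJ : ∀ j, J < j → w j = 0) (f : ℕ → ℝ) :
    Summable fun j => |f j * dropZero w j| := by
  refine summable_of_ne_finset_zero (s := Finset.range (J + 1)) fun j hj => ?_
  have : J < j := by simpa using hj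
  rw [dropZero_of_ne _ (by omega), hJ j this]
  simp

/-- The normalized sequence is a compound Poisson law with mean `∑ w_j` and variance `∑ j w_j`.
Summing the recursion `m p_m = (w * p)_m` gives the mean; summing it against `m = j + (m - j)` gives
the second moment. -/
lemma tsum_sq_sub_mul_expCoeff (hw : ∀ j, 1 ≤ j → 0 ≤ w j) (hJ : ∀ j, J < j → w j = 0) :
    Summable (fun m : ℕ => ((m : ℝ) - ∑' j, dropZero w j) ^ 2 * expCoeff w m) ∧
    ∑' m : ℕ, ((m : ℝ) - ∑' j, dropZero w j) ^ 2 * expCoeff w m =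
      (∑' j : ℕ, (j : ℝ) * dropZero w j) * ∑' m, expCoeff w m := by
  have hq := expCoeff_nonneg hw
  have s0 := summable_expCoeff_of_finite hw hJ
  have s1 := summable_mul_expCoeff hw hJ
  have s2 := summable_sq_mul_expCoeff hw hJ
  have a0 : Summable fun m => |expCoeff w m| := summable_abs_iff.2 s0
  have a1 : Summable fun m : ℕ => |(m : ℝ) * expCoeff w m| := summable_abs_iff.2 s1
  have w0 : Summable fun j => |dropZero w j| := by simpa using summable_dropZero_mul hJ 1
  have w1 : Summable fun j : ℕ => |(j : ℝ) * dropZero w j| := summable_dropZero_mul hJ fun j => j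
  set μ := ∑' j, dropZero w j with hμ
  set Z := ∑' m, expCoeff w m with hZ
  have e1 : ∑' m : ℕ, (m : ℝ) * expCoeff w m = μ * Z := by
    rw [hμ, hZ, ← tsum_conv w0 a0]
    exact tsum_congr (nat_mul_expCoeff w)
  have e2 : ∑' m : ℕ, (m : ℝ) ^ 2 * expCoeff w m =
      (∑' j : ℕ, (j : ℝ) * dropZero w j) * Z + μ * (μ * Z) := by
    rw [← e1, hμ, hZ, ← tsum_conv w0 a1, ← tsum_conv w1 a0,
      ← (summable_abs_iff.1 (summable_conv w1 a0)).tsum_add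
        (summable_abs_iff.1 (summable_conv w0 a1))]
    refine tsum_congr fun m => ?_
    rw [pow_two, mul_assoc, nat_mul_expCoeff]
    simp only [conv, Finset.mul_sum, ← Finset.sum_add_distrib]
    refine Finset.sum_congr rfl fun p hp => ?_
    rw [← Finset.HasAntidiagonal.mem_antidiagonal.1 hp]
    push_cast
    ring
  have hexp : (fun m : ℕ => ((m : ℝ) - μ) ^ 2 * expCoeff w m) = fun m : ℕ =>
      (m : ℝ) ^ 2 * expCoeff w m - 2 * μ * ((m : ℝ) * expCoeff w m) + μ ^ 2 * expCoeff w m := by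
    ext m; ring
  have hs := (s2.sub (s1.mul_left (2 * μ))).add (s0.mul_left (μ ^ 2))
  refine ⟨by rw [hexp]; exact hs, ?_⟩
  rw [hexp, (s2.sub (s1.mul_left (2 * μ))).tsum_add (s0.mul_left (μ ^ 2)),
    s2.tsum_sub (s1.mul_left (2 * μ)), tsum_mul_left, tsum_mul_left, e1, e2, ← hZ]
  ring

end FiniteSupport

/-- A local bound above the mean for a sequence satisfying the compound Poisson recursion. -/
lemma local_bound_of_recursion {p w : ℕ → ℝ} {x₀ L B ρ₀ ρ : ℝ} (hp0 : ∀ m, 0 ≤ p m)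
    (hps : ∀ n, ∑ m ∈ Finset.range n, p m ≤ 1) (hw0 : ∀ j, 1 ≤ j → 0 ≤ w j)
    (hrec : ∀ m : ℕ, m * p m = conv (dropZero w) p m) (hx₀ : 0 < x₀) (hL : 0 < L) (hB0 : 0 ≤ B)
    (hB : ∀ j : ℕ, L < j → w j ≤ B) (hρ₀ : ρ₀ < 1) (hρ : 0 < ρ) (hρ1 : ρ < 1)
    (hρρ : ρ₀ ≤ ρ) (hsum : ∀ n, ∑ j ∈ Finset.range n, dropZero w j ≤ ρ₀ * x₀) (m : ℕ) :
    p m ≤ B / (x₀ * (1 - ρ₀)) + Real.exp (Real.log ρ * ((m - x₀) / L)) := by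
  -- `A` solves `ρ₀ * x₀ * A + B = x₀ * A`, so the constant part of the bound reproduces itself
  -- under the recursion. The exponential part grows by `ρ⁻¹` when its argument drops by `L`, and
  -- `ρ₀ ≤ ρ` pays for this growth.
  set A := B / (x₀ * (1 - ρ₀)) with hA
  have hA0 : 0 ≤ A := div_nonneg hB0 (mul_nonneg hx₀.le (by linarith))
  have hlog : Real.log ρ < 0 := Real.log_neg hρ hρ1
  set E : ℝ → ℝ := fun x => Real.exp (Real.log ρ * ((x - x₀) / L)) with hE
  change p m ≤ A + E m
  have hE0 : ∀ x, 0 < E x := fun x => Real.exp_pos _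
  induction m using Nat.strong_induction_on with
  | _ m ih =>
    -- Below `x₀` the exponential is at least `1` and the bound is trivial.
    rcases lt_or_ge (m : ℝ) x₀ with hm | hm
    · have h1 : p m ≤ 1 := by
        have h := hps (m + 1)
        exact (Finset.single_le_sum (fun i _ => hp0 i) (Finset.self_mem_range_succ m)).trans h
      have h2 : 1 ≤ E m := by
        apply Real.one_le_exp
        exact mul_nonneg_of_nonpos_of_nonpos hlog.le
          (div_nonpos_of_nonpos_of_nonneg (by linarith) hL.le)
      linarith
    · have hm0 : (0 : ℝ) < m := hx₀.trans_le hm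
      have hEρ : E (m - L) = ρ⁻¹ * E m := by
        simp only [hE]
        rw [← Real.exp_log (inv_pos.2 hρ), ← Real.exp_add, Real.log_inv]
        congr 1
        field_simp
        ring
      -- In the recursion, jumps longer than `L` have weight at most `B` and meet total mass at most
      -- `1`; for the shorter ones the induction hypothesis applies at a distance at most `L`.
      have key : (m : ℝ) * p m ≤ ρ₀ * x₀ * (A + ρ⁻¹ * E m) + B := by
        rw [hrec, conv_apply]
        calc ∑ j ∈ Finset.range (m + 1), dropZero w j * p (m - j)
            ≤ ∑ j ∈ Finset.range (m + 1),
                (dropZero w j * (A + ρ⁻¹ * E m) + B * p (m - j)) := by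
              refine Finset.sum_le_sum fun j hj => ?_
              have hjm : j ≤ m := Nat.lt_succ_iff.1 (Finset.mem_range.1 hj)
              rcases Nat.eq_zero_or_pos j with h0 | h0
              · subst h0
                simpa using mul_nonneg hB0 (hp0 _)
              · rw [dropZero_of_ne _ h0.ne']
                have hpos : 0 ≤ A + ρ⁻¹ * E m := by
                  have := hE0 m
                  positivity
                have hw := hw0 j h0
                rcases lt_or_ge L j with h | h
                · have := mul_le_mul_of_nonneg_right (hB j h) (hp0 (m - j))
                  have := mul_nonneg hw hpos
                  linarith
                · have h1 := ih (m - j) (by omega)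
                  have h2 : E ((m - j : ℕ) : ℝ) ≤ E (m - L) := by
                    apply Real.exp_le_exp.2
                    apply mul_le_mul_of_nonpos_left _ hlog.le
                    rw [Nat.cast_sub hjm]
                    gcongr
                  rw [hEρ] at h2
                  have h3 := mul_le_mul_of_nonneg_left (h1.trans (add_le_add_right h2 A)) hw
                  have := mul_nonneg hB0 (hp0 (m - j))
                  linarith
          _ = (∑ j ∈ Finset.range (m + 1), dropZero w j) * (A + ρ⁻¹ * E m) +
                B * ∑ j ∈ Finset.range (m + 1), p j := by
              rw [Finset.sum_add_distrib, Finset.sum_mul, Finset.mul_sum, add_right_inj]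
              rw [← Finset.mul_sum, ← Finset.mul_sum]
              congr 1
              have := Finset.sum_range_reflect p (m + 1)
              rw [← this]
              exact Finset.sum_congr rfl fun j _ => by simp
          _ ≤ _ := by
              have hpos : 0 ≤ A + ρ⁻¹ * E m := by
                have := hE0 m
                positivity
              have h1 := mul_le_mul_of_nonneg_right (hsum (m + 1)) hpos
              have h2 := mul_le_mul_of_nonneg_left (hps (m + 1)) hB0
              linarith
      have hBA : B = A * (x₀ * (1 - ρ₀)) := by
        rw [hA, div_mul_cancel₀]
        have : 0 < 1 - ρ₀ := by linarith
        positivity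
      have hρE : ρ₀ * x₀ * (ρ⁻¹ * E m) ≤ x₀ * E m := by
        have : ρ₀ * ρ⁻¹ ≤ 1 := by rw [← div_eq_mul_inv, div_le_one hρ]; exact hρρ
        have h1 : 0 < x₀ * E m := mul_pos hx₀ (hE0 m)
        nlinarith
      have hfin : (m : ℝ) * p m ≤ x₀ * (A + E m) := by nlinarith
      have : (m : ℝ) * p m ≤ m * (A + E m) :=
        hfin.trans (mul_le_mul_of_nonneg_right hm (by have := hE0 m; positivity))
      exact le_of_mul_le_mul_left this hm0

/-! ### The sequence with weights `N k j`, `j ≤ N` -/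

/-- The weights `N k_j` for `j ≤ N`. -/
def bulkWeight (k : ℕ → ℝ) (N : ℕ) (j : ℕ) : ℝ := if j ≤ N then N * k j else 0

/-- The normalized coefficients of `exp (N ∑_{j ≤ N} (k j / j) z ^ j)`. -/
def bulkProb (k : ℕ → ℝ) (N : ℕ) (m : ℕ) : ℝ :=
  expCoeff (bulkWeight k N) m / ∑' i, expCoeff (bulkWeight k N) i


section Bulk

variable {k : ℕ → ℝ}

lemma bulkWeight_nonneg (hk : ∀ j, 1 ≤ j → 0 ≤ k j) (N j : ℕ) (hj : 1 ≤ j) :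
    0 ≤ bulkWeight k N j := by
  unfold bulkWeight
  split_ifs
  · exact mul_nonneg (by positivity) (hk j hj)
  · exact le_rfl

lemma bulkWeight_eq_zero (k : ℕ → ℝ) (N j : ℕ) (hj : N < j) : bulkWeight k N j = 0 :=
  if_neg (not_le.2 hj)

lemma bulkMass_pos (hk : ∀ j, 1 ≤ j → 0 ≤ k j) (N : ℕ) :
    0 < ∑' i, expCoeff (bulkWeight k N) i :=
  (summable_expCoeff_of_finite (bulkWeight_nonneg hk N) (bulkWeight_eq_zero k N)).tsum_pos
    (expCoeff_nonneg (bulkWeight_nonneg hk N)) 0 (by simp)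

lemma bulkProb_nonneg (hk : ∀ j, 1 ≤ j → 0 ≤ k j) (N m : ℕ) : 0 ≤ bulkProb k N m :=
  div_nonneg (expCoeff_nonneg (bulkWeight_nonneg hk N) m) (bulkMass_pos hk N).le

lemma hasSum_bulkProb (hk : ∀ j, 1 ≤ j → 0 ≤ k j) (N : ℕ) : HasSum (bulkProb k N) 1 := by
  have h := (summable_expCoeff_of_finite (bulkWeight_nonneg hk N)
    (bulkWeight_eq_zero k N)).hasSum.div_const (∑' i, expCoeff (bulkWeight k N) i)
  rwa [div_self (bulkMass_pos hk N).ne'] at h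

lemma sum_bulkProb_le_one (hk : ∀ j, 1 ≤ j → 0 ≤ k j) (N n : ℕ) :
    ∑ m ∈ Finset.range n, bulkProb k N m ≤ 1 :=
  sum_le_hasSum _ (fun m _ => bulkProb_nonneg hk N m) (hasSum_bulkProb hk N)

lemma nat_mul_bulkProb (k : ℕ → ℝ) (N m : ℕ) :
    m * bulkProb k N m = conv (dropZero (bulkWeight k N)) (bulkProb k N) m := by
  unfold bulkProb
  rw [← mul_div_assoc, nat_mul_expCoeff, conv, conv, Finset.sum_div]
  exact Finset.sum_congr rfl fun p _ => by ring

lemma dropZero_bulkWeight (k : ℕ → ℝ) (N j : ℕ) :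
    dropZero (bulkWeight k N) j = if j ≤ N then N * dropZero k j else 0 := by
  cases j with
  | zero => simp
  | succ j => simp [bulkWeight]

lemma sum_dropZero_bulkWeight_le (hk : ∀ j, 1 ≤ j → 0 ≤ k j) {κ₁ : ℝ}
    (hκ : HasSum (dropZero k) κ₁) (N n : ℕ) :
    ∑ j ∈ Finset.range n, dropZero (bulkWeight k N) j ≤ N * κ₁ := by
  calc ∑ j ∈ Finset.range n, dropZero (bulkWeight k N) j
      ≤ ∑ j ∈ Finset.range n, N * dropZero k j := by
        refine Finset.sum_le_sum fun j _ => ?_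
        rw [dropZero_bulkWeight]
        split_ifs
        · exact le_rfl
        · exact mul_nonneg (by positivity) (dropZero_nonneg hk j)
    _ = N * ∑ j ∈ Finset.range n, dropZero k j := by rw [Finset.mul_sum]
    _ ≤ N * κ₁ := by
        gcongr
        exact sum_le_hasSum _ (fun j _ => dropZero_nonneg hk j) hκ

/-- The mean of the bulk is asymptotically `κ₁ N`. -/
lemma tendsto_tsum_bulkWeight {κ₁ : ℝ} (hκ : HasSum (dropZero k) κ₁) :
    Tendsto (fun N : ℕ => (∑' j, dropZero (bulkWeight k N) j) / N) atTop (𝓝 κ₁) := by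
  have h := (hκ.tendsto_sum_nat).comp (tendsto_add_atTop_nat 1)
  refine h.congr' ?_
  filter_upwards [eventually_ge_atTop 1] with N hN
  have hN' : (N : ℝ) ≠ 0 := by
    have : N ≠ 0 := by omega
    exact_mod_cast this
  rw [tsum_eq_sum (s := Finset.range (N + 1)), eq_div_iff hN', mul_comm]
  · simp only [Function.comp, Finset.mul_sum]
    refine Finset.sum_congr rfl fun j hj => ?_
    rw [dropZero_bulkWeight, if_pos (Nat.lt_succ_iff.1 (Finset.mem_range.1 hj))]
  · intro j hj
    rw [dropZero_bulkWeight, if_neg]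
    simpa [Nat.lt_succ_iff] using hj

/-- The variance of the bulk is `o(N ^ 2)`. -/
lemma tendsto_variance_bulkWeight (hk : ∀ j, 1 ≤ j → 0 ≤ k j) {κ₁ : ℝ}
    (hκ : HasSum (dropZero k) κ₁) :
    Tendsto (fun N : ℕ => (∑' j : ℕ, (j : ℝ) * dropZero (bulkWeight k N) j) / (N : ℝ) ^ 2) atTop
      (𝓝 0) := by
  have h0 := dropZero_nonneg hk
  -- The quotient is `∑_{j ≤ N} k_j (j / N)`. Thanks to the truncation at `N` it is dominated
  -- termwise by the summable `k_j`, although `∑ j k_j` may diverge.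
  have key : Tendsto (fun N : ℕ => ∑' j : ℕ, if j ≤ N then dropZero k j * (j / N : ℝ) else 0) atTop
      (𝓝 (∑' _ : ℕ, (0 : ℝ))) := by
    refine tendsto_tsum_of_dominated_convergence hκ.summable (fun j => ?_) (Eventually.of_forall
      fun N j => ?_)
    · have := (tendsto_const_div_atTop_nhds_zero_nat (j : ℝ)).const_mul (dropZero k j)
      rw [mul_zero] at this
      refine this.congr' ?_
      filter_upwards [eventually_ge_atTop j] with N hN
      rw [if_pos hN]
    · split_ifs with h
      · have hj := h0 j
        rw [Real.norm_of_nonneg (by positivity)]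
        have h1 : (j / N : ℝ) ≤ 1 := div_le_one_of_le₀ (by exact_mod_cast h) (by positivity)
        nlinarith
      · simpa using h0 j
  rw [tsum_zero] at key
  refine key.congr' ?_
  filter_upwards [eventually_ge_atTop 1] with N hN
  have hN' : (N : ℝ) ≠ 0 := by
    have : N ≠ 0 := by omega
    exact_mod_cast this
  rw [← tsum_div_const]
  refine tsum_congr fun j => ?_
  rw [dropZero_bulkWeight]
  split_ifs
  · field_simp
  · simp

/-- The law of large numbers for the bulk. -/
lemma tendsto_bulkProb_far (hk : ∀ j, 1 ≤ j → 0 ≤ k j) {κ₁ : ℝ}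
    (hκ : HasSum (dropZero k) κ₁) {ε : ℝ} (hε : 0 < ε) :
    Tendsto (fun N : ℕ => ∑' m : ℕ, if ε * N < |(m : ℝ) - κ₁ * N| then bulkProb k N m else 0) atTop
      (𝓝 0) := by
  -- Chebyshev's inequality with deviation `ε N / 2` from the exact mean; the other `ε N / 2`
  -- absorbs the distance from that mean to `κ₁ N`.
  have hv := (tendsto_variance_bulkWeight hk hκ).mul_const (4 / ε ^ 2)
  rw [zero_mul] at hv
  refine squeeze_zero' (Eventually.of_forall fun N => tsum_nonneg fun m => ?_) ?_ hv
  · split_ifs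
    · exact bulkProb_nonneg hk N m
    · exact le_rfl
  have hm := Metric.tendsto_nhds.1 (tendsto_tsum_bulkWeight hκ) (ε / 2) (by positivity)
  filter_upwards [hm, eventually_ge_atTop 1] with N hN hN1
  have hN0 : (0 : ℝ) < N := by exact_mod_cast hN1
  obtain ⟨hs, he⟩ := tsum_sq_sub_mul_expCoeff (bulkWeight_nonneg hk N) (bulkWeight_eq_zero k N)
  set μ := ∑' j, dropZero (bulkWeight k N) j with hμ
  set V := ∑' j : ℕ, (j : ℝ) * dropZero (bulkWeight k N) j with hV
  have hZ := bulkMass_pos hk N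
  have hs' : HasSum (fun m : ℕ => ((m : ℝ) - μ) ^ 2 * bulkProb k N m) V := by
    have h := hs.hasSum.div_const (∑' i, expCoeff (bulkWeight k N) i)
    rw [he, mul_div_cancel_right₀ _ hZ.ne'] at h
    refine h.congr_fun ?_ |> id
    intro m
    simp only [bulkProb]
    ring
  have hμN : |μ - κ₁ * N| < ε / 2 * N := by
    rw [Real.dist_eq] at hN
    have : μ / N - κ₁ = (μ - κ₁ * N) / N := by field_simp
    rwa [this, abs_div, abs_of_pos hN0, div_lt_iff₀ hN0] at hN
  have hs2 := hs'.mul_right ((4 / ε ^ 2) / (N : ℝ) ^ 2)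
  have hle : ∀ m : ℕ, (if ε * N < |(m : ℝ) - κ₁ * N| then bulkProb k N m else 0) ≤
      ((m : ℝ) - μ) ^ 2 * bulkProb k N m * ((4 / ε ^ 2) / (N : ℝ) ^ 2) := by
    intro m
    have hp := bulkProb_nonneg hk N m
    split_ifs with h
    · have h1 : ε / 2 * N ≤ |(m : ℝ) - μ| := by
        have := abs_sub_le (m : ℝ) μ (κ₁ * N)
        linarith
      have h2 : (ε / 2 * N) ^ 2 ≤ ((m : ℝ) - μ) ^ 2 := by
        rw [← sq_abs ((m : ℝ) - μ)]
        exact pow_le_pow_left₀ (by positivity) h1 2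
      calc bulkProb k N m = (ε / 2 * N) ^ 2 * bulkProb k N m * ((4 / ε ^ 2) / (N : ℝ) ^ 2) := by
            field_simp
            ring
        _ ≤ _ := by gcongr
    · positivity
  have hsum1 : Summable fun m : ℕ => if ε * N < |(m : ℝ) - κ₁ * N| then bulkProb k N m else 0 := by
    refine Summable.of_nonneg_of_le (fun m => ?_) hle hs2.summable
    split_ifs
    · exact bulkProb_nonneg hk N m
    · exact le_rfl
  refine (hsum1.tsum_le_tsum hle hs2.summable).trans (le_of_eq ?_)
  rw [hs2.tsum_eq]
  field_simp

/-- Above the mean, the point probabilities of the bulk are `o(1 / N)`, uniformly. -/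
lemma eventually_bulkProb_le (hk : ∀ j, 1 ≤ j → 0 ≤ k j) {κ₁ : ℝ}
    (hκ : HasSum (dropZero k) κ₁) {s C : ℝ} (hs : 1 < s)
    (hC : ∀ j : ℕ, 1 ≤ j → k j ≤ C * (j : ℝ) ^ (-s)) {ε ζ : ℝ} (hε : 0 < ε) (hζ : 0 < ζ) :
    ∀ᶠ N : ℕ in atTop, ∀ m : ℕ, (κ₁ + ε) * N ≤ m → N * bulkProb k N m ≤ ζ := by
  have hC0 : 0 ≤ C := by
    have := (hk 1 le_rfl).trans (hC 1 le_rfl)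
    simpa using this
  have hκ0 : 0 ≤ κ₁ := hκ.nonneg (dropZero_nonneg hk)
  -- `local_bound_of_recursion` is used with `x₀ = (κ₁ + ε / 2) N`, which is above the mean and
  -- leaves a distance `ε N / 2` for the exponential to decay. The midpoint `ρ` is positive even if
  -- `ρ₀ = 0`.
  set ρ₀ := κ₁ / (κ₁ + ε / 2) with hρ₀
  have hρ₀0 : 0 ≤ ρ₀ := by positivity
  have hρ₀1 : ρ₀ < 1 := by rw [hρ₀, div_lt_one (by positivity)]; linarith
  set ρ := (1 + ρ₀) / 2 with hρ
  have hlog : Real.log ρ < 0 := Real.log_neg (by linarith) (by linarith)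
  -- With `L = N ^ γ`, a longer jump has weight at most `N * C * N ^ (-γ s)`, so the constant part
  -- of the bound times `N` is `O(N ^ (1 - γ s))`; the exponential part decays like `exp (-c N ^ (1
  -- - γ))`. Both vanish exactly because `1 / s < γ < 1`.
  set γ := (1 + 1 / s) / 2 with hγ
  have hs1 : 1 / s < 1 := by rw [div_lt_one (by linarith)]; exact hs
  have hs0 : 0 < 1 / s := by positivity
  have hγ1 : γ < 1 := by linarith
  have hγs : 1 < γ * s := by
    have : γ * s = (s + 1) / 2 := by rw [hγ]; field_simp
    linarith
  have t1 : Tendsto (fun N : ℕ => C / ((κ₁ + ε / 2) * (1 - ρ₀)) * (N : ℝ) ^ (-(γ * s - 1))) atTop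
      (𝓝 0) := by
    have := ((tendsto_rpow_neg_atTop (show 0 < γ * s - 1 by linarith)).comp
      tendsto_natCast_atTop_atTop).const_mul (C / ((κ₁ + ε / 2) * (1 - ρ₀)))
    simpa using this
  have t2 : Tendsto (fun N : ℕ => (N : ℝ) * Real.exp (Real.log ρ * (ε / 2) * (N : ℝ) ^ (1 - γ)))
      atTop (𝓝 0) := by
    have hb : 0 < -(Real.log ρ * (ε / 2)) := by nlinarith
    have h := tendsto_rpow_mul_exp_neg_mul_atTop_nhds_zero (1 / (1 - γ)) _ hb
    have h2 := h.comp ((tendsto_rpow_atTop (show 0 < 1 - γ by linarith)).comp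
      tendsto_natCast_atTop_atTop)
    refine h2.congr fun N => ?_
    simp only [Function.comp]
    rw [← Real.rpow_mul (by positivity), mul_one_div_cancel (by linarith), Real.rpow_one]
    congr 2
    ring
  have t3 := t1.add t2
  rw [add_zero] at t3
  filter_upwards [t3.eventually (gt_mem_nhds hζ), eventually_ge_atTop 1] with N hN hN1 m hm
  have hN0 : (0 : ℝ) < N := by exact_mod_cast hN1
  have hLpos : 0 < (N : ℝ) ^ γ := Real.rpow_pos_of_pos hN0 _
  have hb := local_bound_of_recursion (p := bulkProb k N) (w := bulkWeight k N)
    (x₀ := (κ₁ + ε / 2) * N) (L := (N : ℝ) ^ γ) (B := N * (C * (N : ℝ) ^ (-(γ * s))))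
    (ρ₀ := ρ₀) (ρ := ρ) (bulkProb_nonneg hk N) (sum_bulkProb_le_one hk N) (bulkWeight_nonneg hk N)
    (nat_mul_bulkProb k N) (by positivity) hLpos (by positivity) ?_ hρ₀1 (by linarith)
    (by linarith) (by linarith) ?_ m
  · have hcalc : (N : ℝ) * bulkProb k N m ≤ C / ((κ₁ + ε / 2) * (1 - ρ₀)) * (N : ℝ) ^ (-(γ * s - 1))
        + (N : ℝ) * Real.exp (Real.log ρ * (ε / 2) * (N : ℝ) ^ (1 - γ)) := by
      refine (mul_le_mul_of_nonneg_left hb hN0.le).trans ?_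
      rw [mul_add]
      refine add_le_add (le_of_eq ?_) ?_
      · have e : (N : ℝ) ^ (-(γ * s - 1)) = (N : ℝ) ^ (-(γ * s)) * N := by
          rw [← Real.rpow_add_one hN0.ne']; congr 1; ring
        rw [e]
        have : 1 - ρ₀ ≠ 0 := by linarith
        field_simp
      · refine mul_le_mul_of_nonneg_left (Real.exp_le_exp.2 ?_) hN0.le
        rw [mul_assoc]
        refine mul_le_mul_of_nonpos_left ?_ hlog.le
        rw [le_div_iff₀ hLpos, mul_assoc, ← Real.rpow_add hN0, sub_add_cancel, Real.rpow_one]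
        linarith
    exact hcalc.trans hN.le
  · intro j hj
    have hj0 : (0 : ℝ) < j := hLpos.trans hj
    have hj1 : 1 ≤ j := by exact_mod_cast hj0
    unfold bulkWeight
    split_ifs
    · gcongr
      refine (hC j hj1).trans ?_
      gcongr
      rw [← mul_neg, Real.rpow_mul hN0.le]
      exact Real.rpow_le_rpow_of_nonpos hLpos hj.le (by linarith)
    · positivity
  · intro n
    refine (sum_dropZero_bulkWeight_le hk hκ N n).trans (le_of_eq ?_)
    rw [hρ₀]
    field_simp

end Bulk

/-! ### Averaging a regularly varying sequence over the bulk -/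

/-- `|x|` is dominated by `powCoeff (p + 1)`, and partial sums are convolution with `powCoeff 1`,
the constant sequence `1`. -/
lemma exists_sum_abs_le_rpow {x : ℕ → ℝ} {p A : ℝ} (hp : -1 < p)
    (hx : Tendsto (fun n : ℕ => x n / (n : ℝ) ^ p) atTop (𝓝 A)) :
    ∃ C, 0 ≤ C ∧ ∀ n : ℕ, 1 ≤ n →
      ∑ i ∈ Finset.range (n + 1), |x i| ≤ C * (n : ℝ) ^ (p + 1) := by
  have hα : 0 < p + 1 := by linarith
  obtain ⟨C, hC0, hC⟩ := isBigO_powCoeff hα (by simpa using hx)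
  obtain ⟨D, hD0, hD⟩ := exists_abs_le_rpow (p := p + 1) hα.le
    (by simpa using tendsto_powCoeff (show 0 < p + 1 + 1 by linarith))
  refine ⟨C * D, by positivity, fun n hn => ?_⟩
  have h1 : ∑ i ∈ Finset.range (n + 1), powCoeff (p + 1) i = powCoeff (p + 1 + 1) n := by
    rw [← powCoeff_add (p + 1) 1, conv_apply]
    refine Finset.sum_congr rfl fun i _ => ?_
    rw [powCoeff_eq 1]
    have : ∀ m : ℕ, ∏ i ∈ Finset.range m, ((1 : ℝ) + i) = m.factorial := by
      intro m
      induction m with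
      | zero => simp
      | succ m ih => rw [Finset.prod_range_succ, ih, Nat.factorial_succ]; push_cast; ring
    rw [this, div_self (by positivity), mul_one]
  calc ∑ i ∈ Finset.range (n + 1), |x i|
      ≤ ∑ i ∈ Finset.range (n + 1), C * powCoeff (p + 1) i := Finset.sum_le_sum fun i _ => hC i
    _ = C * powCoeff (p + 1 + 1) n := by rw [← Finset.mul_sum, h1]
    _ ≤ C * (D * (n : ℝ) ^ (p + 1)) := by
        gcongr
        exact (le_abs_self _).trans (hD n hn n le_rfl)
    _ = _ := by ring

lemma exists_near_rpow {x : ℕ → ℝ} {p A ν : ℝ} (hν : 0 < ν)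
    (hx : Tendsto (fun n : ℕ => x n / (n : ℝ) ^ p) atTop (𝓝 A)) {ζ : ℝ} (hζ : 0 < ζ) :
    ∃ ε, 0 < ε ∧ ∀ᶠ N : ℕ in atTop, ∀ n : ℕ, |(n : ℝ) - ν * N| ≤ ε * N →
      |x n / (N : ℝ) ^ p - A * ν ^ p| ≤ ζ := by
  have h1 : Tendsto (fun q : ℕ × ℝ => x q.1 / (q.1 : ℝ) ^ p * q.2 ^ p) (atTop ×ˢ 𝓝 ν)
      (𝓝 (A * ν ^ p)) :=
    (hx.comp tendsto_fst).mul (tendsto_snd.rpow_const (Or.inl hν.ne'))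
  have h2 := Metric.tendsto_nhds.1 h1 ζ hζ
  obtain ⟨P, hP, Q, hQ, hPQ⟩ := eventually_prod_iff.1 h2
  obtain ⟨n₀, hn₀⟩ := eventually_atTop.1 hP
  obtain ⟨ε, hε, hεQ⟩ := Metric.eventually_nhds_iff.1 hQ
  -- The bound `ν / 2` forces `n ≥ ν N / 2`, hence `n → ∞`; the bound `ε / 2` keeps `n / N` near
  -- `ν`.
  refine ⟨min (ε / 2) (ν / 2), by positivity, ?_⟩
  have h3 : ∀ᶠ N : ℕ in atTop, (n₀ : ℝ) < ν / 2 * N :=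
    (tendsto_natCast_atTop_atTop.const_mul_atTop (by positivity)).eventually_gt_atTop _
  filter_upwards [h3, eventually_ge_atTop 1] with N hN hN1 n hn
  have hN0 : (0 : ℝ) < N := by exact_mod_cast hN1
  have ha : |(n : ℝ) - ν * N| ≤ ε / 2 * N := hn.trans (by gcongr; exact min_le_left _ _)
  have hb : |(n : ℝ) - ν * N| ≤ ν / 2 * N := hn.trans (by gcongr; exact min_le_right _ _)
  have hn1 : ν / 2 * N ≤ n := by linarith [neg_le_of_abs_le hb]
  have hn0 : (0 : ℝ) < n := lt_of_lt_of_le (by positivity) hn1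
  have hP' := hn₀ n (by exact_mod_cast (hN.trans_le hn1).le)
  have hQ' : Q ((n : ℝ) / N) := by
    apply hεQ
    rw [Real.dist_eq]
    have : (n : ℝ) / N - ν = (n - ν * N) / N := by field_simp
    rw [this, abs_div, abs_of_pos hN0, div_lt_iff₀ hN0]
    have : ε / 2 * N < ε * N := by nlinarith
    linarith
  have h4 := hPQ hP' hQ'
  rw [Real.dist_eq] at h4
  have h5 : x n / (n : ℝ) ^ p * ((n : ℝ) / N) ^ p = x n / (N : ℝ) ^ p := by
    rw [Real.div_rpow hn0.le hN0.le]
    have := Real.rpow_pos_of_pos hn0 p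
    field_simp
  rw [h5] at h4
  exact h4.le

lemma exists_bound_rpow_of_le {x : ℕ → ℝ} {p A ν : ℝ} (hν : 0 < ν)
    (hx : Tendsto (fun n : ℕ => x n / (n : ℝ) ^ p) atTop (𝓝 A)) :
    ∃ D, 0 ≤ D ∧ ∀ N n : ℕ, 1 ≤ N → ν * N ≤ n → n ≤ N → |x n| / (N : ℝ) ^ p ≤ D := by
  obtain ⟨C, hC⟩ := (Metric.isBounded_range_of_tendsto _ hx).exists_norm_le
  have hC0 : 0 ≤ C := (norm_nonneg _).trans (hC _ ⟨0, rfl⟩)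
  -- As `ν ≤ n / N ≤ 1`, the maximum bounds `(n / N) ^ p` for either sign of `p`.
  refine ⟨C * max 1 (ν ^ p), by positivity, fun N n hN hn hnN => ?_⟩
  have hN0 : (0 : ℝ) < N := by exact_mod_cast hN
  have hn0 : (0 : ℝ) < n := lt_of_lt_of_le (by positivity) hn
  have hnp := Real.rpow_pos_of_pos hn0 p
  have hNp := Real.rpow_pos_of_pos hN0 p
  have h1 := hC _ ⟨n, rfl⟩
  rw [Real.norm_eq_abs, abs_div, abs_of_pos hnp] at h1
  have h2 : |x n| / (N : ℝ) ^ p = |x n| / (n : ℝ) ^ p * ((n : ℝ) / N) ^ p := by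
    rw [Real.div_rpow hn0.le hN0.le]
    field_simp
  rw [h2]
  have hν1 : ν ≤ (n : ℝ) / N := by rwa [le_div_iff₀ hN0]
  have hn1 : (n : ℝ) / N ≤ 1 := by rw [div_le_one hN0]; exact_mod_cast hnN
  refine mul_le_mul h1 ?_ (by positivity) hC0
  rcases le_or_gt 0 p with hp | hp
  · exact (Real.rpow_le_one (by positivity) hn1 hp).trans (le_max_left _ _)
  · exact (Real.rpow_le_rpow_of_nonpos hν hν1 hp.le).trans (le_max_right _ _)

/-- Three ranges of the bulk size `m`. Near `κ₁ N` the remainder `N - m` is near `ν N` and `T (N -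
m) / N ^ p` is near its limit. Far below, this quotient is bounded and the mass is small by the law
of large numbers. Far above, `N - m` may be small and the quotient unbounded when `p < 0`; there the
`o(1 / N)` bound on point probabilities is set against `∑_{i ≤ N} |T i| = O(N ^ (p + 1))`. -/
theorem tendsto_conv_bulkProb {k : ℕ → ℝ} (hk : ∀ j, 1 ≤ j → 0 ≤ k j) {κ₁ : ℝ}
    (hκ : HasSum (dropZero k) κ₁) (hκ1 : κ₁ < 1) {s C : ℝ} (hs : 1 < s)
    (hC : ∀ j : ℕ, 1 ≤ j → k j ≤ C * (j : ℝ) ^ (-s)) {T : ℕ → ℝ} {p A : ℝ} (hp : -1 < p)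
    (hT : Tendsto (fun n : ℕ => T n / (n : ℝ) ^ p) atTop (𝓝 A)) :
    Tendsto (fun N : ℕ => conv (bulkProb k N) T N / (N : ℝ) ^ p) atTop
      (𝓝 (A * (1 - κ₁) ^ p)) := by
  set ν := 1 - κ₁ with hνdef
  have hν : 0 < ν := by linarith
  obtain ⟨D, hD0, hD⟩ := exists_bound_rpow_of_le hν hT
  obtain ⟨K, hK0, hK⟩ := exists_sum_abs_le_rpow hp hT
  set B := A * ν ^ p with hB
  rw [Metric.tendsto_atTop]
  intro ζ hζ
  obtain ⟨ε₀, hε₀, hnear⟩ := exists_near_rpow hν hT (show 0 < ζ / 4 by positivity)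
  set ε := min ε₀ (ν / 2) with hεdef
  have hε : 0 < ε := by positivity
  have hεν : ε < ν := (min_le_right _ _).trans_lt (by linarith)
  have hfar := ((tendsto_bulkProb_far hk hκ hε).const_mul (|B| + D)).eventually
    (gt_mem_nhds (show (|B| + D) * 0 < ζ / 4 by simpa using by positivity))
  have hloc := eventually_bulkProb_le hk hκ hs hC hε (show 0 < ζ / (4 * (K + 1)) by positivity)
  obtain ⟨N₀, hN₀⟩ := eventually_atTop.1
    (hnear.and (hfar.and (hloc.and (eventually_ge_atTop 1))))
  refine ⟨N₀, fun N hN => ?_⟩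
  obtain ⟨h1, h2, h3, hN1⟩ := hN₀ N hN
  have hN0 : (0 : ℝ) < N := by exact_mod_cast hN1
  have hNp := Real.rpow_pos_of_pos hN0 p
  have hP := hasSum_bulkProb hk N
  have hP0 := bulkProb_nonneg hk N
  set G : ℕ → ℝ := fun m => if m ≤ N then T (N - m) / (N : ℝ) ^ p else 0 with hG
  have hGsum : HasSum (fun m => bulkProb k N m * G m) (conv (bulkProb k N) T N / (N : ℝ) ^ p) := by
    rw [summable_conv_term_eq, ← tsum_div_const]
    have he : (fun m => bulkProb k N m * G m) = fun m =>
        (if m ≤ N then bulkProb k N m * T (N - m) else 0) / (N : ℝ) ^ p := by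
      ext m
      simp only [hG]
      split_ifs <;> ring
    rw [he]
    refine (summable_of_ne_finset_zero (s := Finset.range (N + 1)) fun m hm => ?_).hasSum
    rw [if_neg (by simpa [Nat.lt_succ_iff] using hm), zero_div]
  have hdiff := hGsum.sub (hP.mul_right B)
  rw [one_mul] at hdiff
  set far : ℕ → ℝ := fun m => if ε * N < |(m : ℝ) - κ₁ * N| then bulkProb k N m else 0 with hfardef
  set tl : ℕ → ℝ := fun m => if m ≤ N then |T (N - m)| else 0 with htl
  have hfars : Summable far := by
    refine Summable.of_nonneg_of_le (fun m => ?_) (fun m => ?_) hP.summable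
    · simp only [hfardef]; split_ifs
      · exact hP0 m
      · exact le_rfl
    · simp only [hfardef]; split_ifs
      · exact le_rfl
      · exact hP0 m
  have htls : HasSum tl (∑ i ∈ Finset.range (N + 1), |T i|) := by
    have h : HasSum tl (∑ m ∈ Finset.range (N + 1), tl m) :=
      hasSum_sum_of_ne_finset_zero fun m hm => by
        simp only [htl]
        rw [if_neg (by simpa [Nat.lt_succ_iff] using hm)]
    convert h using 1
    rw [← Finset.sum_range_reflect]
    refine Finset.sum_congr rfl fun m hm => ?_
    have : m ≤ N := Nat.lt_succ_iff.1 (Finset.mem_range.1 hm)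
    simp only [htl, if_pos this]
    rfl
  set q := ζ / (4 * (K + 1)) / N / (N : ℝ) ^ p with hq
  have hq0 : 0 ≤ q := by positivity
  -- One term for each range; the factor `|B|` in the middle one also pays for comparing with `B` at
  -- all far `m`. After summation each of the three is at most `ζ / 4`.
  have hbound : ∀ m, |bulkProb k N m * G m - bulkProb k N m * B| ≤
      ζ / 4 * bulkProb k N m + (|B| + D) * far m + q * tl m := by
    intro m
    have hpm := hP0 m
    have htl0 : 0 ≤ tl m := by simp only [htl]; split_ifs <;> positivity
    rw [← mul_sub, abs_mul, abs_of_nonneg hpm]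
    rcases le_or_gt |(m : ℝ) - κ₁ * N| (ε * N) with h | h
    · have hmN : m ≤ N := by
        have : (m : ℝ) ≤ N := by nlinarith [le_of_abs_le h]
        exact_mod_cast this
      have hn := h1 (N - m) (by
        rw [Nat.cast_sub hmN]
        have : (N : ℝ) - m - ν * N = -(m - κ₁ * N) := by rw [hνdef]; ring
        rw [this, abs_neg]
        refine h.trans ?_
        gcongr
        exact min_le_left _ _)
      have hGm : G m = T (N - m) / (N : ℝ) ^ p := if_pos hmN
      have hf0 : far m = 0 := if_neg (not_lt.2 h)
      rw [hGm, hf0]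
      have := mul_le_mul_of_nonneg_left hn hpm
      have := mul_nonneg hq0 htl0
      linarith
    · have hf1 : far m = bulkProb k N m := if_pos h
      rw [hf1]
      have hGB : |G m - B| ≤ |G m| + |B| := abs_sub _ _
      have hmain : bulkProb k N m * |G m| ≤ D * bulkProb k N m + q * tl m := by
        by_cases hmN : m ≤ N
        · have hGm : |G m| = |T (N - m)| / (N : ℝ) ^ p := by
            simp only [hG, if_pos hmN, abs_div, abs_of_pos hNp]
          have htm : tl m = |T (N - m)| := if_pos hmN
          rcases le_or_gt (m : ℝ) (κ₁ * N) with hlow | hhigh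
          · have hd := hD N (N - m) hN1 (by
              rw [Nat.cast_sub hmN, hνdef]; linarith) (Nat.sub_le _ _)
            rw [← hGm] at hd
            have := mul_le_mul_of_nonneg_left hd hpm
            have := mul_nonneg hq0 htl0
            linarith
          · rw [abs_of_pos (by linarith)] at h
            have hl := h3 m (by nlinarith)
            have hl' : bulkProb k N m ≤ ζ / (4 * (K + 1)) / N := by
              rw [le_div_iff₀ hN0]; linarith
            have h6 : bulkProb k N m * |G m| ≤ q * tl m := by
              rw [hGm, htm, hq, div_mul_eq_mul_div, ← mul_div_assoc]
              gcongr
            have := mul_nonneg hD0 hpm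
            linarith
        · have hGm : G m = 0 := if_neg hmN
          rw [hGm, abs_zero, mul_zero]
          positivity
      have := mul_le_mul_of_nonneg_left hGB hpm
      have : 0 ≤ ζ / 4 * bulkProb k N m := by positivity
      linarith
  have hsumb := ((hP.mul_left (ζ / 4)).add (hfars.hasSum.mul_left (|B| + D))).add (htls.mul_left q)
  have hfin : |conv (bulkProb k N) T N / (N : ℝ) ^ p - B| ≤
      ζ / 4 * 1 + (|B| + D) * (∑' m, far m) + q * ∑ i ∈ Finset.range (N + 1), |T i| := by
    rw [← hdiff.tsum_eq]
    have hs1 : Summable fun m => |bulkProb k N m * G m - bulkProb k N m * B| :=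
      Summable.of_nonneg_of_le (fun _ => abs_nonneg _) hbound hsumb.summable
    calc |∑' m, (bulkProb k N m * G m - bulkProb k N m * B)|
        ≤ ∑' m, |bulkProb k N m * G m - bulkProb k N m * B| := by
          simpa only [Real.norm_eq_abs] using
            norm_tsum_le_tsum_norm (f := fun m => bulkProb k N m * G m - bulkProb k N m * B) hs1
      _ ≤ _ := by
          rw [← hsumb.tsum_eq]
          exact hs1.tsum_le_tsum hbound hsumb.summable
  rw [Real.dist_eq]
  have h7 : q * ∑ i ∈ Finset.range (N + 1), |T i| ≤ ζ / 4 := by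
    refine (mul_le_mul_of_nonneg_left (hK N hN1) hq0).trans ?_
    have : q * (K * (N : ℝ) ^ (p + 1)) = ζ / 4 * (K / (K + 1)) := by
      rw [hq, Real.rpow_add_one hN0.ne']
      field_simp
    rw [this]
    have h8 : K / (K + 1) ≤ 1 := by rw [div_le_one (by positivity)]; linarith
    nlinarith
  linarith

/-! ### Weighted partitions and moments of power sums -/

/-- The weight `∏_j w_j ^ {c_j} / (j ^ {c_j} c_j!)` of a partition with `c_j` parts equal to `j`. -/
def partWeight (w : ℕ → ℝ) (μ : Multiset ℕ) : ℝ :=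
  ∏ j ∈ μ.toFinset, (w j / j) ^ μ.count j / (μ.count j).factorial

lemma partWeight_eq_prod (w : ℕ → ℝ) {μ : Multiset ℕ} {S : Finset ℕ} (hS : μ.toFinset ⊆ S) :
    partWeight w μ = ∏ j ∈ S, (w j / j) ^ μ.count j / (μ.count j).factorial := by
  refine Finset.prod_subset hS fun j _ hj => ?_
  have : μ.count j = 0 := Multiset.count_eq_zero.2 (by simpa using hj)
  simp [this]

/-- Only the factor at `j` changes, and there `c x ^ c / c! = x · x ^ (c - 1) / (c - 1)!`. -/
lemma partWeight_cons (w : ℕ → ℝ) (j : ℕ) (ν : Multiset ℕ) :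
    ((j ::ₘ ν).count j : ℝ) * partWeight w (j ::ₘ ν) = w j / j * partWeight w ν := by
  have h1 : (j ::ₘ ν).toFinset ⊆ insert j ν.toFinset := by simp
  have h2 : ν.toFinset ⊆ insert j ν.toFinset := Finset.subset_insert _ _
  rw [partWeight_eq_prod w h1, partWeight_eq_prod w h2, ← Finset.mul_prod_erase _ _
    (Finset.mem_insert_self j _), ← Finset.mul_prod_erase _ _ (Finset.mem_insert_self j _)]
  have h3 : ∀ i ∈ (insert j ν.toFinset).erase j,
      (w i / i) ^ (j ::ₘ ν).count i / ((j ::ₘ ν).count i).factorial =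
        (w i / i) ^ ν.count i / (ν.count i).factorial := by
    intro i hi
    rw [Multiset.count_cons_of_ne (Finset.ne_of_mem_erase hi)]
  rw [Finset.prod_congr rfl h3, Multiset.count_cons_self, Nat.factorial_succ, pow_succ]
  push_cast
  field_simp

/-- The Mecke formula for weighted partitions. -/
theorem sum_partWeight_mul_sum (w : ℕ → ℝ) (n : ℕ) (F : ℕ → Multiset ℕ → ℝ) :
    ∑ μ : n.Partition, partWeight w μ.parts * (μ.parts.map fun x => F x (μ.parts.erase x)).sum =
      ∑ j ∈ Finset.Icc 1 n, w j / j *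
        ∑ ν : (n - j).Partition, partWeight w ν.parts * F j ν.parts := by
  have h1 (μ : n.Partition) : (μ.parts.map fun x => F x (μ.parts.erase x)).sum =
      ∑ j ∈ Finset.Icc 1 n, (μ.parts.count j : ℝ) * F j (μ.parts.erase j) := by
    rw [Finset.sum_multiset_map_count]
    simp only [nsmul_eq_mul]
    refine Finset.sum_subset (fun j hj => ?_) fun j _ hj => ?_
    · have hj' : j ∈ μ.parts := by simpa using hj
      exact Finset.mem_Icc.2 ⟨μ.parts_pos hj', Nat.Partition.le_of_mem_parts hj'⟩
    · have : μ.parts.count j = 0 := Multiset.count_eq_zero.2 (by simpa using hj)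
      simp [this]
  simp only [h1, Finset.mul_sum]
  rw [Finset.sum_comm]
  refine Finset.sum_congr rfl fun j hj => ?_
  obtain ⟨hj1, hjn⟩ := Finset.mem_Icc.1 hj
  have h2 : ∑ μ : n.Partition, partWeight w μ.parts *
        ((μ.parts.count j : ℝ) * F j (μ.parts.erase j)) =
      ∑ μ : {μ : n.Partition // j ∈ μ.parts}, partWeight w μ.1.parts *
        ((μ.1.parts.count j : ℝ) * F j (μ.1.parts.erase j)) := by
    rw [← Finset.sum_subtype (Finset.univ.filter fun μ : n.Partition => j ∈ μ.parts) (by simp)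
      fun μ => partWeight w μ.parts * ((μ.parts.count j : ℝ) * F j (μ.parts.erase j))]
    refine (Finset.sum_filter_of_ne fun μ _ h => ?_).symm
    by_contra hc
    rw [Multiset.count_eq_zero.2 hc] at h
    simp at h
  -- Removing one part `j` is a bijection from the partitions of `n` containing `j` onto all
  -- partitions of `n - j`; the multiplicity of `j` is absorbed by `partWeight_cons`.
  rw [h2, ← Equiv.sum_comp (Nat.Partition.partitionWithPartEquiv hj1 hjn).symm]
  refine Finset.sum_congr rfl fun ν _ => ?_
  rw [Nat.Partition.partitionWithPartEquiv_symm_apply_parts, Multiset.erase_cons_head]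
  have := partWeight_cons w j ν.parts
  linear_combination F j ν.parts * this

/-- The power sum of the parts. -/
def powSum (m : ℕ) (μ : Multiset ℕ) : ℝ := (μ.map fun x : ℕ => (x : ℝ) ^ m).sum

lemma powSum_cons (m j : ℕ) (ν : Multiset ℕ) : powSum m (j ::ₘ ν) = (j : ℝ) ^ m + powSum m ν := by
  simp [powSum]

/-- The sum of `∏_{i ∈ s} powSum (e i)` over weighted partitions of `n`. -/
def partMoment {ι : Type*} (w : ℕ → ℝ) (e : ι → ℕ) (s : Finset ι) (n : ℕ) : ℝ :=
  ∑ μ : n.Partition, partWeight w μ.parts * ∏ i ∈ s, powSum (e i) μ.parts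

/-- The sequence `w_j j ^ (m - 1)`. -/
def powWeight (w : ℕ → ℝ) (m j : ℕ) : ℝ := dropZero w j * (j : ℝ) ^ m / j

/-- The Mecke formula with `F j _ = j`: the parts of a partition of `n` add up to `n`, and this is
the recursion of `expCoeff`. -/
lemma partMoment_empty {ι : Type*} (w : ℕ → ℝ) (e : ι → ℕ) :
    partMoment w e ∅ = expCoeff w := by
  apply eq_expCoeff
  · simp [partMoment, partWeight]
  · intro n
    have h := sum_partWeight_mul_sum w n fun j _ => (j : ℝ)
    have h1 (μ : n.Partition) : (μ.parts.map fun x : ℕ => (x : ℝ)).sum = n := by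
      have := congrArg (Nat.cast (R := ℝ)) μ.parts_sum
      rwa [Nat.cast_multiset_sum] at this
    simp only [h1] at h
    simp only [partMoment, Finset.prod_empty, mul_one]
    rw [mul_comm, Finset.sum_mul, h, conv_apply, Finset.range_eq_Ico,
      Finset.sum_eq_sum_Ico_succ_bot (by omega)]
    simp only [dropZero_zero, zero_mul, zero_add]
    refine Finset.sum_congr (by ext; simp) fun j hj => ?_
    have hj1 : j ≠ 0 := by have := (Finset.mem_Ico.1 hj).1; omega
    rw [dropZero_of_ne _ hj1, ← Finset.sum_mul]
    have : (j : ℝ) ≠ 0 := by exact_mod_cast hj1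
    simp only [partMoment, Finset.prod_empty, mul_one]
    field_simp

/-- The Mecke formula removes the part `j` counted by the factor `powSum (e i)`. In every other
factor that part contributes `j ^ e a` besides the remaining parts; `A` is the set of factors from
which this contribution is chosen when the product is expanded. -/
lemma partMoment_insert {ι : Type*} [DecidableEq ι] (w : ℕ → ℝ) (e : ι → ℕ) {i : ι} {s : Finset ι}
    (hi : i ∉ s) :
    partMoment w e (insert i s) =
      ∑ A ∈ s.powerset, conv (powWeight w (e i + ∑ a ∈ A, e a)) (partMoment w e (s \ A)) := by
  ext n
  have h := sum_partWeight_mul_sum w n fun j ν =>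
    (j : ℝ) ^ e i * ∏ a ∈ s, ((j : ℝ) ^ e a + powSum (e a) ν)
  have h1 (μ : n.Partition) : (μ.parts.map fun x : ℕ => (x : ℝ) ^ e i *
      ∏ a ∈ s, ((x : ℝ) ^ e a + powSum (e a) (μ.parts.erase x))).sum =
      ∏ a ∈ insert i s, powSum (e a) μ.parts := by
    rw [Finset.prod_insert hi, powSum, ← Multiset.sum_map_mul_right]
    congr 1
    refine Multiset.map_congr rfl fun x hx => ?_
    congr 1
    refine Finset.prod_congr rfl fun a _ => ?_
    rw [← powSum_cons, Multiset.cons_erase hx]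
  simp only [h1] at h
  rw [partMoment, h, Finset.sum_apply]
  simp only [conv_apply, Finset.prod_add]
  rw [Finset.sum_comm, Finset.range_eq_Ico, Finset.sum_eq_sum_Ico_succ_bot (by omega)]
  simp only [powWeight, dropZero_zero, zero_mul, zero_div, Finset.sum_const_zero, zero_add]
  refine Finset.sum_congr (by ext; simp) fun j hj => ?_
  have hj1 : j ≠ 0 := by have := (Finset.mem_Icc.1 hj).1; omega
  simp only [partMoment, Finset.mul_sum]
  rw [Finset.sum_comm]
  refine Finset.sum_congr rfl fun A _ => Finset.sum_congr rfl fun ν _ => ?_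
  rw [dropZero_of_ne _ hj1, pow_add, Finset.prod_pow_eq_pow_sum]
  ring

/-! ### From permutations to partitions -/

/-- Cauchy's count of the permutations with given cycle counts. `cycleType` omits fixed points, so
the parts equal to `1` are split off as `r` and restored in both products. -/
lemma card_perm_partition_eq (N : ℕ) (μ : (Fintype.card (Fin N)).Partition) :
    ((Finset.univ.filter fun σ : Equiv.Perm (Fin N) => σ.partition = μ).card : ℝ) *
      ∏ j ∈ μ.parts.toFinset, ((j : ℝ) ^ μ.parts.count j * (μ.parts.count j).factorial) =
      N.factorial := by
  set m := μ.parts.filter fun n => 2 ≤ n with hm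
  set r := μ.parts.count 1 with hr
  have hsplit : μ.parts = m + Multiset.replicate r 1 := by
    rw [hm, hr, ← Multiset.filter_eq']
    conv_lhs => rw [← Multiset.filter_add_not (fun n => 2 ≤ n) μ.parts]
    congr 1
    refine Multiset.filter_congr fun x hx => ?_
    have := μ.parts_pos hx
    omega
  have hsum : m.sum + r = N := by
    have h := μ.parts_sum
    rw [hsplit, Multiset.sum_add, Multiset.sum_replicate, Fintype.card_fin] at h
    simpa using h
  have h1m : 1 ∉ m := by simp [hm]
  have hset : (Finset.univ.filter fun σ : Equiv.Perm (Fin N) => σ.partition = μ) =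
      Finset.univ.filter fun σ : Equiv.Perm (Fin N) => σ.cycleType = m := by
    ext σ
    simp only [Finset.mem_filter, Finset.mem_univ, true_and]
    constructor
    · rintro rfl
      rw [hm, Equiv.Perm.filter_parts_partition_eq_cycleType]
    · intro h
      apply Nat.Partition.ext
      rw [Equiv.Perm.parts_partition, h, hsplit]
      congr 2
      rw [← Equiv.Perm.sum_cycleType, h, Fintype.card_fin]
      omega
  have hcard := Equiv.Perm.card_of_cycleType_mul_eq (Fin N) m
  rw [if_pos ⟨by rw [Fintype.card_fin]; omega, fun a ha => (Multiset.mem_filter.1 ha).2⟩,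
    Fintype.card_fin] at hcard
  have hprod : ∏ j ∈ μ.parts.toFinset, (j ^ μ.parts.count j * (μ.parts.count j).factorial) =
      (N - m.sum).factorial * m.prod * ∏ n ∈ m.toFinset, (m.count n).factorial := by
    rw [Finset.prod_mul_distrib, ← Finset.prod_multiset_count]
    have hp : μ.parts.prod = m.prod := by
      rw [hsplit, Multiset.prod_add, Multiset.prod_replicate, one_pow, mul_one]
    have hsub : μ.parts.toFinset ⊆ insert 1 m.toFinset := by
      intro x hx
      rw [Multiset.mem_toFinset, hsplit, Multiset.mem_add] at hx
      rcases hx with hx | hx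
      · exact Finset.mem_insert_of_mem (Multiset.mem_toFinset.2 hx)
      · rw [Multiset.eq_of_mem_replicate hx]
        exact Finset.mem_insert_self _ _
    have hf : ∏ j ∈ μ.parts.toFinset, (μ.parts.count j).factorial =
        r.factorial * ∏ n ∈ m.toFinset, (m.count n).factorial := by
      rw [Finset.prod_subset hsub fun j _ hj => by
        rw [Multiset.count_eq_zero.2 (by simpa using hj), Nat.factorial_zero],
        Finset.prod_insert (by simpa using h1m)]
      congr 1
      refine Finset.prod_congr rfl fun j hj => ?_
      have hj1 : j ≠ 1 := fun h => h1m (h ▸ Multiset.mem_toFinset.1 hj)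
      rw [hsplit, Multiset.count_add, Multiset.count_replicate, if_neg (Ne.symm hj1), add_zero]
    rw [hp, hf, show N - m.sum = r by omega]
    ring
  rw [hset]
  have h3 := congrArg (Nat.cast (R := ℝ)) hprod
  have h4 := congrArg (Nat.cast (R := ℝ)) hcard
  push_cast at h3 h4
  rw [h3]
  exact h4

lemma cycleWeight_eq (θ κ : ℕ → ℝ) (N : ℕ) (σ : Equiv.Perm (Fin N)) :
    cycleWeight θ κ N σ =
      ∏ j ∈ σ.partition.parts.toFinset, (θ j + N * κ j) ^ σ.partition.parts.count j := by
  symm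
  refine Finset.prod_subset (fun j hj => ?_) fun j _ hj => ?_
  · have hj' := Multiset.mem_toFinset.1 hj
    have h := Nat.Partition.le_of_mem_parts hj'
    rw [Fintype.card_fin] at h
    exact Finset.mem_Icc.2 ⟨σ.partition.parts_pos hj', h⟩
  · rw [Multiset.count_eq_zero.2 (by simpa using hj), pow_zero]

theorem sum_cycleWeight_mul (θ κ : ℕ → ℝ) (N : ℕ) (G : Multiset ℕ → ℝ) :
    ∑ σ : Equiv.Perm (Fin N), cycleWeight θ κ N σ * G σ.partition.parts =
      N.factorial * ∑ μ : (Fintype.card (Fin N)).Partition,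
        partWeight (fun j => θ j + N * κ j) μ.parts * G μ.parts := by
  rw [← Finset.sum_fiberwise (s := Finset.univ) (g := fun σ : Equiv.Perm (Fin N) => σ.partition),
    Finset.mul_sum]
  refine Finset.sum_congr rfl fun μ _ => ?_
  have h : ∀ σ ∈ Finset.univ.filter fun σ : Equiv.Perm (Fin N) => σ.partition = μ,
      cycleWeight θ κ N σ * G σ.partition.parts =
        (∏ j ∈ μ.parts.toFinset, (θ j + N * κ j) ^ μ.parts.count j) * G μ.parts := by
    intro σ hσ
    rw [cycleWeight_eq, (Finset.mem_filter.1 hσ).2]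
  rw [Finset.sum_congr rfl h, Finset.sum_const, nsmul_eq_mul, ← card_perm_partition_eq N μ,
    partWeight]
  have hne : ∏ j ∈ μ.parts.toFinset, ((j : ℝ) ^ μ.parts.count j * (μ.parts.count j).factorial) ≠ 0 := by
    refine Finset.prod_ne_zero_iff.2 fun j hj => ?_
    have : (j : ℝ) ≠ 0 := by
      have := μ.parts_pos (Multiset.mem_toFinset.1 hj)
      positivity
    positivity
  have hd : ∏ j ∈ μ.parts.toFinset, ((θ j + N * κ j) / j) ^ μ.parts.count j /
      ((μ.parts.count j).factorial : ℝ) =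
      (∏ j ∈ μ.parts.toFinset, (θ j + N * κ j) ^ μ.parts.count j) /
      ∏ j ∈ μ.parts.toFinset, ((j : ℝ) ^ μ.parts.count j * (μ.parts.count j).factorial) := by
    rw [← Finset.prod_div_distrib]
    exact Finset.prod_congr rfl fun j _ => by rw [div_pow, div_div]
  rw [hd]
  field_simp

lemma sum_cycleWeight_mul_powSum {ι : Type*} (θ κ : ℕ → ℝ) (N : ℕ) (e : ι → ℕ) (s : Finset ι) :
    ∑ σ : Equiv.Perm (Fin N), cycleWeight θ κ N σ * ∏ i ∈ s, powSum (e i) σ.partition.parts =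
      N.factorial * partMoment (fun j => θ j + N * κ j) e s N := by
  rw [sum_cycleWeight_mul θ κ N fun μ => ∏ i ∈ s, powSum (e i) μ]
  change _ * partMoment _ e s (Fintype.card (Fin N)) = _
  rw [Fintype.card_fin]

lemma normConst_eq (θ κ : ℕ → ℝ) (N : ℕ) :
    normConst θ κ N = expCoeff (fun j => θ j + N * κ j) N := by
  have h := sum_cycleWeight_mul_powSum θ κ N (fun i : ℕ => i) ∅
  simp only [Finset.prod_empty, mul_one, partMoment_empty] at h
  have : (N.factorial : ℝ) ≠ 0 := by positivity
  rw [normConst, h]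
  field_simp

lemma permExpect_powSum {ι : Type*} (θ κ : ℕ → ℝ) (N : ℕ) (e : ι → ℕ) (s : Finset ι) :
    permExpect θ κ N (fun σ => ∏ i ∈ s, powSum (e i) σ.partition.parts) =
      partMoment (fun j => θ j + N * κ j) e s N / expCoeff (fun j => θ j + N * κ j) N := by
  have h := sum_cycleWeight_mul_powSum θ κ N e s
  have hf : (N.factorial : ℝ) ≠ 0 := by positivity
  simp only [permExpect, permProb, mul_assoc]
  rw [← Finset.mul_sum, h, normConst_eq]
  field_simp

/-! ### Rescaling the weights -/

/-- Because `∑ j C_j = N`, every weight, and hence the normalization, is multiplied by `R ^ N`. -/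
lemma permProb_scale (θ κ : ℕ → ℝ) {R : ℝ} (hR : 0 < R) (N : ℕ) (σ : Equiv.Perm (Fin N)) :
    permProb (fun j => θ j * R ^ j) (fun j => κ j * R ^ j) N σ = permProb θ κ N σ := by
  have h1 : cycleWeight (fun j => θ j * R ^ j) (fun j => κ j * R ^ j) N σ =
      R ^ N * cycleWeight θ κ N σ := by
    have h := σ.partition.parts_sum.trans (Fintype.card_fin N)
    rw [Finset.sum_multiset_count] at h
    have hRN := (congrArg (fun n => R ^ n) h).symm
    rw [cycleWeight_eq, cycleWeight_eq, hRN, ← Finset.prod_pow_eq_pow_sum,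
      ← Finset.prod_mul_distrib]
    refine Finset.prod_congr rfl fun j _ => ?_
    rw [smul_eq_mul, mul_comm (Multiset.count _ _), pow_mul, ← mul_pow]
    congr 1
    ring
  have h2 : normConst (fun j => θ j * R ^ j) (fun j => κ j * R ^ j) N = R ^ N * normConst θ κ N := by
    rw [normConst_eq, normConst_eq, ← expCoeff_scale]
    congr 1
    ext j
    ring
  have hRN : R ^ N ≠ 0 := by positivity
  rw [permProb, permProb, h1, h2, one_div_mul_eq_div, one_div_mul_eq_div, mul_left_comm,
    mul_div_mul_left _ _ hRN]

/-! ### Asymptotics of the moments -/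

section Moments

variable {ι : Type*} [DecidableEq ι]

/-- The recursion over finite sets satisfied by the moments of power sums of a Poisson process
with rate `θ x⁻¹ e^{-x}`. -/
def IsGammaMoment (θ : ℝ) (e : ι → ℕ) (ζ : Finset ι → ℝ) : Prop :=
  ζ ∅ = 1 ∧ ∀ i s, i ∉ s → ζ (insert i s) =
    ∑ A ∈ s.powerset, θ * Real.Gamma ((e i + ∑ a ∈ A, e a : ℕ) : ℝ) * ζ (s \ A)

lemma finset_insert_induction {P : Finset ι → Prop} (h0 : P ∅)
    (h : ∀ i s, i ∉ s → (∀ A ∈ s.powerset, P (s \ A)) → P (insert i s)) (s : Finset ι) : P s := by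
  induction s using Finset.strongInduction with
  | H s ih =>
    rcases s.eq_empty_or_nonempty with rfl | ⟨i, hi⟩
    · exact h0
    · have h1 := h i (s.erase i) (Finset.notMem_erase i s) fun A _ =>
        ih _ (lt_of_le_of_lt Finset.sdiff_subset (Finset.erase_ssubset hi))
      rwa [Finset.insert_erase hi] at h1

lemma sum_insert_eq (e : ι → ℕ) {i : ι} {s A : Finset ι} (hi : i ∉ s) (hA : A ∈ s.powerset) :
    (e i + ∑ a ∈ A, e a) + ∑ a ∈ s \ A, e a = ∑ a ∈ insert i s, e a := by
  rw [Finset.sum_insert hi, ← Finset.sum_sdiff (Finset.mem_powerset.1 hA)]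
  ring

lemma tendsto_powWeight {b : ℕ → ℝ} {θ : ℝ} (hb : Tendsto b atTop (𝓝 θ)) (m : ℕ) :
    Tendsto (fun n : ℕ => powWeight b m n / (n : ℝ) ^ ((m : ℝ) - 1)) atTop (𝓝 θ) := by
  refine hb.congr' ?_
  filter_upwards [eventually_ge_atTop 1] with n hn
  have hn0 : (0 : ℝ) < n := by exact_mod_cast hn
  rw [powWeight, dropZero_of_ne _ (by omega), Real.rpow_sub hn0, Real.rpow_natCast, Real.rpow_one]
  field_simp

/-- Induction along `partMoment_insert`. With `m = e i + ∑_{a ∈ A} e a`, the term of `A` convolves a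
sequence asymptotic to `θ n ^ (m - 1)`, read as `(θ Γ(m)) / Γ(m)` times the power, with the lower
moment. In `tendsto_conv_div_rpow` the Gamma denominators merge into a single `Γ(M + θ)`, where `M`
is the total exponent, and the numerators follow the recursion for `ζ`. -/
lemma tendsto_partMoment {b : ℕ → ℝ} {θ c : ℝ} (hθ : 0 < θ) (hb : Tendsto b atTop (𝓝 θ))
    (hc : Tendsto (fun n : ℕ => expCoeff b n / (n : ℝ) ^ (θ - 1)) atTop (𝓝 (c / Real.Gamma θ)))
    {e : ι → ℕ} (he : ∀ i, 1 ≤ e i) {ζ : Finset ι → ℝ} (hζ : IsGammaMoment θ e ζ) (s : Finset ι) :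
    Tendsto (fun n : ℕ => partMoment b e s n / (n : ℝ) ^ (((∑ a ∈ s, e a : ℕ) : ℝ) + θ - 1)) atTop
      (𝓝 (c * ζ s / Real.Gamma (((∑ a ∈ s, e a : ℕ) : ℝ) + θ))) := by
  induction s using finset_insert_induction with
  | h0 => simpa [partMoment_empty, hζ.1] using hc
  | h i s hi ih =>
    rw [partMoment_insert b e hi]
    have key : ∀ A ∈ s.powerset, Tendsto (fun n : ℕ =>
        conv (powWeight b (e i + ∑ a ∈ A, e a)) (partMoment b e (s \ A)) n /
          (n : ℝ) ^ (((∑ a ∈ insert i s, e a : ℕ) : ℝ) + θ - 1)) atTop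
        (𝓝 ((θ * Real.Gamma ((e i + ∑ a ∈ A, e a : ℕ) : ℝ)) * (c * ζ (s \ A)) /
          Real.Gamma (((∑ a ∈ insert i s, e a : ℕ) : ℝ) + θ))) := by
      intro A hA
      have hm : (0 : ℝ) < ((e i + ∑ a ∈ A, e a : ℕ) : ℝ) := by
        have := he i
        exact_mod_cast (by omega : 0 < e i + ∑ a ∈ A, e a)
      have hβ : 0 < ((∑ a ∈ s \ A, e a : ℕ) : ℝ) + θ := by positivity
      have h1 := tendsto_powWeight hb (e i + ∑ a ∈ A, e a)
      rw [← mul_div_cancel_right₀ θ (Real.Gamma_pos_of_pos hm).ne'] at h1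
      have h2 := tendsto_conv_div_rpow hm hβ h1 (ih A hA)
      rw [← add_assoc, ← Nat.cast_add, sum_insert_eq e hi hA] at h2
      exact h2
    have h := tendsto_finsetSum _ key
    rw [hζ.2 i s hi]
    convert h using 2
    · rw [Finset.sum_apply, Finset.sum_div]
    · rw [Finset.mul_sum, Finset.sum_div]
      exact Finset.sum_congr rfl fun A _ => by ring

end Moments

/-! ### The bulk is negligible in moments of high order -/

section Comparison

variable {ι : Type*} [DecidableEq ι]

lemma powWeight_nonneg {w : ℕ → ℝ} (hw : ∀ j, 1 ≤ j → 0 ≤ w j) (m j : ℕ) :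
    0 ≤ powWeight w m j :=
  div_nonneg (mul_nonneg (dropZero_nonneg hw j) (by positivity)) (by positivity)

lemma powWeight_add (w w' : ℕ → ℝ) (m : ℕ) :
    powWeight (w + w') m = powWeight w m + powWeight w' m := by
  ext j
  cases j with
  | zero => simp [powWeight]
  | succ j => simp [powWeight]; ring

lemma partWeight_nonneg {w : ℕ → ℝ} (hw : ∀ j, 1 ≤ j → 0 ≤ w j) {n : ℕ} (μ : n.Partition) :
    0 ≤ partWeight w μ.parts := by
  refine Finset.prod_nonneg fun j hj => ?_
  have := hw j (μ.parts_pos (Multiset.mem_toFinset.1 hj))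
  positivity

lemma powSum_nonneg (m : ℕ) (μ : Multiset ℕ) : 0 ≤ powSum m μ :=
  Multiset.sum_nonneg fun x hx => by
    obtain ⟨y, _, rfl⟩ := Multiset.mem_map.1 hx
    positivity

lemma partMoment_nonneg {ι : Type*} {w : ℕ → ℝ} (hw : ∀ j, 1 ≤ j → 0 ≤ w j) (e : ι → ℕ) (s : Finset ι)
    (n : ℕ) : 0 ≤ partMoment w e s n :=
  Finset.sum_nonneg fun μ _ => mul_nonneg (partWeight_nonneg hw μ)
    (Finset.prod_nonneg fun _ _ => powSum_nonneg _ _)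

lemma powWeight_le {b : ℕ → ℝ} {B : ℝ} (hB : ∀ j, 1 ≤ j → b j ≤ B) (hB0 : 0 ≤ B) {m : ℕ}
    (hm : 1 ≤ m) {N j : ℕ} (hN : 1 ≤ N) (hj : j ≤ N) :
    powWeight b m j ≤ B * (N : ℝ) ^ ((m : ℝ) - 1) := by
  have hN0 : (0 : ℝ) < N := by exact_mod_cast hN
  rcases Nat.eq_zero_or_pos j with h | h
  · subst h
    simp only [powWeight, dropZero_zero, zero_mul, zero_div]
    positivity
  · have hj0 : (0 : ℝ) < j := by exact_mod_cast h
    have e1 : powWeight b m j = b j * (j : ℝ) ^ ((m : ℝ) - 1) := by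
      rw [powWeight, dropZero_of_ne _ h.ne', Real.rpow_sub hj0, Real.rpow_natCast, Real.rpow_one]
      ring
    rw [e1]
    have hm1 : (1 : ℝ) ≤ m := by exact_mod_cast hm
    have h1 : (j : ℝ) ^ ((m : ℝ) - 1) ≤ (N : ℝ) ^ ((m : ℝ) - 1) :=
      Real.rpow_le_rpow hj0.le (by exact_mod_cast hj) (by linarith)
    exact mul_le_mul (hB j h) h1 (by positivity) hB0

/-- Origin of the threshold `s + 1` for the exponents: for such `m` the power `j ^ (m - 1 - s)` is
largest at `j = N`, and the bulk weight is smaller by a factor `N ^ (1 - s)` than the scale `N ^ (m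
- 1)` of `powWeight b m`. -/
lemma powWeight_bulk_le {k : ℕ → ℝ} {s C : ℝ} (hC : ∀ j : ℕ, 1 ≤ j → k j ≤ C * (j : ℝ) ^ (-s))
    (hC0 : 0 ≤ C) {m : ℕ} (hm : s + 1 ≤ m) {N j : ℕ} (hN : 1 ≤ N) (hj : j ≤ N) :
    powWeight (fun i => N * k i) m j ≤ C * (N : ℝ) ^ (1 - s) * (N : ℝ) ^ ((m : ℝ) - 1) := by
  have hN0 : (0 : ℝ) < N := by exact_mod_cast hN
  rcases Nat.eq_zero_or_pos j with h | h
  · subst h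
    simp only [powWeight, dropZero_zero, zero_mul, zero_div]
    positivity
  · have hj0 : (0 : ℝ) < j := by exact_mod_cast h
    have e1 : powWeight (fun i => N * k i) m j = N * k j * (j : ℝ) ^ ((m : ℝ) - 1) := by
      rw [powWeight, dropZero_of_ne _ h.ne', Real.rpow_sub hj0, Real.rpow_natCast, Real.rpow_one]
      ring
    rw [e1]
    have h1 : (j : ℝ) ^ ((m : ℝ) - 1 - s) ≤ (N : ℝ) ^ ((m : ℝ) - 1 - s) :=
      Real.rpow_le_rpow hj0.le (by exact_mod_cast hj) (by linarith)
    calc N * k j * (j : ℝ) ^ ((m : ℝ) - 1)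
        ≤ N * (C * (j : ℝ) ^ (-s)) * (j : ℝ) ^ ((m : ℝ) - 1) := by
          gcongr
          exact hC j h
      _ = N * C * (j : ℝ) ^ ((m : ℝ) - 1 - s) := by
          rw [sub_eq_add_neg _ s, Real.rpow_add hj0]
          ring
      _ ≤ N * C * (N : ℝ) ^ ((m : ℝ) - 1 - s) := by gcongr
      _ = _ := by
          rw [show (m : ℝ) - 1 - s = (1 - s) + ((m : ℝ) - 1) - 1 by ring, Real.rpow_sub hN0,
            Real.rpow_add hN0, Real.rpow_one]
          field_simp

lemma abs_conv_le_mul_sum {x y : ℕ → ℝ} {K : ℝ} {n N : ℕ} (hn : n ≤ N) (hK : 0 ≤ K)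
    (hx : ∀ j ≤ N, |x j| ≤ K) : |conv x y n| ≤ K * ∑ j ∈ Finset.range (N + 1), |y j| := by
  rw [conv_comm, conv_apply, Finset.mul_sum]
  refine (Finset.abs_sum_le_sum_abs _ _).trans ?_
  refine (Finset.sum_le_sum fun j _ => ?_).trans
    (Finset.sum_le_sum_of_subset_of_nonneg (Finset.range_subset_range.2 (by omega : n + 1 ≤ N + 1))
      fun j _ _ => mul_nonneg hK (abs_nonneg (y j)))
  rw [abs_mul, mul_comm]
  exact mul_le_mul_of_nonneg_right (hx _ (by omega)) (abs_nonneg _)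

variable {b k : ℕ → ℝ} {θ c κ₁ s C : ℝ}

/-- The normalized moment sequence. -/
def normMoment (b k : ℕ → ℝ) (e : ι → ℕ) (S : Finset ι) (N : ℕ) : ℕ → ℝ :=
  (∑' i, expCoeff (bulkWeight k N) i)⁻¹ • partMoment (b + fun i => N * k i) e S

lemma normMoment_nonneg {ι : Type*} (hb : ∀ j, 1 ≤ j → 0 ≤ b j)
    (hk : ∀ j, 1 ≤ j → 0 ≤ k j) (e : ι → ℕ)
    (S : Finset ι) (N n : ℕ) : 0 ≤ normMoment b k e S N n :=
  mul_nonneg (inv_nonneg.2 (bulkMass_pos hk N).le) (partMoment_nonneg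
    (fun j hj => add_nonneg (hb j hj) (mul_nonneg (by positivity) (hk j hj))) e S n)

lemma normMoment_insert (b k : ℕ → ℝ) (e : ι → ℕ) {i : ι} {S : Finset ι} (hi : i ∉ S) (N : ℕ) :
    normMoment b k e (insert i S) N =
      ∑ A ∈ S.powerset, conv (powWeight (b + fun i => N * k i) (e i + ∑ a ∈ A, e a))
        (normMoment b k e (S \ A) N) := by
  simp only [normMoment, partMoment_insert _ e hi, conv_smul_right, Finset.smul_sum]

/-- A coefficient of index at most `N` does not see the truncation of the bulk weights at `N`, so
here the exponential of the full weights factors. -/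
lemma normMoment_empty {ι : Type*} (b k : ℕ → ℝ) (e : ι → ℕ) {N n : ℕ} (hn : n ≤ N) :
    normMoment b k e ∅ N n = conv (bulkProb k N) (partMoment b e ∅) n := by
  have h1 : bulkProb k N =
      (∑' i, expCoeff (bulkWeight k N) i)⁻¹ • expCoeff (bulkWeight k N) := by
    ext m
    simp [bulkProb, div_eq_inv_mul]
  rw [normMoment, partMoment_empty, partMoment_empty, h1, conv_smul_left, ← expCoeff_add]
  simp only [Pi.smul_apply]
  congr 1
  refine expCoeff_congr fun j _ hj => ?_
  simp only [Pi.add_apply, bulkWeight, if_pos (hj.trans hn)]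
  ring

/-- An a priori bound on sums over `n ≤ N`, not on single values: this form passes through the
recursion by `sum_conv_le`, and it is what the comparison below consumes. The factor `2` comes from
`N + 1 ≤ 2 N`. -/
lemma exists_sum_normMoment_le (hb : ∀ j, 1 ≤ j → 0 ≤ b j) (hk : ∀ j, 1 ≤ j → 0 ≤ k j)
    (hθ : 0 < θ) {B : ℝ} (hB : ∀ j, 1 ≤ j → b j ≤ B)
    (hc : Tendsto (fun n : ℕ => expCoeff b n / (n : ℝ) ^ (θ - 1)) atTop (𝓝 (c / Real.Gamma θ)))
    (hs : 1 < s) (hC : ∀ j : ℕ, 1 ≤ j → k j ≤ C * (j : ℝ) ^ (-s))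
    {e : ι → ℕ} (he : ∀ i, s + 1 ≤ e i) (S : Finset ι) :
    ∃ K, 0 ≤ K ∧ ∀ N : ℕ, 1 ≤ N → ∑ n ∈ Finset.range (N + 1), normMoment b k e S N n ≤
      K * (N : ℝ) ^ (((∑ a ∈ S, e a : ℕ) : ℝ) + θ) := by
  have hB0 : 0 ≤ B := (hb 1 le_rfl).trans (hB 1 le_rfl)
  have hC0 : 0 ≤ C := by simpa using (hk 1 le_rfl).trans (hC 1 le_rfl)
  induction S using finset_insert_induction with
  | h0 =>
    obtain ⟨K, hK0, hK⟩ := exists_sum_abs_le_rpow (by linarith) hc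
    refine ⟨K, hK0, fun N hN => ?_⟩
    rw [Finset.sum_congr rfl fun n hn => normMoment_empty b k e
      (Nat.lt_succ_iff.1 (Finset.mem_range.1 hn)), partMoment_empty]
    refine (sum_conv_le (bulkProb_nonneg hk N) (expCoeff_nonneg hb) _).trans ?_
    have h1 := sum_bulkProb_le_one hk N (N + 1)
    have h2 := hK N hN
    simp only [abs_of_nonneg (expCoeff_nonneg hb _), sub_add_cancel] at h2
    simp only [Finset.sum_empty, Nat.cast_zero, zero_add]
    refine le_trans ?_ h2
    exact mul_le_of_le_one_left (Finset.sum_nonneg fun n _ => expCoeff_nonneg hb n) h1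
  | h i S hi ih =>
    choose! K hK0 hK using ih
    refine ⟨∑ A ∈ S.powerset, 2 * (B + C) * K A, Finset.sum_nonneg fun A hA => by
      have := hK0 A hA; positivity, fun N hN => ?_⟩
    have hN0 : (0 : ℝ) < N := by exact_mod_cast hN
    have hN1 : (1 : ℝ) ≤ N := by exact_mod_cast hN
    rw [normMoment_insert b k e hi]
    simp only [Finset.sum_apply]
    rw [Finset.sum_comm, Finset.sum_mul]
    refine Finset.sum_le_sum fun A hA => ?_
    have hsum := sum_insert_eq e hi hA
    set m := e i + ∑ a ∈ A, e a with hm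
    have hms : s + 1 ≤ m := by
      have : (e i : ℝ) ≤ m := by exact_mod_cast (by omega : e i ≤ m)
      linarith [he i]
    have hm1 : 1 ≤ m := by
      have : (1 : ℝ) ≤ m := by linarith
      exact_mod_cast this
    have hw : ∀ j, 1 ≤ j → 0 ≤ (b + fun i => N * k i) j := fun j hj =>
      add_nonneg (hb j hj) (mul_nonneg hN0.le (hk j hj))
    have hW : ∑ j ∈ Finset.range (N + 1), powWeight (b + fun i => N * k i) m j ≤
        2 * (B + C) * (N : ℝ) ^ (m : ℝ) := by
      have h1 : ∀ j ∈ Finset.range (N + 1), powWeight (b + fun i => N * k i) m j ≤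
          (B + C) * (N : ℝ) ^ ((m : ℝ) - 1) := by
        intro j hj
        have hj' := Nat.lt_succ_iff.1 (Finset.mem_range.1 hj)
        rw [powWeight_add, Pi.add_apply, add_mul]
        refine add_le_add (powWeight_le hB hB0 hm1 hN hj') ?_
        refine (powWeight_bulk_le hC hC0 hms hN hj').trans ?_
        have h2 : (N : ℝ) ^ (1 - s) ≤ 1 := Real.rpow_le_one_of_one_le_of_nonpos hN1 (by linarith)
        have h3 : 0 ≤ C * (N : ℝ) ^ ((m : ℝ) - 1) := by positivity
        nlinarith
      refine (Finset.sum_le_sum h1).trans ?_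
      rw [Finset.sum_const, Finset.card_range, nsmul_eq_mul, Real.rpow_sub hN0, Real.rpow_one]
      push_cast
      have h2 : ((N : ℝ) + 1) / N ≤ 2 := by rw [div_le_iff₀ hN0]; linarith
      have h3 : 0 ≤ (B + C) * (N : ℝ) ^ (m : ℝ) := by positivity
      calc ((N : ℝ) + 1) * ((B + C) * ((N : ℝ) ^ (m : ℝ) / N))
          = ((N : ℝ) + 1) / N * ((B + C) * (N : ℝ) ^ (m : ℝ)) := by ring
        _ ≤ 2 * ((B + C) * (N : ℝ) ^ (m : ℝ)) := by gcongr
        _ = _ := by ring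
    refine (sum_conv_le (powWeight_nonneg hw m) (normMoment_nonneg hb hk e _ N) _).trans ?_
    refine (mul_le_mul hW (hK A hA N hN) (Finset.sum_nonneg fun n _ =>
      normMoment_nonneg hb hk e _ N n) (by positivity)).trans (le_of_eq ?_)
    rw [← hsum, Nat.cast_add m, add_assoc, Real.rpow_add hN0 (m : ℝ)]
    ring

/-- Compares the true moments with those in which the power sums see only the `b`-part while the
bulk merely occupies points. In the recursion the weight splits as `b + N k`. The `N k` term is
small by `powWeight_bulk_le` and `exists_sum_normMoment_le`. In the `b` term, `bulkProb` commutes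
past `powWeight b`, leaving the difference for a smaller set. Uniformity in `n ≤ N` keeps the
induction running. -/
lemma exists_normMoment_sub_le (hb : ∀ j, 1 ≤ j → 0 ≤ b j) (hk : ∀ j, 1 ≤ j → 0 ≤ k j)
    (hθ : 0 < θ) {B : ℝ} (hB : ∀ j, 1 ≤ j → b j ≤ B)
    (hc : Tendsto (fun n : ℕ => expCoeff b n / (n : ℝ) ^ (θ - 1)) atTop (𝓝 (c / Real.Gamma θ)))
    (hs : 1 < s) (hC : ∀ j : ℕ, 1 ≤ j → k j ≤ C * (j : ℝ) ^ (-s))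
    {e : ι → ℕ} (he : ∀ i, s + 1 ≤ e i) (S : Finset ι) :
    ∃ δ : ℕ → ℝ, Tendsto δ atTop (𝓝 0) ∧ (∀ N, 0 ≤ δ N) ∧ ∀ N : ℕ, 1 ≤ N → ∀ n ≤ N,
      |normMoment b k e S N n - conv (bulkProb k N) (partMoment b e S) n| ≤
        δ N * (N : ℝ) ^ (((∑ a ∈ S, e a : ℕ) : ℝ) + θ - 1) := by
  have hB0 : 0 ≤ B := (hb 1 le_rfl).trans (hB 1 le_rfl)
  have hC0 : 0 ≤ C := by simpa using (hk 1 le_rfl).trans (hC 1 le_rfl)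
  induction S using finset_insert_induction with
  | h0 =>
    refine ⟨0, tendsto_const_nhds, fun _ => le_rfl, fun N hN n hn => ?_⟩
    rw [normMoment_empty b k e hn]
    simp
  | h i S hi ih =>
    choose! δ hδ hδ0 hδN using ih
    have hKex := fun A => exists_sum_normMoment_le (e := e) hb hk hθ hB hc hs hC he (S \ A)
    choose K hK0 hK using hKex
    refine ⟨fun N => ∑ A ∈ S.powerset, (C * K A * (N : ℝ) ^ (1 - s) + 2 * B * δ A N), ?_, ?_, ?_⟩
    · have hp : Tendsto (fun N : ℕ => (N : ℝ) ^ (1 - s)) atTop (𝓝 0) := by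
        have h := (tendsto_rpow_neg_atTop (show 0 < s - 1 by linarith)).comp
          tendsto_natCast_atTop_atTop
        refine h.congr fun N => ?_
        simp only [Function.comp, neg_sub]
      have h := tendsto_finsetSum S.powerset fun A hA =>
        (hp.const_mul (C * K A)).add ((hδ A hA).const_mul (2 * B))
      simpa using h
    · intro N
      refine Finset.sum_nonneg fun A hA => ?_
      have := hK0 A
      have := hδ0 A hA N
      positivity
    · intro N hN n hn
      have hN0 : (0 : ℝ) < N := by exact_mod_cast hN
      have hsplit : normMoment b k e (insert i S) N n -
          conv (bulkProb k N) (partMoment b e (insert i S)) n =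
          ∑ A ∈ S.powerset, (conv (powWeight (fun i => N * k i) (e i + ∑ a ∈ A, e a))
            (normMoment b k e (S \ A) N) n + conv (powWeight b (e i + ∑ a ∈ A, e a))
              (normMoment b k e (S \ A) N - conv (bulkProb k N) (partMoment b e (S \ A))) n) := by
        rw [normMoment_insert b k e hi, partMoment_insert b e hi, conv_sum_right, Finset.sum_apply,
          Finset.sum_apply, ← Finset.sum_sub_distrib]
        refine Finset.sum_congr rfl fun A _ => ?_
        rw [powWeight_add, conv_add_left, conv_sub_right, conv_left_comm (bulkProb k N)]
        simp only [Pi.add_apply, Pi.sub_apply]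
        ring
      rw [hsplit, Finset.sum_mul]
      refine (Finset.abs_sum_le_sum_abs _ _).trans (Finset.sum_le_sum fun A hA => ?_)
      refine (abs_add_le _ _).trans ?_
      have hsum := sum_insert_eq e hi hA
      set m := e i + ∑ a ∈ A, e a with hm
      have hms : s + 1 ≤ m := by
        have : (e i : ℝ) ≤ m := by exact_mod_cast (by omega : e i ≤ m)
        linarith [he i]
      have hm1 : 1 ≤ m := by
        have : (1 : ℝ) ≤ m := by linarith
        exact_mod_cast this
      have hNk : ∀ j, 1 ≤ j → 0 ≤ (N : ℝ) * k j := fun j hj => mul_nonneg hN0.le (hk j hj)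
      have hexp : (N : ℝ) ^ (((∑ a ∈ insert i S, e a : ℕ) : ℝ) + θ - 1) =
          (N : ℝ) ^ ((m : ℝ) - 1) * (N : ℝ) ^ (((∑ a ∈ S \ A, e a : ℕ) : ℝ) + θ) := by
        rw [← hsum, ← Real.rpow_add hN0]
        congr 1
        push_cast
        ring
      rw [add_mul, hexp]
      refine add_le_add ?_ ?_
      · refine (abs_conv_le_mul_sum (K := C * (N : ℝ) ^ (1 - s) * (N : ℝ) ^ ((m : ℝ) - 1)) hn
          (by positivity) fun j hj => ?_).trans ?_
        · rw [abs_of_nonneg (powWeight_nonneg hNk m j)]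
          exact powWeight_bulk_le hC hC0 hms hN hj
        · simp only [abs_of_nonneg (normMoment_nonneg hb hk e _ N _)]
          refine (mul_le_mul_of_nonneg_left (hK A N hN) (by positivity)).trans (le_of_eq ?_)
          ring
      · refine (abs_conv_le_mul_sum (K := B * (N : ℝ) ^ ((m : ℝ) - 1)) hn
          (by positivity) fun j hj => ?_).trans ?_
        · rw [abs_of_nonneg (powWeight_nonneg hb m j)]
          exact powWeight_le hB hB0 hm1 hN hj
        · have h1 : ∑ j ∈ Finset.range (N + 1), |(normMoment b k e (S \ A) N -
              conv (bulkProb k N) (partMoment b e (S \ A))) j| ≤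
              (2 * N) * (δ A N * (N : ℝ) ^ (((∑ a ∈ S \ A, e a : ℕ) : ℝ) + θ - 1)) := by
            refine (Finset.sum_le_sum fun j hj => hδN A hA N hN j
              (Nat.lt_succ_iff.1 (Finset.mem_range.1 hj))).trans ?_
            rw [Finset.sum_const, Finset.card_range, nsmul_eq_mul]
            have hN1 : (1 : ℝ) ≤ N := by exact_mod_cast hN
            have := hδ0 A hA N
            gcongr
            push_cast
            linarith
          refine (mul_le_mul_of_nonneg_left h1 (by positivity)).trans (le_of_eq ?_)
          rw [Real.rpow_sub_one hN0.ne' (((∑ a ∈ S \ A, e a : ℕ) : ℝ) + θ)]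
          field_simp

/-- Convergence of the normalized moments of the cycle lengths. -/
theorem tendsto_permExpect_powSum (hb : ∀ j, 1 ≤ j → 0 ≤ b j) (hk : ∀ j, 1 ≤ j → 0 ≤ k j)
    (hθ : 0 < θ) (hbθ : Tendsto b atTop (𝓝 θ)) (hbs : Summable fun j : ℕ => |b j - θ| / j)
    (hκ : HasSum (dropZero k) κ₁) (hκ1 : κ₁ < 1) (hs : 1 < s)
    (hC : ∀ j : ℕ, 1 ≤ j → k j ≤ C * (j : ℝ) ^ (-s))
    {e : ι → ℕ} (he : ∀ i, s + 1 ≤ e i) {ζ : Finset ι → ℝ} (hζ : IsGammaMoment θ e ζ)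
    (S : Finset ι) :
    Tendsto (fun N : ℕ => permExpect b k N (fun σ => ∏ i ∈ S, powSum (e i) σ.partition.parts) /
      (N * (1 - κ₁)) ^ (∑ a ∈ S, e a)) atTop
      (𝓝 (ζ S * Real.Gamma θ / Real.Gamma (((∑ a ∈ S, e a : ℕ) : ℝ) + θ))) := by
  obtain ⟨c, hc0, hc⟩ := exists_tendsto_expCoeff_div_rpow hθ hb hbθ hbs
  obtain ⟨B, hB⟩ := (Metric.isBounded_range_of_tendsto _ hbθ).exists_norm_le
  have hB' : ∀ j, 1 ≤ j → b j ≤ B := fun j _ => (le_abs_self _).trans (hB _ ⟨j, rfl⟩)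
  have he1 : ∀ i, 1 ≤ e i := by
    intro i
    have : (1 : ℝ) ≤ e i := by linarith [he i]
    exact_mod_cast this
  set ν := 1 - κ₁ with hν
  have hν0 : 0 < ν := by linarith
  have key (S : Finset ι) : Tendsto (fun N : ℕ => normMoment b k e S N N /
      (N : ℝ) ^ (((∑ a ∈ S, e a : ℕ) : ℝ) + θ - 1)) atTop
      (𝓝 (c * ζ S / Real.Gamma (((∑ a ∈ S, e a : ℕ) : ℝ) + θ) *
        ν ^ (((∑ a ∈ S, e a : ℕ) : ℝ) + θ - 1))) := by
    obtain ⟨δ, hδ, -, hδN⟩ := exists_normMoment_sub_le hb hk hθ hB' hc hs hC he S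
    have hM : (0 : ℝ) ≤ ((∑ a ∈ S, e a : ℕ) : ℝ) := by positivity
    have h1 := tendsto_conv_bulkProb hk hκ hκ1 hs hC
      (p := ((∑ a ∈ S, e a : ℕ) : ℝ) + θ - 1) (by linarith) (tendsto_partMoment hθ hbθ hc he1 hζ S)
    have h2 : Tendsto (fun N : ℕ => (normMoment b k e S N N -
        conv (bulkProb k N) (partMoment b e S) N) /
          (N : ℝ) ^ (((∑ a ∈ S, e a : ℕ) : ℝ) + θ - 1)) atTop (𝓝 0) := by
      refine squeeze_zero_norm' ?_ hδ
      filter_upwards [eventually_ge_atTop 1] with N hN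
      have hN0 : (0 : ℝ) < N := by exact_mod_cast hN
      have hp := Real.rpow_pos_of_pos hN0 (((∑ a ∈ S, e a : ℕ) : ℝ) + θ - 1)
      rw [Real.norm_eq_abs, abs_div, abs_of_pos hp, div_le_iff₀ hp]
      exact hδN N hN N le_rfl
    have h3 := h2.add h1
    rw [zero_add] at h3
    refine h3.congr fun N => ?_
    ring
  -- An expectation is the moment for `S` over that for `∅`; the quotient cancels the constant `c`,
  -- the bulk mass and the factors `N ^ (θ - 1)` and `ν ^ (θ - 1)`.
  have h0 := key ∅
  have hΓ := Real.Gamma_pos_of_pos hθ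
  have hne : c * ζ ∅ / Real.Gamma (((∑ a ∈ (∅ : Finset ι), e a : ℕ) : ℝ) + θ) *
        ν ^ (((∑ a ∈ (∅ : Finset ι), e a : ℕ) : ℝ) + θ - 1) ≠ 0 := by
    rw [hζ.1]
    simp only [Finset.sum_empty, Nat.cast_zero, zero_add]
    have := Real.rpow_pos_of_pos hν0 (θ - 1)
    positivity
  have h := ((key S).div h0 hne).div_const (ν ^ (∑ a ∈ S, e a))
  convert h.congr' ?_ using 2
  · rw [hζ.1]
    simp only [Finset.sum_empty, Nat.cast_zero, zero_add]
    have h1 := Real.rpow_pos_of_pos hν0 (θ - 1)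
    have h2 : ν ^ (((∑ a ∈ S, e a : ℕ) : ℝ) + θ - 1) = ν ^ (∑ a ∈ S, e a) * ν ^ (θ - 1) := by
      rw [add_sub_assoc, Real.rpow_add hν0, Real.rpow_natCast]
    have h3 : 0 < ν ^ (∑ a ∈ S, e a) := by positivity
    rw [h2]
    field_simp
  · filter_upwards [eventually_ge_atTop 1] with N hN
    have hN0 : (0 : ℝ) < N := by exact_mod_cast hN
    have h1 := Real.rpow_pos_of_pos hN0 (θ - 1)
    have h2 : (N : ℝ) ^ (((∑ a ∈ S, e a : ℕ) : ℝ) + θ - 1) =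
        (N : ℝ) ^ (∑ a ∈ S, e a) * (N : ℝ) ^ (θ - 1) := by
      rw [add_sub_assoc, Real.rpow_add hN0, Real.rpow_natCast]
    have hZ := bulkMass_pos hk N
    rw [permExpect_powSum]
    simp only [Pi.div_apply, normMoment, Pi.smul_apply, smul_eq_mul, Finset.sum_empty,
      Nat.cast_zero, zero_add, partMoment_empty]
    rw [h2, mul_pow]
    change _ = partMoment (b + fun i => N * k i) e S N / expCoeff (b + fun i => N * k i) N / _
    -- If the normalization vanishes, both sides are `0` by the convention for division by zero.
    rcases eq_or_ne (expCoeff (b + fun i => N * k i) N) 0 with hY | hY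
    · simp [hY]
    · field_simp

end Comparison

/-! ### Power series and coefficient bounds -/

/-- `f` is given by the power series with coefficients `c` on `|z| < R`. -/
def HasSeriesOn (c : ℕ → ℂ) (R : ℝ) (f : ℂ → ℂ) : Prop :=
  ∀ z : ℂ, ‖z‖ < R → HasSum (fun j : ℕ => c j * z ^ j) (f z)

lemma HasSeriesOn.hasFPowerSeriesOnBall {c : ℕ → ℂ} {R : ℝ} {f : ℂ → ℂ} (hR : 0 < R)
    (h : HasSeriesOn c R f) :
    HasFPowerSeriesOnBall f (FormalMultilinearSeries.ofScalars ℂ c) 0 (ENNReal.ofReal R) where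
  r_le := by
    refine ENNReal.le_of_forall_nnreal_lt fun r hr => ?_
    have hr' : (r : ℝ) < R := by
      rwa [← ENNReal.ofReal_coe_nnreal, ENNReal.ofReal_lt_ofReal_iff hR] at hr
    apply FormalMultilinearSeries.le_radius_of_tendsto (l := 0)
    have := (h (r : ℝ) (by simpa using hr')).summable.tendsto_atTop_zero.norm
    simpa using this
  r_pos := by simpa using hR
  hasSum := by
    intro y hy
    have hy' : ‖y‖ < R := by
      rw [Metric.mem_eball, edist_zero_right, ← ofReal_norm,
        ENNReal.ofReal_lt_ofReal_iff hR] at hy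
      exact hy
    have := h y hy'
    simpa [FormalMultilinearSeries.ofScalars_apply_eq, mul_comm] using this

lemma HasSeriesOn.deriv {c : ℕ → ℂ} {R : ℝ} {f : ℂ → ℂ} (hR : 0 < R) (h : HasSeriesOn c R f) :
    HasSeriesOn (fun j => (j + 1) * c (j + 1)) R (deriv f) := by
  intro z hz
  have h1 := (h.hasFPowerSeriesOnBall hR).fderiv
  have hz' : z ∈ Metric.eball (0 : ℂ) (ENNReal.ofReal R) := by
    rw [Metric.mem_eball, edist_zero_right, ← ofReal_norm, ENNReal.ofReal_lt_ofReal_iff hR]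
    exact hz
  have h2 := h1.hasSum hz'
  have h3 := h2.mapL (ContinuousLinearMap.apply ℂ ℂ (1 : ℂ))
  simp only [zero_add, ContinuousLinearMap.apply_apply, fderiv_apply_one_eq_deriv] at h3
  refine h3.congr_fun ?_ |> id
  intro j
  have h4 := (FormalMultilinearSeries.ofScalars ℂ c).derivSeries_coeff_one j
  rw [FormalMultilinearSeries.coeff_ofScalars] at h4
  have h5 := (FormalMultilinearSeries.ofScalars ℂ c).derivSeries.apply_eq_pow_smul_coeff
    (n := j) (z := z)
  rw [h5, smul_apply, h4]
  simp
  ring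

lemma HasSeriesOn.iteratedDeriv {c : ℕ → ℂ} {R : ℝ} {f : ℂ → ℂ} (hR : 0 < R)
    (h : HasSeriesOn c R f) (n : ℕ) :
    HasSeriesOn (fun j => ((j + n).descFactorial n : ℂ) * c (j + n)) R (iteratedDeriv n f) := by
  induction n with
  | zero => simpa using h
  | succ n ih =>
    rw [iteratedDeriv_succ]
    convert ih.deriv hR using 2 with j
    rw [show j + (n + 1) = j + 1 + n by ring, Nat.descFactorial_succ]
    rw [show j + 1 + n - n = j + 1 by omega]
    push_cast
    ring

lemma HasSeriesOn.modDeriv {c : ℕ → ℂ} {R : ℝ} {f : ℂ → ℂ} (hR : 0 < R)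
    (h : HasSeriesOn c R f) (n : ℕ) :
    HasSeriesOn (fun j => (j.descFactorial n : ℂ) * c j) R (modDeriv n f) := by
  intro z hz
  have h1 := (h.iteratedDeriv hR n z hz).mul_left (z ^ n)
  rw [SurrogateSpatial.modDeriv]
  rw [← (add_left_injective n).hasSum_iff]
  · refine h1.congr_fun ?_ |> id
    intro j
    simp only [Function.comp, pow_add]
    ring
  · intro j hj
    have : j < n := by
      by_contra hc
      exact hj ⟨j - n, by simp only; omega⟩
    simp [Nat.descFactorial_of_lt this]

lemma norm_one_sub_mul_circleMap (q t : ℝ) :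
    ‖1 - (q : ℂ) * circleMap 0 1 t‖ = ‖circleMap 0 1 t - (q : ℂ)‖ := by
  have h1 : ‖circleMap 0 1 t‖ = 1 := by simp
  have h2 : circleMap 0 1 t - (q : ℂ) =
      circleMap 0 1 t * (starRingEnd ℂ) (1 - (q : ℂ) * circleMap 0 1 t) := by
    have : circleMap 0 1 t * (starRingEnd ℂ) (circleMap 0 1 t) = 1 := by
      rw [Complex.mul_conj, Complex.normSq_eq_norm_sq, h1]
      simp
    rw [map_sub, map_mul, Complex.conj_ofReal, map_one]
    linear_combination (q : ℂ) * this
  rw [h2, norm_mul, h1, one_mul, RCLike.norm_conj]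

/-- On the unit circle `|1 - q u| = |u - q|`, so the integrand is the Poisson kernel divided by `1 -
q ^ 2`, and the Poisson kernel has mean `1`. -/
lemma integral_inv_norm_sq {q : ℝ} (hq0 : 0 ≤ q) (hq1 : q < 1) :
    (2 * Real.pi)⁻¹ * ∫ t in (0 : ℝ)..2 * Real.pi, (‖1 - (q : ℂ) * circleMap 0 1 t‖ ^ 2)⁻¹ =
      (1 - q ^ 2)⁻¹ := by
  have h := (diffContOnCl_const (𝕜 := ℂ) (s := Metric.ball (0 : ℂ) 1)
    (c := (1 : ℂ))).circleAverage_poissonKernel_smul' (w := (q : ℂ)) (c := 0) (R := 1)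
    (by simpa [abs_of_nonneg hq0] using hq1)
  have hpos : 0 < 1 - q ^ 2 := by nlinarith
  have h3 : ∀ t : ℝ, ((‖circleMap 0 1 t - 0‖ ^ 2 - ‖(q : ℂ) - 0‖ ^ 2) /
      ‖circleMap 0 1 t - 0 - ((q : ℂ) - 0)‖ ^ 2) • (1 : ℂ) =
      (((1 - q ^ 2) * (‖1 - (q : ℂ) * circleMap 0 1 t‖ ^ 2)⁻¹ : ℝ) : ℂ) := by
    intro t
    rw [norm_one_sub_mul_circleMap]
    simp [div_eq_mul_inv]
  rw [Real.circleAverage_def] at h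
  simp_rw [h3] at h
  rw [intervalIntegral.integral_ofReal, intervalIntegral.integral_const_mul] at h
  rw [Complex.real_smul] at h
  have h4 : (2 * Real.pi)⁻¹ * ((1 - q ^ 2) *
      ∫ t in (0 : ℝ)..2 * Real.pi, (‖1 - (q : ℂ) * circleMap 0 1 t‖ ^ 2)⁻¹) = 1 := by
    exact_mod_cast h
  refine eq_inv_of_mul_eq_one_left ?_
  linarith

lemma HasSeriesOn.differentiableOn {c : ℕ → ℂ} {R : ℝ} {f : ℂ → ℂ} (hR : 0 < R)
    (h : HasSeriesOn c R f) : DifferentiableOn ℂ f (Metric.ball 0 R) := by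
  have := (h.hasFPowerSeriesOnBall hR).differentiableOn
  rwa [Metric.eball_ofReal] at this

lemma HasSeriesOn.norm_coeff_mul_pow_le {c : ℕ → ℂ} {R : ℝ} {f : ℂ → ℂ} (hR : 0 < R)
    (h : HasSeriesOn c R f) {r : ℝ} (hr : 0 < r) (hrR : r < R) (j : ℕ) :
    ‖c j‖ * r ^ j ≤ (2 * Real.pi)⁻¹ * ∫ t in (0 : ℝ)..2 * Real.pi, ‖f (circleMap 0 r t)‖ := by
  lift r to NNReal using hr.le
  have h1 : DifferentiableOn ℂ f (Metric.closedBall 0 r) :=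
    (h.differentiableOn hR).mono (Metric.closedBall_subset_ball hrR)
  have h2 := h1.hasFPowerSeriesOnBall (by exact_mod_cast hr)
  have h3 := h2.hasFPowerSeriesAt.eq_formalMultilinearSeries
    (h.hasFPowerSeriesOnBall hR).hasFPowerSeriesAt
  have h4 := norm_cauchyPowerSeries_le f 0 r j
  rw [h3, FormalMultilinearSeries.ofScalars_norm, abs_of_pos hr, inv_pow,
    ← div_eq_mul_inv, le_div_iff₀ (by positivity)] at h4
  exact h4

lemma half_le_one_sub_pow (j : ℕ) (hj : 1 ≤ j) : (1 / 2 : ℝ) ≤ (1 - 1 / (2 * j)) ^ j := by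
  have hj' : (1 : ℝ) ≤ j := by exact_mod_cast hj
  have h1 : (-2 : ℝ) ≤ -(1 / (2 * j)) := by
    have : 1 / (2 * (j : ℝ)) ≤ 1 := by
      rw [div_le_one (by positivity)]
      linarith
    linarith
  have := one_add_mul_le_pow h1 j
  rw [← sub_eq_add_neg] at this
  refine le_trans (le_of_eq ?_) this
  field_simp
  ring

/-- Cauchy's estimate on the circle of radius `q R` with `1 - q = 1 / (2 j)`. As `α ≥ 2`, `|1 - q u|
^ (-α) ≤ (1 - q) ^ (2 - α) |1 - q u| ^ (-2)`, whose mean is at most `(1 - q) ^ (1 - α) = (2 j) ^ (α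
- 1)`. Bernoulli's inequality gives `q ^ j ≥ 1 / 2`. No contour outside the disc is needed. -/
lemma HasSeriesOn.norm_coeff_le {c : ℕ → ℂ} {R : ℝ} {f : ℂ → ℂ} (hR : 0 < R)
    (h : HasSeriesOn c R f) {K α : ℝ} (hK : 0 ≤ K) (hα : 2 ≤ α)
    (hf : ∀ z : ℂ, ‖z‖ < R → ‖f z‖ ≤ K * ‖1 - z / (R : ℂ)‖ ^ (-α)) (j : ℕ) (hj : 1 ≤ j) :
    ‖c j‖ * R ^ j ≤ 2 * K * (2 * j) ^ (α - 1) := by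
  have hj' : (1 : ℝ) ≤ j := by exact_mod_cast hj
  set q : ℝ := 1 - 1 / (2 * j) with hq
  have hx : 0 < 1 / (2 * (j : ℝ)) := by positivity
  have hx1 : 1 / (2 * (j : ℝ)) ≤ 1 / 2 := by
    apply one_div_le_one_div_of_le <;> linarith
  have hq0 : 0 < q := by linarith
  have hq1 : q < 1 := by linarith
  have hRc : (R : ℂ) ≠ 0 := by exact_mod_cast hR.ne'
  have h1 := h.norm_coeff_mul_pow_le hR (r := q * R) (by positivity) (by nlinarith) j
  have hz : ∀ t : ℝ, circleMap 0 (q * R) t / (R : ℂ) = q * circleMap 0 1 t := by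
    intro t
    simp only [circleMap, zero_add]
    push_cast
    field_simp
  have hlow : ∀ t : ℝ, 1 - q ≤ ‖1 - (q : ℂ) * circleMap 0 1 t‖ := by
    intro t
    have := norm_sub_norm_le (1 : ℂ) ((q : ℂ) * circleMap 0 1 t)
    simpa [abs_of_pos hq0] using this
  have hpt : ∀ t : ℝ, ‖f (circleMap 0 (q * R) t)‖ ≤
      K * (1 - q) ^ (2 - α) * (‖1 - (q : ℂ) * circleMap 0 1 t‖ ^ 2)⁻¹ := by
    intro t
    have h2 := hf (circleMap 0 (q * R) t) (by
      rw [norm_circleMap_zero, abs_of_pos (by positivity)]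
      nlinarith)
    rw [hz] at h2
    refine h2.trans ?_
    have hp : 0 < ‖1 - (q : ℂ) * circleMap 0 1 t‖ := lt_of_lt_of_le (by linarith) (hlow t)
    rw [mul_assoc]
    refine mul_le_mul_of_nonneg_left ?_ hK
    rw [show -α = (2 - α) + (-2 : ℝ) by ring, Real.rpow_add hp, Real.rpow_neg hp.le]
    norm_cast
    refine mul_le_mul_of_nonneg_right ?_ (by positivity)
    exact Real.rpow_le_rpow_of_nonpos (by linarith) (hlow t) (by linarith)
  have hcont : Continuous fun t : ℝ => ‖f (circleMap 0 (q * R) t)‖ := by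
    refine ((h.differentiableOn hR).continuousOn.comp_continuous (continuous_circleMap 0 (q * R))
      fun t => ?_).norm
    rw [mem_ball_zero_iff, norm_circleMap_zero, abs_of_pos (by positivity)]
    nlinarith
  have hcont2 : Continuous fun t : ℝ =>
      K * (1 - q) ^ (2 - α) * (‖1 - (q : ℂ) * circleMap 0 1 t‖ ^ 2)⁻¹ := by
    refine continuous_const.mul (Continuous.inv₀ (by fun_prop) fun t => ?_)
    have := lt_of_lt_of_le (show 0 < 1 - q by linarith) (hlow t)
    positivity
  have h3 := intervalIntegral.integral_mono_on (μ := volume) (a := 0) (b := 2 * Real.pi) (by positivity)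
    (hcont.intervalIntegrable _ _) (hcont2.intervalIntegrable _ _) fun t _ => hpt t
  rw [intervalIntegral.integral_const_mul] at h3
  have h4 : ‖c j‖ * (q * R) ^ j ≤ K * (1 - q) ^ (2 - α) * (1 - q ^ 2)⁻¹ := by
    rw [← integral_inv_norm_sq hq0.le hq1]
    refine h1.trans ((mul_le_mul_of_nonneg_left h3 (by positivity)).trans (le_of_eq ?_))
    ring
  have h5 : (1 - q) ^ (2 - α) * (1 - q ^ 2)⁻¹ ≤ (2 * (j : ℝ)) ^ (α - 1) := by
    have h6 : (1 - q ^ 2)⁻¹ ≤ (1 - q) ^ (-1 : ℝ) := by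
      rw [Real.rpow_neg_one]
      apply inv_anti₀ (by linarith)
      nlinarith
    refine (mul_le_mul_of_nonneg_left h6 (by have : 0 < 1 - q := by linarith
                                             positivity)).trans (le_of_eq ?_)
    rw [← Real.rpow_add (by linarith), show 1 - q = (2 * (j : ℝ))⁻¹ by rw [hq]; field_simp; ring,
      Real.inv_rpow (by positivity), ← Real.rpow_neg (by positivity)]
    congr 1
    ring
  have h7 := half_le_one_sub_pow j hj
  rw [mul_pow] at h4
  have h8 : ‖c j‖ * R ^ j * (1 / 2) ≤ ‖c j‖ * R ^ j * q ^ j :=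
    mul_le_mul_of_nonneg_left h7 (by positivity)
  have h9 := mul_le_mul_of_nonneg_left h5 hK
  nlinarith

/-- To the left of the vertical line through `R` the argument of `z - R` exceeds `π / 2 > φ` in
absolute value. This part of the indented disc is open and contains the closed disc of radius `R`
without the point `R`, which is all that the estimates use. -/
lemma mem_Delta0_of_re_lt {R η φ : ℝ} (hφ' : φ < Real.pi / 2) {z : ℂ}
    (hz : ‖z‖ < ‖(R : ℂ) * (1 + (η : ℂ) * Complex.exp ((φ : ℂ) * Complex.I))‖)
    (hre : z.re < R) : z ∈ Delta0 R η φ := by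
  refine ⟨hz, ?_, ?_⟩
  · rintro rfl
    simp at hre
  · refine hφ'.trans ?_
    by_contra hc
    have := Complex.abs_arg_le_pi_div_two_iff.1 (not_lt.1 hc)
    simp at this
    linarith

lemma lt_norm_Delta0 {R η φ : ℝ} (hR : 0 < R) (hη : 0 < η) (hφ : 0 < φ) (hφ' : φ < Real.pi / 2) :
    R < ‖(R : ℂ) * (1 + (η : ℂ) * Complex.exp ((φ : ℂ) * Complex.I))‖ := by
  have hc : 0 < Real.cos φ := Real.cos_pos_of_mem_Ioo ⟨by linarith, hφ'⟩
  have h1 := Complex.re_le_norm (1 + (η : ℂ) * Complex.exp ((φ : ℂ) * Complex.I))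
  rw [Complex.exp_mul_I] at h1
  simp [Complex.cos_ofReal_re, Complex.sin_ofReal_im] at h1
  rw [norm_mul, Complex.norm_real, Real.norm_of_nonneg hR.le, Complex.exp_mul_I]
  nlinarith [mul_pos hη hc]

lemma re_lt_of_norm_le {R : ℝ} {z : ℂ} (hz : ‖z‖ ≤ R) (hne : z ≠ R) : z.re < R := by
  rcases (Complex.re_le_norm z).lt_or_eq with h | h
  · linarith
  · rcases hz.lt_or_eq with h' | h'
    · linarith
    · exfalso
      apply hne
      have h2 := Complex.re_eq_norm.1 h
      apply Complex.ext
      · simp [h, h']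
      · simpa using (Complex.nonneg_iff.1 h2).2.symm

/-- Near `R` the local bound applies; the rest of the closed disc is compact, and there `f` is
continuous and `|1 - z / R|` does not vanish. -/
lemma exists_bound_of_isBigO {R η φ : ℝ} (hR : 0 < R) (hη : 0 < η) (hφ : 0 < φ)
    (hφ' : φ < Real.pi / 2) {f : ℂ → ℂ} {α : ℝ}
    (hf : ContinuousOn f {z : ℂ | ‖z‖ < ‖(R : ℂ) *
      (1 + (η : ℂ) * Complex.exp ((φ : ℂ) * Complex.I))‖ ∧ z.re < R})
    (hO : f =O[𝓝[Delta0 R η φ] (R : ℂ)] fun z : ℂ => ‖1 - z / (R : ℂ)‖ ^ (-α)) :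
    ∃ K, 0 ≤ K ∧ ∀ z : ℂ, ‖z‖ < R → ‖f z‖ ≤ K * ‖1 - z / (R : ℂ)‖ ^ (-α) := by
  have hRc : (R : ℂ) ≠ 0 := by exact_mod_cast hR.ne'
  have hρ := lt_norm_Delta0 hR hη hφ hφ'
  obtain ⟨K₁, hK₁, hb⟩ := hO.exists_pos
  rw [isBigOWith_iff, eventually_nhdsWithin_iff, Metric.eventually_nhds_iff] at hb
  obtain ⟨ε, hε, hb⟩ := hb
  set S : Set ℂ := Metric.closedBall 0 R ∩ {z | ε ≤ dist z R} with hS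
  have hSc : IsCompact S := (isCompact_closedBall _ _).inter_right
    (isClosed_le continuous_const (by fun_prop))
  have hne : ∀ z ∈ S, z ≠ R := by
    rintro z hz rfl
    have := hz.2
    simp at this
    linarith
  have hSsub : ∀ z ∈ S, ‖z‖ < ‖(R : ℂ) *
      (1 + (η : ℂ) * Complex.exp ((φ : ℂ) * Complex.I))‖ ∧ z.re < R := fun z hz =>
    ⟨lt_of_le_of_lt (by simpa using hz.1) hρ, re_lt_of_norm_le (by simpa using hz.1) (hne z hz)⟩
  have hw : ∀ z : ℂ, z ≠ R → 0 < ‖1 - z / (R : ℂ)‖ := by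
    intro z hz
    rw [norm_pos_iff, sub_ne_zero, ne_comm, Ne, div_eq_one_iff_eq hRc]
    exact hz
  have hcont : ContinuousOn (fun z : ℂ => ‖f z‖ * ‖1 - z / (R : ℂ)‖ ^ α) S := by
    refine ((hf.mono hSsub).norm).mul ?_
    refine ContinuousOn.rpow_const (by fun_prop) fun z hz => Or.inl (hw z (hne z hz)).ne'
  obtain ⟨K₂, hK₂⟩ := hSc.bddAbove_image hcont
  refine ⟨max K₁ K₂, le_max_of_le_left hK₁.le, fun z hz => ?_⟩
  have hzne : z ≠ R := by
    rintro rfl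
    simp [abs_of_pos hR] at hz
  have hwz := hw z hzne
  by_cases hd : dist z R < ε
  · have := hb hd (mem_Delta0_of_re_lt hφ' (hz.trans hρ) (re_lt_of_norm_le hz.le hzne))
    refine this.trans ?_
    rw [Real.norm_of_nonneg (by positivity)]
    gcongr
    exact le_max_left _ _
  · have := hK₂ ⟨z, ⟨by simpa using hz.le, not_lt.1 hd⟩, rfl⟩
    simp only at this
    rw [Real.rpow_neg hwz.le, ← div_eq_mul_inv, le_div_iff₀ (by positivity)]
    exact this.trans (le_max_right _ _)

lemma continuousOn_modDeriv {R η φ : ℝ} (hφ' : φ < Real.pi / 2) {g : ℂ → ℂ}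
    (hg : DifferentiableOn ℂ g (Delta0 R η φ)) (n : ℕ) :
    ContinuousOn (modDeriv n g) {z : ℂ | ‖z‖ < ‖(R : ℂ) *
      (1 + (η : ℂ) * Complex.exp ((φ : ℂ) * Complex.I))‖ ∧ z.re < R} := by
  have hopen : IsOpen {z : ℂ | ‖z‖ < ‖(R : ℂ) *
      (1 + (η : ℂ) * Complex.exp ((φ : ℂ) * Complex.I))‖ ∧ z.re < R} :=
    (isOpen_lt continuous_norm continuous_const).inter
      (isOpen_lt Complex.continuous_re continuous_const)
  have h1 := (hg.mono fun z hz => mem_Delta0_of_re_lt hφ' hz.1 hz.2).analyticOnNhd hopen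
  have h2 := (h1.iterated_deriv n).continuousOn
  rw [← iteratedDeriv_eq_iterate] at h2
  exact (continuousOn_id.pow n).mul h2

lemma eventually_norm_one_sub_div {R : ℝ} (hR : 0 < R) (S : Set ℂ) (hS : (R : ℂ) ∉ S) :
    ∀ᶠ z in 𝓝[S] (R : ℂ), 0 < ‖1 - z / (R : ℂ)‖ ∧ ‖1 - z / (R : ℂ)‖ ≤ 1 := by
  have hRc : (R : ℂ) ≠ 0 := by exact_mod_cast hR.ne'
  have h1 : Tendsto (fun z : ℂ => ‖1 - z / (R : ℂ)‖) (𝓝[S] (R : ℂ)) (𝓝 0) := by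
    have : Continuous fun z : ℂ => ‖1 - z / (R : ℂ)‖ := by fun_prop
    have h := this.tendsto (R : ℂ)
    rw [div_self hRc, sub_self, norm_zero] at h
    exact h.mono_left nhdsWithin_le_nhds
  filter_upwards [h1.eventually (ge_mem_nhds one_pos), self_mem_nhdsWithin] with z hz hzS
  refine ⟨?_, hz⟩
  rw [norm_pos_iff, sub_ne_zero, ne_comm, Ne, div_eq_one_iff_eq hRc]
  rintro rfl
  exact hS hzS

lemma isBigO_norm_one_sub_div_rpow {R : ℝ} (hR : 0 < R) (S : Set ℂ) (hS : (R : ℂ) ∉ S)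
    {α β : ℝ} (h : β ≤ α) :
    (fun z : ℂ => ‖1 - z / (R : ℂ)‖ ^ α) =O[𝓝[S] (R : ℂ)]
      fun z : ℂ => ‖1 - z / (R : ℂ)‖ ^ β := by
  refine IsBigO.of_bound 1 ?_
  filter_upwards [eventually_norm_one_sub_div hR S hS] with z hz
  have := hz.1
  rw [Real.norm_of_nonneg (by positivity), Real.norm_of_nonneg (by positivity), one_mul]
  exact Real.rpow_le_rpow_of_exponent_ge hz.1 hz.2 h

lemma notMem_Delta0 (R η φ : ℝ) : (R : ℂ) ∉ Delta0 R η φ := fun h => h.2.1 rfl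

/-- The third derivative is taken so that the remainder, of size `|1 - z / R| ^ (-(3 - d))`, has
exponent at least `2`, as `norm_coeff_le` requires. Subtracting the series `∑ (j + 2 choose 2) x ^
j` of `(1 - x) ^ (-3)` compares `(j - 1)(j - 2) w_j R ^ j` with `A (j + 2)(j + 1)`. -/
lemma exists_coeff_sub_le {R η φ : ℝ} (hR : 0 < R) (hη : 0 < η) (hφ : 0 < φ)
    (hφ' : φ < Real.pi / 2) {w : ℕ → ℝ} {g : ℂ → ℂ} (hg : IsGeneratingFunctionOn w R g)
    (hol : DifferentiableOn ℂ g (Delta0 R η φ)) {A δ : ℝ} (hδ : 0 < δ)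
    (hO : (fun z : ℂ => modDeriv 3 g z - (A : ℂ) * ((3 - 1).factorial : ℂ) / (1 - z / R) ^ 3)
        =O[𝓝[Delta0 R η φ] (R : ℂ)] (fun z : ℂ => ‖1 - z / (R : ℂ)‖ ^ (δ - 3))) :
    ∃ C d : ℝ, 0 < d ∧ ∀ j : ℕ, 3 ≤ j → |w j * R ^ j - A| ≤ C * (j : ℝ) ^ (-d) := by
  have hRc : (R : ℂ) ≠ 0 := by exact_mod_cast hR.ne'
  -- `d ≤ 1` keeps the exponent `3 - d` at least `2`, and also lets the correction of order `x` be
  -- absorbed in `x ^ (2 - d)`.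
  set d : ℝ := min δ 1 with hd
  have hd0 : 0 < d := lt_min hδ one_pos
  have hd1 : d ≤ 1 := min_le_right _ _
  set f : ℂ → ℂ := fun z => modDeriv 3 g z - (A : ℂ) * ((3 - 1).factorial : ℂ) / (1 - z / R) ^ 3
    with hf
  have hO' : f =O[𝓝[Delta0 R η φ] (R : ℂ)] fun z : ℂ => ‖1 - z / (R : ℂ)‖ ^ (-(3 - d)) :=
    hO.trans (isBigO_norm_one_sub_div_rpow hR _ (notMem_Delta0 R η φ) (by
      have := min_le_left δ 1
      linarith))
  have hcont : ContinuousOn f {z : ℂ | ‖z‖ < ‖(R : ℂ) *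
      (1 + (η : ℂ) * Complex.exp ((φ : ℂ) * Complex.I))‖ ∧ z.re < R} := by
    refine (continuousOn_modDeriv hφ' hol 3).sub (ContinuousOn.div (by fun_prop) (by fun_prop) ?_)
    intro z hz h0
    rw [pow_eq_zero_iff (by norm_num), sub_eq_zero, eq_comm, div_eq_one_iff_eq hRc] at h0
    rw [h0] at hz
    simp at hz
  obtain ⟨K, hK, hb⟩ := exists_bound_of_isBigO hR hη hφ hφ' hcont hO'
  have hser : HasSeriesOn (fun j => (j.descFactorial 3 : ℂ) * ((w j / j : ℝ) : ℂ) -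
      (A : ℂ) * 2 * (((j + 2).choose 2 : ℂ) * (R : ℂ)⁻¹ ^ j)) R f := by
    intro z hz
    have h1 := HasSeriesOn.modDeriv hR hg 3 z hz
    have h2 := hasSum_choose_mul_geometric_of_norm_lt_one 2 (r := z / (R : ℂ)) (by
      rw [norm_div, Complex.norm_real, Real.norm_of_nonneg hR.le, div_lt_one hR]
      exact hz)
    have h3 := h1.sub (h2.mul_left ((A : ℂ) * 2))
    have h4 : f z = modDeriv 3 g z - (A : ℂ) * 2 * (1 / (1 - z / (R : ℂ)) ^ (2 + 1)) := by
      simp [hf, div_eq_mul_inv]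
    rw [h4]
    refine h3.congr_fun ?_ |> id
    intro j
    simp only [div_pow, inv_pow]
    ring
  have hc := hser.norm_coeff_le hR hK (α := 3 - d) (by linarith) hb
  refine ⟨(2 * K * 2 ^ (2 - d) + 6 * |A|) * (9 / 2), d, hd0, fun j hj => ?_⟩
  have h5 := hc j (by omega)
  obtain ⟨i, rfl⟩ : ∃ i, j = i + 3 := ⟨j - 3, by omega⟩
  have hx : (3 : ℝ) ≤ ((i + 3 : ℕ) : ℝ) := by push_cast; linarith [Nat.cast_nonneg (α := ℝ) i]
  set x : ℝ := ((i + 3 : ℕ) : ℝ) with hxd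
  have h6 : (((i + 3).descFactorial 3 : ℕ) : ℝ) = x * (x - 1) * (x - 2) := by
    rw [show (i + 3).descFactorial 3 = (i + 3) * (i + 2) * (i + 1) by
      simp [Nat.descFactorial]; ring, hxd]
    push_cast
    ring
  have h7 : (((i + 3 + 2).choose 2 : ℕ) : ℝ) = (x + 2) * (x + 1) / 2 := by
    rw [Nat.cast_choose_two, hxd]
    push_cast
    ring
  have h8 : ‖(((i + 3).descFactorial 3 : ℕ) : ℂ) * ((w (i + 3) / (i + 3 : ℕ) : ℝ) : ℂ) -
      (A : ℂ) * 2 * ((((i + 3 + 2).choose 2 : ℕ) : ℂ) * (R : ℂ)⁻¹ ^ (i + 3))‖ * R ^ (i + 3) =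
      |(x - 1) * (x - 2) * (w (i + 3) * R ^ (i + 3)) - A * ((x + 2) * (x + 1))| := by
    have h9 : (((i + 3).descFactorial 3 : ℕ) : ℂ) * ((w (i + 3) / (i + 3 : ℕ) : ℝ) : ℂ) -
      (A : ℂ) * 2 * ((((i + 3 + 2).choose 2 : ℕ) : ℂ) * (R : ℂ)⁻¹ ^ (i + 3)) =
      (((x * (x - 1) * (x - 2)) * (w (i + 3) / x) -
        A * 2 * (((x + 2) * (x + 1) / 2) * R⁻¹ ^ (i + 3)) : ℝ) : ℂ) := by
      rw [← h6, ← h7, hxd]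
      push_cast
      rfl
    rw [h9, Complex.norm_real, Real.norm_eq_abs]
    nth_rewrite 1 [← abs_of_pos (pow_pos hR (i + 3))]
    rw [← abs_mul]
    congr 1
    have hxne : x ≠ 0 := by linarith
    rw [inv_pow]
    field_simp
  rw [h8] at h5
  have hx0 : 0 < x := by linarith
  have h10 : (2 * x) ^ (3 - d - 1) = 2 ^ (2 - d) * (x ^ 2 * x ^ (-d)) := by
    rw [Real.mul_rpow (by norm_num) hx0.le, show 3 - d - 1 = 2 - d by ring]
    congr 1
    rw [← Real.rpow_natCast x 2, ← Real.rpow_add hx0]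
    norm_num
    rfl
  rw [h10] at h5
  have h11 : x ≤ x ^ 2 * x ^ (-d) := by
    rw [← Real.rpow_natCast x 2, ← Real.rpow_add hx0]
    conv_lhs => rw [← Real.rpow_one x]
    apply Real.rpow_le_rpow_of_exponent_le (by linarith)
    norm_num
    linarith
  set y := x ^ 2 * x ^ (-d) with hy
  -- `(x + 2)(x + 1) - (x - 1)(x - 2) = 6 x`.
  have h12 : |(x - 1) * (x - 2) * (w (i + 3) * R ^ (i + 3) - A)| ≤
      (2 * K * 2 ^ (2 - d) + 6 * |A|) * y := by
    calc |(x - 1) * (x - 2) * (w (i + 3) * R ^ (i + 3) - A)|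
        = |((x - 1) * (x - 2) * (w (i + 3) * R ^ (i + 3)) - A * ((x + 2) * (x + 1))) +
          A * (6 * x)| := by congr 1; ring
      _ ≤ _ := abs_add_le _ _
      _ ≤ 2 * K * (2 ^ (2 - d) * y) + |A| * (6 * y) := by
          rw [abs_mul A, abs_of_pos (show 0 < 6 * x by linarith)]
          gcongr
      _ = _ := by ring
  rw [abs_mul, abs_of_pos (by nlinarith)] at h12
  -- Equality holds at `x = 3`, the smallest index admitted.
  have h13 : 2 / 9 * x ^ 2 ≤ (x - 1) * (x - 2) := by nlinarith
  have h14 : 2 / 9 * x ^ 2 * |w (i + 3) * R ^ (i + 3) - A| ≤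
      (2 * K * 2 ^ (2 - d) + 6 * |A|) * y :=
    (mul_le_mul_of_nonneg_right h13 (abs_nonneg _)).trans h12
  rw [hy] at h14
  have hx2 : 0 < x ^ 2 := by positivity
  refine le_of_mul_le_mul_left ?_ (show 0 < 2 / 9 * x ^ 2 by positivity)
  refine h14.trans (le_of_eq ?_)
  ring

lemma tendsto_of_abs_sub_le {b : ℕ → ℝ} {A C d : ℝ} (hd : 0 < d)
    (h : ∀ j : ℕ, 3 ≤ j → |b j - A| ≤ C * (j : ℝ) ^ (-d)) : Tendsto b atTop (𝓝 A) := by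
  rw [tendsto_iff_norm_sub_tendsto_zero]
  have h1 : Tendsto (fun j : ℕ => C * (j : ℝ) ^ (-d)) atTop (𝓝 (C * 0)) :=
    ((tendsto_rpow_neg_atTop hd).comp tendsto_natCast_atTop_atTop).const_mul C
  rw [mul_zero] at h1
  refine squeeze_zero' (Eventually.of_forall fun _ => norm_nonneg _) ?_ h1
  filter_upwards [eventually_ge_atTop 3] with j hj using h j hj

lemma summable_of_abs_sub_le {b : ℕ → ℝ} {A C d : ℝ} (hd : 0 < d)
    (h : ∀ j : ℕ, 3 ≤ j → |b j - A| ≤ C * (j : ℝ) ^ (-d)) :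
    Summable fun j : ℕ => |b j - A| / j := by
  have h1 : Summable fun j : ℕ => C * (j : ℝ) ^ (-d - 1) :=
    (Real.summable_nat_rpow.2 (by linarith)).mul_left C
  refine h1.of_norm_bounded_eventually_nat ?_
  filter_upwards [eventually_ge_atTop 3] with j hj
  have hj' : (0 : ℝ) < j := by exact_mod_cast (by omega : 0 < j)
  rw [Real.norm_of_nonneg (by positivity), Real.rpow_sub_one hj'.ne', ← mul_div_assoc]
  gcongr
  exact h j hj

/-- With `n ≥ s + 2` the singular term and the remainder are both `O(|1 - z / R| ^ (-(n - s)))` with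
exponent `n - s ≥ 2`, so `norm_coeff_le` applies to the `n`-th modified derivative. For `j > 2 n`
its coefficients carry a factor at least `(j / 2) ^ n`, and dividing by it leaves the order `j ^
(-s)`; `C₁` takes care of the finitely many smaller `j`. -/
lemma exists_coeff_le {R η φ : ℝ} (hR : 0 < R) (hη : 0 < η) (hφ : 0 < φ)
    (hφ' : φ < Real.pi / 2) {w : ℕ → ℝ} (hw : ∀ j, 1 ≤ j → 0 ≤ w j) {g : ℂ → ℂ}
    (hg : IsGeneratingFunctionOn w R g) (hol : DifferentiableOn ℂ g (Delta0 R η φ))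
    {s : ℝ} {n : ℕ} (hn : s + 2 ≤ n) {A : ℂ} {δ : ℝ} (hδ : 0 < δ)
    (hO : (fun z : ℂ => modDeriv n g z - A * (1 - z / R) ^ ((s - n : ℝ) : ℂ))
        =O[𝓝[Delta0 R η φ] (R : ℂ)] (fun z : ℂ => ‖1 - z / (R : ℂ)‖ ^ (s - n + δ))) :
    ∃ C : ℝ, ∀ j : ℕ, 1 ≤ j → w j * R ^ j ≤ C * (j : ℝ) ^ (-s) := by
  have hO' : modDeriv n g =O[𝓝[Delta0 R η φ] (R : ℂ)]
      fun z : ℂ => ‖1 - z / (R : ℂ)‖ ^ (-((n : ℝ) - s)) := by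
    have h1 : (fun z : ℂ => A * (1 - z / R) ^ ((s - n : ℝ) : ℂ)) =O[𝓝[Delta0 R η φ] (R : ℂ)]
        fun z : ℂ => ‖1 - z / (R : ℂ)‖ ^ (-((n : ℝ) - s)) := by
      refine IsBigO.of_bound ‖A‖ (Eventually.of_forall fun z => ?_)
      rw [norm_mul, Complex.norm_cpow_real, neg_sub, Real.norm_of_nonneg (by positivity)]
    have h2 := (hO.trans (isBigO_norm_one_sub_div_rpow hR _ (notMem_Delta0 R η φ)
      (show -((n : ℝ) - s) ≤ s - n + δ by linarith))).add h1
    simpa using h2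
  obtain ⟨K, hK, hb⟩ := exists_bound_of_isBigO hR hη hφ hφ' (continuousOn_modDeriv hφ' hol n) hO'
  have hc := (HasSeriesOn.modDeriv hR hg n).norm_coeff_le hR hK (α := n - s) (by linarith) hb
  have hsum : ∀ j : ℕ, 0 ≤ w (j + 1) * R ^ (j + 1) * ((j + 1 : ℕ) : ℝ) ^ s := fun j => by
    have := hw (j + 1) (by omega)
    positivity
  set C₁ : ℝ := ∑ j ∈ Finset.range (2 * n), w (j + 1) * R ^ (j + 1) * ((j + 1 : ℕ) : ℝ) ^ s
  set C₂ : ℝ := 2 * K * 2 ^ (n - s - 1) * 2 ^ n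
  refine ⟨max C₁ C₂, fun j hj => ?_⟩
  have hj' : (0 : ℝ) < j := by exact_mod_cast hj
  by_cases hjn : j ≤ 2 * n
  · have h1 : w j * R ^ j * (j : ℝ) ^ s ≤ C₁ := by
      obtain ⟨i, rfl⟩ : ∃ i, j = i + 1 := ⟨j - 1, by omega⟩
      exact Finset.single_le_sum (f := fun j : ℕ => w (j + 1) * R ^ (j + 1) *
        ((j + 1 : ℕ) : ℝ) ^ s) (fun i _ => hsum i) (Finset.mem_range.2 (by omega))
    rw [Real.rpow_neg hj'.le, ← div_eq_mul_inv, le_div_iff₀ (by positivity)]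
    exact h1.trans (le_max_left _ _)
  · have h1 := hc j hj
    have h2 : ((j : ℝ) / 2) ^ n ≤ j.descFactorial n := by
      refine le_trans ?_ (Nat.cast_le.2 (Nat.pow_sub_le_descFactorial j n))
      push_cast
      gcongr
      have h3 : j ≤ 2 * (j + 1 - n) := by omega
      have h4 : (j : ℝ) ≤ 2 * ((j + 1 - n : ℕ) : ℝ) := by exact_mod_cast h3
      linarith
    have hwj := hw j hj
    rw [norm_mul, Complex.norm_natCast, Complex.norm_real, Real.norm_of_nonneg (by positivity)]
      at h1
    have h5 : ((j : ℝ) / 2) ^ n * (w j / j) * R ^ j ≤ 2 * K * (2 * j) ^ ((n : ℝ) - s - 1) :=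
      le_trans (by gcongr) h1
    have h6 : (2 * (j : ℝ)) ^ ((n : ℝ) - s - 1) = 2 ^ ((n : ℝ) - s - 1) *
        ((j : ℝ) ^ n * (j : ℝ) ^ (-s) / j) := by
      rw [Real.mul_rpow (by norm_num) hj'.le, show (n : ℝ) - s - 1 = n + -s - 1 by ring,
        Real.rpow_sub_one hj'.ne', Real.rpow_add hj', Real.rpow_natCast]
    rw [h6, div_pow] at h5
    have h7 : (j : ℝ) ^ n / (2 ^ n * j) * (w j * R ^ j) ≤
        (j : ℝ) ^ n / (2 ^ n * j) * (C₂ * (j : ℝ) ^ (-s)) := by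
      refine le_trans (le_of_eq ?_) (h5.trans (le_of_eq ?_))
      · field_simp
      · simp only [C₂]
        field_simp
    refine (le_of_mul_le_mul_left h7 (by positivity)).trans ?_
    gcongr
    exact le_max_right _ _

/-- Since `s > 1` the coefficients are summable up to the boundary, and dominated convergence as `r
↑ R` identifies the boundary value with their sum. This makes `κ₁` the mean of the bulk per unit of
`N`. -/
lemma hasSum_of_coeff_le {R : ℝ} (hR : 0 < R) {w : ℕ → ℝ} (hw : ∀ j, 1 ≤ j → 0 ≤ w j)
    {g : ℂ → ℂ} (hg : IsGeneratingFunctionOn w R g) {s C : ℝ} (hs : 1 < s)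
    (hC : ∀ j : ℕ, 1 ≤ j → w j * R ^ j ≤ C * (j : ℝ) ^ (-s)) :
    HasSum (dropZero fun j => w j * R ^ j) (modDerivAt 1 g R).toReal ∧
      modDerivAt 1 g R = ((modDerivAt 1 g R).toReal : EReal) := by
  set k : ℕ → ℝ := dropZero fun j => w j * R ^ j with hk
  have hk0 : ∀ j, 0 ≤ k j := dropZero_nonneg fun j hj => by have := hw j hj; positivity
  have hsum : Summable k := by
    have h1 : Summable fun j : ℕ => C * (j : ℝ) ^ (-s) :=
      (Real.summable_nat_rpow.2 (by linarith)).mul_left C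
    refine h1.of_norm_bounded_eventually_nat ?_
    filter_upwards [eventually_ge_atTop 1] with j hj
    rw [Real.norm_of_nonneg (hk0 j), hk, dropZero_of_ne _ (by omega)]
    exact hC j hj
  have h2 : ∀ r : ℝ, 0 < r → r < R →
      ∑' j, k j * (r / R) ^ j = (modDeriv 1 g (r : ℂ)).re := by
    intro r hr hrR
    have h3 := HasSeriesOn.modDeriv hR hg 1 (r : ℂ) (by simpa [abs_of_pos hr] using hrR)
    have h4 := Complex.hasSum_re h3
    rw [← h4.tsum_eq]
    refine tsum_congr fun j => ?_
    rcases Nat.eq_zero_or_pos j with rfl | hj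
    · simp [hk]
    · have hj' : (j : ℝ) ≠ 0 := by positivity
      simp only [hk, dropZero_of_ne _ (show j ≠ 0 by omega), Nat.descFactorial_one]
      have : (j : ℂ) * ((w j / j : ℝ) : ℂ) * (r : ℂ) ^ j = ((w j * r ^ j : ℝ) : ℂ) := by
        rw [← Complex.ofReal_natCast, ← Complex.ofReal_pow, ← Complex.ofReal_mul,
          ← Complex.ofReal_mul]
        congr 1
        field_simp
      rw [this, Complex.ofReal_re, div_pow]
      field_simp
  have h5 : Tendsto (fun r : ℝ => ∑' j, k j * (r / R) ^ j) (𝓝[<] R) (𝓝 (∑' j, k j)) := by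
    refine tendsto_tsum_of_dominated_convergence hsum (fun j => ?_) ?_
    · have : Continuous fun r : ℝ => k j * (r / R) ^ j := by fun_prop
      have h6 := this.tendsto R
      rw [div_self hR.ne', one_pow, mul_one] at h6
      exact h6.mono_left nhdsWithin_le_nhds
    · filter_upwards [Ioo_mem_nhdsLT hR] with r hr j
      have h0 : 0 ≤ r / R := div_nonneg hr.1.le hR.le
      rw [Real.norm_of_nonneg (mul_nonneg (hk0 j) (pow_nonneg h0 _))]
      exact mul_le_of_le_one_right (hk0 j) (pow_le_one₀ h0 ((div_le_one hR).2 hr.2.le))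
  have h6 : Tendsto (fun r : ℝ => (((modDeriv 1 g (r : ℂ)).re : ℝ) : EReal)) (𝓝[<] R)
      (𝓝 ((∑' j, k j : ℝ) : EReal)) := by
    refine (continuous_coe_real_ereal.tendsto _).comp (h5.congr' ?_)
    filter_upwards [Ioo_mem_nhdsLT hR] with r hr using h2 r hr.1 hr.2
  have h7 : modDerivAt 1 g R = ((∑' j, k j : ℝ) : EReal) := h6.limUnder_eq
  rw [h7, EReal.toReal_coe]
  exact ⟨hsum.hasSum, rfl⟩

/-! ### The Mecke formula for a unit-rate Poisson process -/

instance : IsProbabilityMeasure (expMeasure 1) := isProbabilityMeasure_expMeasure one_pos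

/-- The law of a sequence of independent standard exponential variables. -/
def expSeq : Measure (ℕ → ℝ) := Measure.infinitePi fun _ : ℕ => expMeasure 1

instance : IsProbabilityMeasure expSeq := by unfold expSeq; infer_instance

/-- Prepend a term to a sequence. -/
def seqCons (x : ℝ) (e : ℕ → ℝ) : ℕ → ℝ
  | 0 => x
  | n + 1 => e n

lemma measurable_seqCons : Measurable fun p : ℝ × (ℕ → ℝ) => seqCons p.1 p.2 := by
  refine measurable_pi_lambda _ fun n => ?_
  cases n with
  | zero => exact measurable_fst
  | succ n => exact (measurable_pi_apply n).comp measurable_snd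

lemma map_seqCons : ((expMeasure 1).prod expSeq).map (fun p => seqCons p.1 p.2) = expSeq := by
  refine Measure.eq_infinitePi _ fun s t ht => ?_
  classical
  set t' : ℕ → Set ℝ := fun i => if i ∈ s then t i else Set.univ with ht'
  have hm : ∀ i, MeasurableSet (t' i) := fun i => by
    simp only [ht']
    split_ifs with h
    · exact ht i
    · exact MeasurableSet.univ
  obtain ⟨n, hn⟩ : ∃ n, s ⊆ Finset.range (n + 1) := by
    obtain ⟨n, hn⟩ := s.exists_nat_subset_range
    exact ⟨n, hn.trans (Finset.range_mono (Nat.le_succ n))⟩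
  have h1 : (fun p : ℝ × (ℕ → ℝ) => seqCons p.1 p.2) ⁻¹' (Set.pi s t) =
      t' 0 ×ˢ Set.pi (Finset.range n) (fun i => t' (i + 1)) := by
    ext ⟨x, e⟩
    simp only [Set.mem_preimage, Set.mem_pi, Finset.mem_coe, Set.mem_prod, Finset.mem_range, ht']
    constructor
    · intro h
      refine ⟨?_, fun i _ => ?_⟩
      · split_ifs with h0
        · exact h 0 h0
        · trivial
      · split_ifs with h0
        · exact h (i + 1) h0
        · trivial
    · rintro ⟨h0, h⟩ i hi
      cases i with
      | zero => simpa [hi, seqCons] using h0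
      | succ i =>
        have := h i (by have := Finset.mem_range.1 (hn hi); omega)
        simpa [hi, seqCons] using this
  rw [Measure.map_apply measurable_seqCons (MeasurableSet.pi s.countable_toSet fun i _ => ht i), h1,
    Measure.prod_prod, expSeq, Measure.infinitePi_pi _ fun i _ => hm (i + 1), mul_comm,
    ← Finset.prod_range_succ' fun i => expMeasure 1 (t' i)]
  rw [← Finset.prod_subset hn fun i _ hi => by simp [ht', hi]]
  exact Finset.prod_congr rfl fun i hi => by simp [ht', hi]

lemma lintegral_expSeq {F : (ℕ → ℝ) → ℝ≥0∞} (hF : Measurable F) :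
    ∫⁻ e, F e ∂expSeq = ∫⁻ x, ∫⁻ e, F (seqCons x e) ∂expSeq ∂expMeasure 1 := by
  conv_lhs => rw [← map_seqCons]
  rw [lintegral_map hF measurable_seqCons]
  exact lintegral_prod _ (hF.comp measurable_seqCons).aemeasurable

lemma lintegral_expMeasure {g : ℝ → ℝ≥0∞} (hg : Measurable g) :
    ∫⁻ x, g x ∂expMeasure 1 = ∫⁻ x in Set.Ioi 0, ENNReal.ofReal (Real.exp (-x)) * g x := by
  have h1 : Measurable (exponentialPDF 1) := (measurable_exponentialPDFReal 1).ennreal_ofReal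
  have h2 : expMeasure 1 = volume.withDensity (exponentialPDF 1) := rfl
  rw [h2, lintegral_withDensity_eq_lintegral_mul _ h1 hg, ← lintegral_indicator measurableSet_Ioi]
  refine lintegral_congr_ae ?_
  filter_upwards [compl_mem_ae_iff.2 (measure_singleton (0 : ℝ))] with x hx
  rcases lt_or_gt_of_ne (show x ≠ 0 from hx) with h | h
  · simp [exponentialPDF_of_neg h, h.le]
  · simp [exponentialPDF_of_nonneg h.le, h]

/-- The `n`-th point, started at `a`, of the renewal process with increments `e`. -/
def renewal (a : ℝ) (e : ℕ → ℝ) (n : ℕ) : ℝ := a + ∑ i ∈ Finset.range n, e i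

@[simp] lemma renewal_zero (a : ℝ) (e : ℕ → ℝ) : renewal a e 0 = a := by simp [renewal]

lemma renewal_seqCons (a x : ℝ) (e : ℕ → ℝ) (n : ℕ) :
    renewal a (seqCons x e) (n + 1) = renewal (a + x) e n := by
  simp [renewal, Finset.sum_range_succ', seqCons]
  ring

lemma measurable_renewal (n : ℕ) : Measurable fun p : ℝ × (ℕ → ℝ) => renewal p.1 p.2 n := by
  unfold renewal
  fun_prop

/-- The linear statistics of the points of the renewal process started at `a`. -/
def linStat {ι : Type*} (f : ι → ℝ → ℝ≥0∞) (a : ℝ) (e : ℕ → ℝ) (c : ι) : ℝ≥0∞ :=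
  ∑' n, f c (renewal a e (n + 1))

lemma measurable_linStat {ι : Type*} {f : ι → ℝ → ℝ≥0∞} (hf : ∀ c, Measurable (f c)) :
    Measurable fun p : ℝ × (ℕ → ℝ) => linStat f p.1 p.2 := by
  refine measurable_pi_lambda _ fun c => Measurable.tsum fun n => ?_
  exact (hf c).comp (measurable_renewal (n + 1))

lemma linStat_seqCons {ι : Type*} (f : ι → ℝ → ℝ≥0∞) (a x : ℝ) (e : ℕ → ℝ) :
    linStat f a (seqCons x e) = (fun c => f c (a + x)) + linStat f (a + x) e := by
  ext c
  simp only [linStat, Pi.add_apply]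
  rw [tsum_eq_zero_add' ENNReal.summable]
  simp [renewal_seqCons]

/-- The substitution `z = x + y` turns the density of two successive gaps into `e^{-z}` on `0 < x <
z`: given the second point, the first one is distributed as Lebesgue measure on the gap that its
removal creates. This is the Mecke formula for a single gap. -/
lemma lintegral_exp_exp {Q : ℝ → ℝ → ℝ≥0∞} (hQ : Measurable (Function.uncurry Q)) (a : ℝ) :
    ∫⁻ x, ∫⁻ y, Q (a + x) (a + x + y) ∂expMeasure 1 ∂expMeasure 1 =
      ∫⁻ z, (∫⁻ u in Set.Ioc a (a + z), Q u (a + z)) ∂expMeasure 1 := by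
  have hQ' : ∀ {p q : ℝ × ℝ → ℝ}, Measurable p → Measurable q →
      Measurable fun w => Q (p w) (q w) := fun hp hq => hQ.comp (hp.prodMk hq)
  set g : ℝ × ℝ → ℝ≥0∞ := {w : ℝ × ℝ | 0 < w.1 ∧ w.1 < w.2}.indicator fun w =>
    ENNReal.ofReal (Real.exp (-w.2)) * Q (a + w.1) (a + w.2) with hg
  have hgm : Measurable g := by
    refine Measurable.indicator ?_ ?_
    · exact Measurable.mul (by fun_prop) (hQ' (by fun_prop) (by fun_prop))
    · exact (measurableSet_lt measurable_const measurable_fst).inter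
        (measurableSet_lt measurable_fst measurable_snd)
  have hL : ∀ x : ℝ, Measurable fun y => Q (a + x) (a + x + y) := fun x =>
    hQ.comp ((measurable_const).prodMk (by fun_prop))
  have hleft : ∫⁻ x, ∫⁻ y, Q (a + x) (a + x + y) ∂expMeasure 1 ∂expMeasure 1 =
      ∫⁻ x, ∫⁻ z, g (x, z) := by
    rw [lintegral_expMeasure (Measurable.lintegral_prod_right'
      (f := fun w : ℝ × ℝ => Q (a + w.1) (a + w.1 + w.2)) (hQ' (by fun_prop) (by fun_prop))),
      ← lintegral_indicator measurableSet_Ioi]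
    refine lintegral_congr fun x => ?_
    by_cases hx : 0 < x
    · rw [Set.indicator_of_mem (Set.mem_Ioi.2 hx), lintegral_expMeasure (hL x),
        ← lintegral_indicator measurableSet_Ioi, ← lintegral_sub_right_eq_self _ x,
        ← lintegral_const_mul' _ _ ENNReal.ofReal_ne_top]
      refine lintegral_congr fun z => ?_
      by_cases hz : x < z
      · simp only [hg, Set.indicator, Set.mem_Ioi, Set.mem_ofPred_eq, sub_pos, hx, hz, and_self,
          if_true]
        rw [← mul_assoc, ← ENNReal.ofReal_mul (Real.exp_pos _).le, ← Real.exp_add,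
          show a + x + (z - x) = a + z by ring, show -x + -(z - x) = -z by ring]
      · simp [hg, hz]
    · simp [hg, hx]
  have hright : ∫⁻ z, (∫⁻ u in Set.Ioc a (a + z), Q u (a + z)) ∂expMeasure 1 =
      ∫⁻ z, ∫⁻ x, g (x, z) := by
    have h1 : ∀ z : ℝ, ∫⁻ u in Set.Ioc a (a + z), Q u (a + z) =
        ∫⁻ x, {w : ℝ × ℝ | 0 < w.1 ∧ w.1 < w.2}.indicator
          (fun w => Q (a + w.1) (a + w.2)) (x, z) := by
      intro z
      rw [← setLIntegral_congr Ioo_ae_eq_Ioc, ← lintegral_indicator measurableSet_Ioo,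
        ← lintegral_add_left_eq_self
          (fun u => (Set.Ioo a (a + z)).indicator (fun u => Q u (a + z)) u) a]
      refine lintegral_congr fun x => ?_
      simp [Set.indicator]
    have h2 : Measurable fun w : ℝ × ℝ => {w : ℝ × ℝ | 0 < w.1 ∧ w.1 < w.2}.indicator
          (fun w => Q (a + w.1) (a + w.2)) w :=
      Measurable.indicator (hQ' (by fun_prop) (by fun_prop))
        ((measurableSet_lt measurable_const measurable_fst).inter
        (measurableSet_lt measurable_fst measurable_snd))
    simp_rw [h1]
    rw [lintegral_expMeasure (Measurable.lintegral_prod_left' h2),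
      ← lintegral_indicator measurableSet_Ioi]
    refine lintegral_congr fun z => ?_
    by_cases hz : 0 < z
    · rw [Set.indicator_of_mem (Set.mem_Ioi.2 hz), ← lintegral_const_mul' _ _ ENNReal.ofReal_ne_top]
      refine lintegral_congr fun x => ?_
      simp [hg, Set.indicator]
    · rw [Set.indicator_of_notMem (by simpa using hz)]
      symm
      have h3 : (fun x => g (x, z)) = 0 := by
        ext x
        refine Set.indicator_of_notMem ?_ _
        rintro ⟨h3, h4⟩
        exact hz (h3.trans h4)
      rw [h3, lintegral_zero_fun]
  rw [hleft, hright]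
  exact lintegral_lintegral_swap (f := fun x z => g (x, z)) hgm.aemeasurable

section Mecke

variable {ι : Type*} {f : ι → ℝ → ℝ≥0∞} {h : ℝ → ℝ≥0∞}

lemma measurable_lintegral_linStat (hf : ∀ c, Measurable (f c)) {Ψ : (ι → ℝ≥0∞) → ℝ≥0∞}
    (hΨ : Measurable Ψ) {α : Type*} [MeasurableSpace α] {p : α → ι → ℝ≥0∞} (hp : Measurable p)
    {q : α → ℝ} (hq : Measurable q) :
    Measurable fun w => ∫⁻ e, Ψ (p w + linStat f (q w) e) ∂expSeq := by
  refine Measurable.lintegral_prod_right' (f := fun w : α × (ℕ → ℝ) =>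
    Ψ (p w.1 + linStat f (q w.1) w.2)) ?_
  refine hΨ.comp ((hp.comp measurable_fst).add ?_)
  exact (measurable_linStat hf).comp ((hq.comp measurable_fst).prodMk measurable_snd)

lemma measurable_setLIntegral_renewal (hf : ∀ c, Measurable (f c)) (hh : Measurable h) (n : ℕ)
    (a : ℝ) {Ψ : (ι → ℝ≥0∞) → ℝ≥0∞} (hΨ : Measurable Ψ) :
    Measurable fun e => ∫⁻ u in Set.Ioc (renewal a e n) (renewal a e (n + 1)),
      h u * Ψ ((fun c => f c u) + linStat f a e) := by
  have hfm : Measurable fun u : ℝ => fun c => f c u := measurable_pi_lambda _ hf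
  have hren : ∀ (a : ℝ) (n : ℕ), Measurable fun e => renewal a e n := fun a n =>
    (measurable_renewal n).comp (measurable_const.prodMk measurable_id)
  have hlin : ∀ a : ℝ, Measurable fun e => linStat f a e := fun a =>
    (measurable_linStat hf).comp (measurable_const.prodMk measurable_id)
  simp_rw [← lintegral_indicator measurableSet_Ioc]
  have hset : MeasurableSet {w : (ℕ → ℝ) × ℝ |
      renewal a w.1 n < w.2 ∧ w.2 ≤ renewal a w.1 (n + 1)} :=
    (measurableSet_lt ((hren a n).comp measurable_fst) measurable_snd).inter
      (measurableSet_le measurable_snd ((hren a (n + 1)).comp measurable_fst))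
  refine Measurable.lintegral_prod_right' (f := {w : (ℕ → ℝ) × ℝ |
      renewal a w.1 n < w.2 ∧ w.2 ≤ renewal a w.1 (n + 1)}.indicator fun w =>
        h w.2 * Ψ ((fun c => f c w.2) + linStat f a w.1)) (Measurable.indicator ?_ hset)
  exact (hh.comp measurable_snd).mul (hΨ.comp
    ((hfm.comp measurable_snd).add ((hlin a).comp measurable_fst)))

/-- Contribution of one index: singling out the point number `n + 1` amounts to inserting an extra
point `u` into the gap number `n`. For `n = 0` condition on the first two gaps and use
`lintegral_exp_exp`. The inductive step conditions on the first gap, moving the start to `a + x` and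
absorbing the first point into `Ψ`; hence the quantification over `a` and `Ψ` inside the induction.
-/
lemma mecke_aux (hf : ∀ c, Measurable (f c)) (hh : Measurable h) (n : ℕ) :
    ∀ (a : ℝ) (Ψ : (ι → ℝ≥0∞) → ℝ≥0∞), Measurable Ψ →
    ∫⁻ e, h (renewal a e (n + 1)) * Ψ (linStat f a e) ∂expSeq =
      ∫⁻ e, (∫⁻ u in Set.Ioc (renewal a e n) (renewal a e (n + 1)),
        h u * Ψ ((fun c => f c u) + linStat f a e)) ∂expSeq := by
  have hfm : Measurable fun u : ℝ => fun c => f c u := measurable_pi_lambda _ hf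
  have hren : ∀ (a : ℝ) (n : ℕ), Measurable fun e => renewal a e n := fun a n =>
    (measurable_renewal n).comp (measurable_const.prodMk measurable_id)
  have hlin : ∀ a : ℝ, Measurable fun e => linStat f a e := fun a =>
    (measurable_linStat hf).comp (measurable_const.prodMk measurable_id)
  have hmL : ∀ (n : ℕ) (a : ℝ) (Ψ : (ι → ℝ≥0∞) → ℝ≥0∞), Measurable Ψ →
      Measurable fun e => h (renewal a e (n + 1)) * Ψ (linStat f a e) := fun n a Ψ hΨ =>
    (hh.comp (hren a (n + 1))).mul (hΨ.comp (hlin a))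
  have hmR : ∀ (n : ℕ) (a : ℝ) (Ψ : (ι → ℝ≥0∞) → ℝ≥0∞), Measurable Ψ → _ :=
    fun n a Ψ hΨ => measurable_setLIntegral_renewal hf hh n a hΨ
  induction n with
  | zero =>
    intro a Ψ hΨ
    have hΨ' : ∀ x, Measurable fun v => Ψ ((fun c => f c x) + v) := fun x =>
      hΨ.comp (measurable_const.add measurable_id)
    rw [lintegral_expSeq (hmL 0 a Ψ hΨ), lintegral_expSeq (hmR 0 a Ψ hΨ)]
    simp_rw [renewal_seqCons, renewal_zero, linStat_seqCons]
    have h1 := lintegral_exp_exp (Q := fun u v => h u *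
      ∫⁻ e, Ψ (((fun c => f c u) + fun c => f c v) + linStat f v e) ∂expSeq) (by
        refine (hh.comp measurable_fst).mul (measurable_lintegral_linStat hf hΨ
          ((hfm.comp measurable_fst).add (hfm.comp measurable_snd)) measurable_snd)) a
    refine Eq.trans ?_ (h1.trans ?_)
    · refine lintegral_congr fun x => ?_
      have hm : Measurable fun e => Ψ ((fun c => f c (a + x)) + linStat f (a + x) e) :=
        (hΨ' (a + x)).comp (hlin (a + x))
      rw [lintegral_const_mul _ hm, lintegral_expSeq hm, ← lintegral_const_mul _ ?_]
      · refine lintegral_congr fun y => ?_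
        simp only [linStat_seqCons, add_assoc]
      · refine Measurable.lintegral_prod_right' (f := fun w : ℝ × (ℕ → ℝ) =>
          Ψ ((fun c => f c (a + x)) + linStat f (a + x) (seqCons w.1 w.2))) ?_
        exact ((hΨ' (a + x)).comp (hlin (a + x))).comp measurable_seqCons
    · refine lintegral_congr fun z => ?_
      rw [lintegral_lintegral_swap]
      · refine lintegral_congr fun u => ?_
        rw [lintegral_const_mul]
        · simp only [add_assoc]
        · exact hΨ.comp (measurable_const.add (measurable_const.add (hlin (a + z))))
      · refine Measurable.aemeasurable ?_
        exact (hh.comp measurable_snd).mul (hΨ.comp ((hfm.comp measurable_snd).add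
          (measurable_const.add ((hlin (a + z)).comp measurable_fst))))
  | succ n ih =>
    intro a Ψ hΨ
    rw [lintegral_expSeq (hmL (n + 1) a Ψ hΨ), lintegral_expSeq (hmR (n + 1) a Ψ hΨ)]
    refine lintegral_congr fun x => ?_
    simp_rw [renewal_seqCons, linStat_seqCons]
    rw [ih (a + x) (fun v => Ψ ((fun c => f c (a + x)) + v))
      (hΨ.comp (measurable_const.add measurable_id))]
    simp only [add_left_comm]

end Mecke

lemma ae_expSeq_pos : ∀ᵐ e ∂expSeq, ∀ n, 0 < e n := by
  rw [ae_all_iff]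
  intro n
  have h1 : ∀ᵐ x ∂expMeasure 1, 0 < x := by
    rw [ae_iff, ← lintegral_indicator_one (by measurability)]
    rw [lintegral_expMeasure (measurable_one.indicator (by measurability))]
    rw [setLIntegral_congr_fun measurableSet_Ioi (g := fun _ => 0)]
    · simp
    · intro x hx
      simp [Set.mem_Ioi.1 hx]
  have h2 : expSeq.map (fun e => e n) = expMeasure 1 := Measure.infinitePi_map_eval _ n
  rw [← h2] at h1
  exact ae_of_ae_map (measurable_pi_apply n).aemeasurable h1

lemma lintegral_exp_neg_renewal (n : ℕ) :
    ∫⁻ e, ENNReal.ofReal (Real.exp (-renewal 0 e n)) ∂expSeq = 2⁻¹ ^ n := by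
  have hm : ∀ n, Measurable fun e => ENNReal.ofReal (Real.exp (-renewal 0 e n)) := fun n => by
    unfold renewal
    fun_prop
  induction n with
  | zero => simp
  | succ n ih =>
    rw [lintegral_expSeq (hm (n + 1))]
    have h1 : ∀ x : ℝ, ∫⁻ e, ENNReal.ofReal (Real.exp (-renewal 0 (seqCons x e) (n + 1))) ∂expSeq =
        ENNReal.ofReal (Real.exp (-x)) * 2⁻¹ ^ n := by
      intro x
      rw [← ih, ← lintegral_const_mul _ (hm n)]
      refine lintegral_congr fun e => ?_
      rw [renewal_seqCons, ← ENNReal.ofReal_mul (Real.exp_pos _).le, ← Real.exp_add]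
      congr 2
      simp [renewal]
      ring
    simp_rw [h1]
    rw [lintegral_mul_const _ (by fun_prop), lintegral_expMeasure (by fun_prop), pow_succ']
    congr 1
    simp_rw [← ENNReal.ofReal_mul (Real.exp_pos _).le, ← Real.exp_add]
    have h2 := integral_exp_mul_Ioi (a := -2) (by norm_num) 0
    have h3 : IntegrableOn (fun x : ℝ => Real.exp (-2 * x)) (Set.Ioi 0) :=
      exp_neg_integrableOn_Ioi 0 (by norm_num)
    have h4 : ∀ x : ℝ, -x + -x = -2 * x := fun x => by ring
    simp_rw [h4]
    rw [← ofReal_integral_eq_lintegral_ofReal h3 (Eventually.of_forall fun x => (Real.exp_pos _).le),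
      h2]
    simp

/-- The mean of `e^{-S_n}` is `2 ^ (-n)`, so the infimum of these variables has mean zero, and the
partial sums, which increase, are almost surely unbounded. -/
lemma ae_tendsto_renewal : ∀ᵐ e ∂expSeq, Tendsto (renewal 0 e) atTop atTop := by
  have hm : ∀ n, Measurable fun e => ENNReal.ofReal (Real.exp (-renewal 0 e n)) := fun n => by
    unfold renewal
    fun_prop
  have h1 : ∫⁻ e, ⨅ n, ENNReal.ofReal (Real.exp (-renewal 0 e n)) ∂expSeq = 0 := by
    refine le_antisymm ?_ zero_le
    refine ge_of_tendsto' (f := fun n : ℕ => ((2⁻¹ : ℝ≥0∞) ^ n)) (x := atTop) ?_ ?_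
    · exact ENNReal.tendsto_pow_atTop_nhds_zero_of_lt_one (by simp)
    · intro n
      rw [← lintegral_exp_neg_renewal n]
      exact lintegral_mono fun e => iInf_le _ n
  rw [lintegral_eq_zero_iff (Measurable.iInf hm)] at h1
  filter_upwards [h1, ae_expSeq_pos] with e he hpos
  have hmono : Monotone (renewal 0 e) := monotone_nat_of_le_succ fun n => by
    simp only [renewal, Finset.sum_range_succ]
    linarith [hpos n]
  refine tendsto_atTop_atTop_of_monotone hmono fun b => ?_
  by_contra hc
  push Not at hc
  have h2 : ENNReal.ofReal (Real.exp (-b)) ≤ ⨅ n, ENNReal.ofReal (Real.exp (-renewal 0 e n)) :=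
    le_iInf fun n => ENNReal.ofReal_le_ofReal (Real.exp_le_exp.2 (by linarith [hc n]))
  rw [he] at h2
  simp only [Pi.zero_apply, nonpos_iff_eq_zero, ENNReal.ofReal_eq_zero] at h2
  linarith [Real.exp_pos (-b)]

/-- The Mecke formula for the points of a unit-rate Poisson process on `(0, ∞)`. -/
lemma mecke {ι : Type*} {f : ι → ℝ → ℝ≥0∞} {h : ℝ → ℝ≥0∞} (hf : ∀ c, Measurable (f c))
    (hh : Measurable h) {Ψ : (ι → ℝ≥0∞) → ℝ≥0∞} (hΨ : Measurable Ψ) :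
    ∫⁻ e, (∑' n, h (renewal 0 e (n + 1))) * Ψ (linStat f 0 e) ∂expSeq =
      ∫⁻ u in Set.Ioi 0, h u * ∫⁻ e, Ψ ((fun c => f c u) + linStat f 0 e) ∂expSeq := by
  have hren : ∀ n : ℕ, Measurable fun e => renewal 0 e n := fun n =>
    (measurable_renewal n).comp (measurable_const.prodMk measurable_id)
  have hlin : Measurable fun e => linStat f 0 e :=
    (measurable_linStat hf).comp (measurable_const.prodMk measurable_id)
  have hfm : Measurable fun u : ℝ => fun c => f c u := measurable_pi_lambda _ hf
  have hm : Measurable fun w : ℝ × (ℕ → ℝ) =>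
      h w.1 * Ψ ((fun c => f c w.1) + linStat f 0 w.2) :=
    (hh.comp measurable_fst).mul (hΨ.comp ((hfm.comp measurable_fst).add
      (hlin.comp measurable_snd)))
  simp_rw [← ENNReal.tsum_mul_right]
  have hmt : ∀ n : ℕ, AEMeasurable (fun e => h (renewal 0 e (n + 1)) * Ψ (linStat f 0 e)) expSeq :=
    fun n => ((hh.comp (hren (n + 1))).mul (hΨ.comp hlin)).aemeasurable
  rw [lintegral_tsum hmt]
  simp_rw [mecke_aux hf hh _ 0 Ψ hΨ]
  rw [← lintegral_tsum fun n => ?_]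
  · have h1 : ∀ᵐ e ∂expSeq, ∑' n, ∫⁻ u in Set.Ioc (renewal 0 e n) (renewal 0 e (n + 1)),
        h u * Ψ ((fun c => f c u) + linStat f 0 e) =
        ∫⁻ u in Set.Ioi 0, h u * Ψ ((fun c => f c u) + linStat f 0 e) := by
      filter_upwards [ae_expSeq_pos, ae_tendsto_renewal] with e hpos ht
      have hmono : Monotone (renewal 0 e) := monotone_nat_of_le_succ fun n => by
        simp only [renewal, Finset.sum_range_succ]
        linarith [hpos n]
      have h2 := iUnion_Ioc_map_succ_eq_Ioi (f := renewal 0 e) (by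
        intro n
        simpa using hmono (Nat.zero_le n)) (Filter.not_bddAbove_of_tendsto_atTop ht)
      simp only [Nat.bot_eq_zero, renewal_zero] at h2
      rw [← h2, lintegral_iUnion (fun n => measurableSet_Ioc) hmono.pairwise_disjoint_on_Ioc_succ]
      rfl
    rw [lintegral_congr_ae h1, lintegral_lintegral_swap]
    · refine lintegral_congr fun u => ?_
      exact lintegral_const_mul _ (hΨ.comp (measurable_const.add hlin))
    · exact (hm.comp measurable_swap).aemeasurable
  · exact (measurable_setLIntegral_renewal hf hh n 0 hΨ).aemeasurable

/-! ### The intensity of the Poisson process -/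

lemma integrableOn_inv_mul_exp_neg {x : ℝ} (hx : 0 < x) :
    IntegrableOn (fun t : ℝ => t⁻¹ * Real.exp (-t)) (Set.Ioi x) := by
  have h0 : IntegrableOn (fun t : ℝ => Real.exp (-t)) (Set.Ioi x) := by
    simpa using exp_neg_integrableOn_Ioi x one_pos
  have h1 : IntegrableOn (fun t : ℝ => x⁻¹ * Real.exp (-t)) (Set.Ioi x) := Integrable.const_mul h0 _
  refine Integrable.mono' h1 ?_ ?_
  · exact Measurable.aestronglyMeasurable (by fun_prop)
  · refine (ae_restrict_iff' measurableSet_Ioi).2 (Eventually.of_forall fun t ht => ?_)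
    have ht' : x < t := ht
    have : 0 < t := hx.trans ht
    rw [Real.norm_of_nonneg (by positivity)]
    gcongr

lemma gammaTail_eq {θ x : ℝ} (hx : 0 < x) :
    gammaTail θ x = gammaTail θ 1 - θ * ∫ t in (1 : ℝ)..x, t⁻¹ * Real.exp (-t) := by
  have h1 := intervalIntegral.integral_interval_add_Ioi' (a := 1) (b := x)
    (f := fun t : ℝ => t⁻¹ * Real.exp (-t)) (μ := volume) ?_ (integrableOn_inv_mul_exp_neg hx)
  · unfold gammaTail
    rw [← h1]
    ring
  · refine ContinuousOn.intervalIntegrable fun t ht => ?_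
    have : 0 < t := lt_of_lt_of_le (lt_min one_pos hx) ht.1
    exact ContinuousAt.continuousWithinAt (by fun_prop (disch := exact this.ne'))

lemma hasDerivAt_gammaTail (θ : ℝ) {x : ℝ} (hx : 0 < x) :
    HasDerivAt (gammaTail θ) (-(θ * (x⁻¹ * Real.exp (-x)))) x := by
  have hc : ∀ t : ℝ, 0 < t → ContinuousAt (fun t : ℝ => t⁻¹ * Real.exp (-t)) t := fun t ht => by
    fun_prop (disch := exact ht.ne')
  have h1 : HasDerivAt (fun x => gammaTail θ 1 - θ * ∫ t in (1 : ℝ)..x, t⁻¹ * Real.exp (-t))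
      (-(θ * (x⁻¹ * Real.exp (-x)))) x := by
    refine ((intervalIntegral.integral_hasDerivAt_right ?_ ?_ (hc x hx)).const_mul θ).const_sub _
    · refine ContinuousOn.intervalIntegrable fun t ht => ?_
      have : 0 < t := lt_of_lt_of_le (lt_min one_pos hx) ht.1
      exact (hc t this).continuousWithinAt
    · exact (Measurable.stronglyMeasurable (by fun_prop)).stronglyMeasurableAtFilter
  refine h1.congr_of_eventuallyEq ?_
  filter_upwards [lt_mem_nhds hx] with y hy using gammaTail_eq hy

lemma strictAntiOn_gammaTail {θ : ℝ} (hθ : 0 < θ) : StrictAntiOn (gammaTail θ) (Set.Ioi 0) := by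
  refine strictAntiOn_of_deriv_neg (convex_Ioi 0)
    (fun x hx => (hasDerivAt_gammaTail θ hx).continuousAt.continuousWithinAt) fun x hx => ?_
  rw [interior_Ioi] at hx
  rw [(hasDerivAt_gammaTail θ hx).deriv]
  have : 0 < x := hx
  have : 0 < θ * (x⁻¹ * Real.exp (-x)) := by positivity
  linarith

lemma gammaTail_pos {θ x : ℝ} (hθ : 0 < θ) (hx : 0 < x) : 0 < gammaTail θ x := by
  have h0 : 0 ≤ gammaTail θ (x + 1) := by
    refine mul_nonneg hθ.le (setIntegral_nonneg measurableSet_Ioi fun t ht => ?_)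
    have : 0 < t := lt_trans (by linarith) ht
    positivity
  exact h0.trans_lt (strictAntiOn_gammaTail hθ hx (show (0 : ℝ) < x + 1 by linarith) (by linarith))

lemma gammaTail_le {θ x : ℝ} (hθ : 0 < θ) (hx : 1 ≤ x) : gammaTail θ x ≤ θ * Real.exp (-x) := by
  unfold gammaTail
  rw [← integral_exp_neg_Ioi x]
  refine mul_le_mul_of_nonneg_left (setIntegral_mono_on
    (integrableOn_inv_mul_exp_neg (by linarith))
    (by simpa using exp_neg_integrableOn_Ioi x one_pos) measurableSet_Ioi fun t ht => ?_) hθ.le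
  have : 1 ≤ t := hx.trans (le_of_lt ht)
  exact mul_le_of_le_one_left (Real.exp_pos _).le (inv_le_one_of_one_le₀ this)

lemma le_gammaTail {θ x : ℝ} (hθ : 0 < θ) (hx : 0 < x) (hx1 : x ≤ 1) :
    θ * Real.exp (-1) * (-Real.log x) ≤ gammaTail θ x := by
  rw [gammaTail_eq hx, intervalIntegral.integral_symm]
  have h1 : ∫ t in x..1, t⁻¹ * Real.exp (-1) = -Real.log x * Real.exp (-1) := by
    rw [intervalIntegral.integral_mul_const, integral_inv_of_pos hx one_pos]
    simp
  have hc : ∀ c : ℝ → ℝ, Continuous c → IntervalIntegrable (fun t => t⁻¹ * c t) volume x 1 := by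
    intro c hc
    refine ContinuousOn.intervalIntegrable fun t ht => ?_
    have : 0 < t := lt_of_lt_of_le (lt_min hx one_pos) ht.1
    exact ContinuousAt.continuousWithinAt (by fun_prop (disch := exact this.ne'))
  have hle : ∀ t ∈ Set.Icc x 1, t⁻¹ * Real.exp (-1) ≤ t⁻¹ * Real.exp (-t) := fun t ht => by
    have : 0 < t := hx.trans_le ht.1
    have := ht.2
    gcongr
  have h2 := intervalIntegral.integral_mono_on (μ := volume) hx1 (hc _ continuous_const)
    (hc (fun t => Real.exp (-t)) (by fun_prop)) hle
  rw [h1] at h2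
  have h3 := mul_le_mul_of_nonneg_left h2 hθ.le
  have h4 := gammaTail_pos hθ one_pos
  linarith

lemma image_gammaTail {θ : ℝ} (hθ : 0 < θ) : gammaTail θ '' Set.Ioi 0 = Set.Ioi 0 := by
  refine Set.Subset.antisymm ?_ fun u hu => ?_
  · rintro _ ⟨x, hx, rfl⟩
    exact gammaTail_pos hθ hx
  · have hu : 0 < u := hu
    -- Chosen so that the lower bound of `le_gammaTail` equals `u`.
    set x : ℝ := Real.exp (-(u / (θ * Real.exp (-1)))) with hxd
    have hx : 0 < x := Real.exp_pos _
    have hx1 : x ≤ 1 := Real.exp_le_one_iff.2 (by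
      have : 0 < u / (θ * Real.exp (-1)) := by positivity
      linarith)
    have h1 : u ≤ gammaTail θ x := by
      refine le_trans (le_of_eq ?_) (le_gammaTail hθ hx hx1)
      rw [hxd, Real.log_exp]
      field_simp
    -- Chosen so that `θ e^{-y} ≤ θ / y ≤ u`.
    set y : ℝ := max 1 (θ / u) with hyd
    have hy1 : 1 ≤ y := le_max_left _ _
    have h2 : gammaTail θ y ≤ u := by
      refine (gammaTail_le hθ hy1).trans ?_
      have h3 : y ≤ Real.exp y := by linarith [Real.add_one_le_exp y]
      have h4 : θ / u ≤ Real.exp y := (le_max_right _ _).trans h3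
      rw [div_le_iff₀ hu] at h4
      rw [Real.exp_neg, ← div_eq_mul_inv, div_le_iff₀ (Real.exp_pos _)]
      linarith
    obtain ⟨z, hz, rfl⟩ := intermediate_value_Icc' (hx1.trans hy1) (f := gammaTail θ)
      (fun t ht => (hasDerivAt_gammaTail θ (hx.trans_le ht.1)).continuousAt.continuousWithinAt)
      ⟨h2, h1⟩
    exact ⟨z, hx.trans_le hz.1, rfl⟩

lemma gammaTailInv_gammaTail {θ x : ℝ} (hθ : 0 < θ) (hx : 0 < x) :
    gammaTailInv θ (gammaTail θ x) = x := by
  have : {y : ℝ | 0 < y ∧ gammaTail θ y ≤ gammaTail θ x} = Set.Ici x := by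
    ext y
    constructor
    · rintro ⟨hy, h⟩
      exact ((strictAntiOn_gammaTail hθ).le_iff_ge hy hx).1 h
    · intro hy
      have hy0 : 0 < y := hx.trans_le hy
      exact ⟨hy0, ((strictAntiOn_gammaTail hθ).le_iff_ge hy0 hx).2 hy⟩
  rw [gammaTailInv, this, csInf_Ici]

lemma gammaTailInv_pos {θ u : ℝ} (hθ : 0 < θ) (hu : 0 < u) : 0 < gammaTailInv θ u := by
  obtain ⟨x, hx, rfl⟩ : u ∈ gammaTail θ '' Set.Ioi 0 := by rwa [image_gammaTail hθ]
  rwa [gammaTailInv_gammaTail hθ hx]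

lemma strictAntiOn_gammaTailInv {θ : ℝ} (hθ : 0 < θ) :
    StrictAntiOn (gammaTailInv θ) (Set.Ioi 0) := by
  intro u hu v hv huv
  rw [← image_gammaTail hθ] at hu hv
  obtain ⟨x, hx, rfl⟩ := hu
  obtain ⟨y, hy, rfl⟩ := hv
  rw [gammaTailInv_gammaTail hθ hx, gammaTailInv_gammaTail hθ hy]
  exact ((strictAntiOn_gammaTail hθ).lt_iff_gt hx hy).1 huv

lemma lintegral_gammaTailInv {θ : ℝ} (hθ : 0 < θ) (F : ℝ → ℝ≥0∞) :
    ∫⁻ u in Set.Ioi 0, F (gammaTailInv θ u) =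
      ∫⁻ x in Set.Ioi 0, ENNReal.ofReal (θ * (x⁻¹ * Real.exp (-x))) * F x := by
  have h := lintegral_image_eq_lintegral_abs_deriv_mul measurableSet_Ioi
    (fun x hx => (hasDerivAt_gammaTail θ hx).hasDerivWithinAt)
    (strictAntiOn_gammaTail hθ).injOn (fun u => F (gammaTailInv θ u))
  rw [image_gammaTail hθ] at h
  rw [h]
  refine setLIntegral_congr_fun measurableSet_Ioi fun x hx => ?_
  have hx' : 0 < x := hx
  simp only [gammaTailInv_gammaTail hθ hx', abs_neg]
  rw [abs_of_pos (by positivity)]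

/-! ### Gamma and beta integrals -/

lemma lintegral_rpow_mul_exp_neg {a r : ℝ} (ha : 0 < a) (hr : 0 < r) :
    ∫⁻ x in Set.Ioi 0, ENNReal.ofReal (x ^ (a - 1) * Real.exp (-(r * x))) =
      ENNReal.ofReal (Real.Gamma a * r ^ (-a)) := by
  have h1 := Real.integral_rpow_mul_exp_neg_mul_Ioi ha hr
  have h2 : (1 / r) ^ a * Real.Gamma a = Real.Gamma a * r ^ (-a) := by
    rw [one_div, Real.inv_rpow hr.le, Real.rpow_neg hr.le, mul_comm]
  have hpos : 0 < Real.Gamma a * r ^ (-a) :=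
    mul_pos (Real.Gamma_pos_of_pos ha) (Real.rpow_pos_of_pos hr _)
  rw [h2] at h1
  rw [← h1, ofReal_integral_eq_lintegral_ofReal]
  · exact Integrable.of_integral_ne_zero (by rw [h1]; exact hpos.ne')
  · refine (ae_restrict_iff' measurableSet_Ioi).2 (Eventually.of_forall fun x hx => ?_)
    have : 0 < x := hx
    simp only [Pi.zero_apply]
    positivity

/-- Write `Γ(a + b) (1 + t) ^ (-(a + b))` as a Gamma integral in `y` and integrate over `t` first.
-/
lemma lintegral_beta {a b : ℝ} (ha : 0 < a) (hb : 0 < b) :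
    ∫⁻ t in Set.Ioi 0, ENNReal.ofReal (t ^ (a - 1) * (1 + t) ^ (-(a + b))) =
      ENNReal.ofReal (Real.Gamma a * Real.Gamma b / Real.Gamma (a + b)) := by
  have hG : 0 < Real.Gamma (a + b) := Real.Gamma_pos_of_pos (by linarith)
  have h1 : ENNReal.ofReal (Real.Gamma (a + b)) *
      ∫⁻ t in Set.Ioi 0, ENNReal.ofReal (t ^ (a - 1) * (1 + t) ^ (-(a + b))) =
      ENNReal.ofReal (Real.Gamma a * Real.Gamma b) := by
    rw [← lintegral_const_mul' _ _ ENNReal.ofReal_ne_top]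
    have h2 : ∀ t ∈ Set.Ioi (0 : ℝ), ENNReal.ofReal (Real.Gamma (a + b)) *
        ENNReal.ofReal (t ^ (a - 1) * (1 + t) ^ (-(a + b))) =
        ∫⁻ y in Set.Ioi 0, ENNReal.ofReal (t ^ (a - 1) *
          (y ^ (a + b - 1) * Real.exp (-((1 + t) * y)))) := by
      intro t ht
      have ht : 0 < t := ht
      simp_rw [ENNReal.ofReal_mul (show 0 ≤ t ^ (a - 1) by positivity)]
      rw [lintegral_const_mul' _ _ ENNReal.ofReal_ne_top,
        lintegral_rpow_mul_exp_neg (by linarith) (by linarith), ENNReal.ofReal_mul hG.le]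
      ring
    rw [setLIntegral_congr_fun measurableSet_Ioi h2, lintegral_lintegral_swap]
    · have h3 : ∀ y ∈ Set.Ioi (0 : ℝ), ∫⁻ t in Set.Ioi 0, ENNReal.ofReal (t ^ (a - 1) *
          (y ^ (a + b - 1) * Real.exp (-((1 + t) * y)))) =
          ENNReal.ofReal (Real.Gamma a) * ENNReal.ofReal (y ^ (b - 1) * Real.exp (-(1 * y))) := by
        intro y hy
        have hy : 0 < y := hy
        have h4 : ∀ t : ℝ, ENNReal.ofReal (t ^ (a - 1) *
            (y ^ (a + b - 1) * Real.exp (-((1 + t) * y)))) =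
            ENNReal.ofReal (y ^ (a + b - 1) * Real.exp (-y)) *
            ENNReal.ofReal (t ^ (a - 1) * Real.exp (-(y * t))) := by
          intro t
          rw [← ENNReal.ofReal_mul (by positivity),
            show -((1 + t) * y) = -y + -(y * t) by ring, Real.exp_add]
          congr 1
          ring
        simp_rw [h4]
        rw [lintegral_const_mul' _ _ ENNReal.ofReal_ne_top, lintegral_rpow_mul_exp_neg ha hy,
          ← ENNReal.ofReal_mul (by positivity),
          ← ENNReal.ofReal_mul (Real.Gamma_pos_of_pos ha).le]
        congr 1
        rw [show b - 1 = (a + b - 1) + -a by ring, Real.rpow_add hy, one_mul]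
        ring
      rw [setLIntegral_congr_fun measurableSet_Ioi h3,
        lintegral_const_mul' _ _ ENNReal.ofReal_ne_top, lintegral_rpow_mul_exp_neg hb one_pos,
        Real.one_rpow, mul_one, ENNReal.ofReal_mul (Real.Gamma_pos_of_pos ha).le]
    · refine Measurable.aemeasurable ?_
      unfold Function.uncurry
      fun_prop
  have h5 : Real.Gamma a * Real.Gamma b / Real.Gamma (a + b) =
      (Real.Gamma (a + b))⁻¹ * (Real.Gamma a * Real.Gamma b) := by ring
  rw [h5, ENNReal.ofReal_mul (by positivity), ← h1, ← mul_assoc, ← ENNReal.ofReal_mul (by positivity),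
    inv_mul_cancel₀ hG.ne', ENNReal.ofReal_one, one_mul]

/-! ### Moments of the Poisson process -/

/-- The weight `e^{-t y}`, with value `0` at `y = ∞`. -/
def expNeg (t : ℝ) (y : ℝ≥0∞) : ℝ≥0∞ :=
  if y = ∞ then 0 else ENNReal.ofReal (Real.exp (-(t * y.toReal)))

lemma measurable_expNeg : Measurable fun p : ℝ × ℝ≥0∞ => expNeg p.1 p.2 :=
  Measurable.ite (measurable_snd (measurableSet_singleton ∞)) measurable_const (by fun_prop)

/-- The value `0` at `∞` makes the tilt multiplicative without a finiteness assumption, so it may be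
placed inside the Mecke formula. -/
lemma expNeg_ofReal_add (t : ℝ) {x : ℝ} (hx : 0 ≤ x) (y : ℝ≥0∞) :
    expNeg t (ENNReal.ofReal x + y) = ENNReal.ofReal (Real.exp (-(t * x))) * expNeg t y := by
  by_cases hy : y = ∞
  · simp [expNeg, hy]
  · simp only [expNeg, hy, ENNReal.add_eq_top, ENNReal.ofReal_ne_top, or_self, if_false]
    rw [ENNReal.toReal_add ENNReal.ofReal_ne_top hy, ENNReal.toReal_ofReal hx,
      ← ENNReal.ofReal_mul (Real.exp_pos _).le, ← Real.exp_add]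
    congr 2
    ring

/-- The powers of the points. -/
def pointPow (θ : ℝ) (k : ℕ) (u : ℝ) : ℝ≥0∞ := ENNReal.ofReal (gammaTailInv θ u) ^ k

lemma measurable_pointPow (θ : ℝ) (k : ℕ) : Measurable (pointPow θ k) :=
  (measurable_gammaTailInv θ).ennreal_ofReal.pow_const k

/-- The power sums of the points of the Poisson process. -/
def pointSum (θ : ℝ) (ω : ℕ → ℝ) : ℕ → ℝ≥0∞ := linStat (pointPow θ) 0 ω

lemma measurable_pointSum (θ : ℝ) : Measurable (pointSum θ) := by
  refine measurable_pi_lambda _ fun k => Measurable.tsum fun n => ?_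
  refine (measurable_pointPow θ k).comp ?_
  unfold renewal
  fun_prop

lemma pointSum_eq (θ : ℝ) (ω : ℕ → ℝ) (k : ℕ) :
    pointSum θ ω k = ∑' n, ENNReal.ofReal (poissonPoint θ ω n) ^ k := by
  simp [pointSum, linStat, pointPow, poissonPoint, renewal]

/-- The exponentially tilted joint moments of the power sums. -/
def tiltedMoment {ι : Type*} (θ t : ℝ) (e : ι → ℕ) (s : Finset ι) : ℝ≥0∞ :=
  ∫⁻ ω, (∏ i ∈ s, pointSum θ ω (e i)) * expNeg t (pointSum θ ω 1) ∂expSeq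

section

variable {ι : Type*} {θ t : ℝ} {e : ι → ℕ}

lemma lintegral_pow_mul_exp_gammaTailInv (hθ : 0 < θ) (ht : 0 ≤ t) {m : ℕ} (hm : 1 ≤ m) :
    ∫⁻ u in Set.Ioi 0, ENNReal.ofReal (gammaTailInv θ u) ^ m *
      ENNReal.ofReal (Real.exp (-(t * gammaTailInv θ u))) =
      ENNReal.ofReal (θ * Real.Gamma m * (1 + t) ^ (-(m : ℝ))) := by
  have hm' : (0 : ℝ) < m := by exact_mod_cast hm
  rw [lintegral_gammaTailInv hθ fun x => ENNReal.ofReal x ^ m *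
    ENNReal.ofReal (Real.exp (-(t * x))), mul_assoc, ENNReal.ofReal_mul hθ.le,
    ← lintegral_rpow_mul_exp_neg hm' (show 0 < 1 + t by linarith),
    ← lintegral_const_mul' _ _ ENNReal.ofReal_ne_top]
  refine setLIntegral_congr_fun measurableSet_Ioi fun x hx => ?_
  have hx : 0 < x := hx
  rw [← ENNReal.ofReal_pow hx.le, ← ENNReal.ofReal_mul (by positivity),
    ← ENNReal.ofReal_mul (by positivity), ← ENNReal.ofReal_mul (by positivity)]
  congr 1
  rw [Real.rpow_sub_one hx.ne', Real.rpow_natCast,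
    show -((1 + t) * x) = -x + -(t * x) by ring, Real.exp_add]
  field_simp

/-- Counterpart of `partMoment_insert` for the Poisson process. The extra point `x` also multiplies
the tilt by `e^{-t x}`, so its rate becomes `θ x⁻¹ e^{-(1 + t) x}`, whose moment of order `m` is `θ
Γ(m) (1 + t) ^ (-m)`. -/
lemma tiltedMoment_insert [DecidableEq ι] (hθ : 0 < θ) (ht : 0 ≤ t) (he : ∀ i, 1 ≤ e i) {i : ι} {s : Finset ι}
    (hi : i ∉ s) :
    tiltedMoment θ t e (insert i s) = ∑ A ∈ s.powerset,
      ENNReal.ofReal (θ * Real.Gamma ((e i + ∑ a ∈ A, e a : ℕ) : ℝ) *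
        (1 + t) ^ (-((e i + ∑ a ∈ A, e a : ℕ) : ℝ))) * tiltedMoment θ t e (s \ A) := by
  have hexp : Measurable (expNeg t) := measurable_expNeg.comp (measurable_const.prodMk measurable_id)
  have hΨ : Measurable fun v : ℕ → ℝ≥0∞ => (∏ a ∈ s, v (e a)) * expNeg t (v 1) :=
    (Finset.measurable_prod _ fun a _ => measurable_pi_apply (e a)).mul
      (hexp.comp (measurable_pi_apply 1))
  have h1 := mecke (measurable_pointPow θ) (measurable_pointPow θ (e i)) hΨ
  have h2 : tiltedMoment θ t e (insert i s) = ∫⁻ ω, (∑' n, pointPow θ (e i) (renewal 0 ω (n + 1))) *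
      ((∏ a ∈ s, linStat (pointPow θ) 0 ω (e a)) * expNeg t (linStat (pointPow θ) 0 ω 1))
      ∂expSeq := by
    unfold tiltedMoment
    refine lintegral_congr fun ω => ?_
    rw [Finset.prod_insert hi, mul_assoc]
    rfl
  rw [h2, h1]
  have h3 : ∀ u ∈ Set.Ioi (0 : ℝ), pointPow θ (e i) u * ∫⁻ ω,
      (∏ a ∈ s, ((fun c => pointPow θ c u) + linStat (pointPow θ) 0 ω) (e a)) *
        expNeg t (((fun c => pointPow θ c u) + linStat (pointPow θ) 0 ω) 1) ∂expSeq =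
      ∑ A ∈ s.powerset, (ENNReal.ofReal (gammaTailInv θ u) ^ (e i + ∑ a ∈ A, e a) *
        ENNReal.ofReal (Real.exp (-(t * gammaTailInv θ u)))) * tiltedMoment θ t e (s \ A) := by
    intro u hu
    have hG := (gammaTailInv_pos hθ hu).le
    have h4 : ∀ ω, (∏ a ∈ s, ((fun c => pointPow θ c u) + linStat (pointPow θ) 0 ω) (e a)) *
        expNeg t (((fun c => pointPow θ c u) + linStat (pointPow θ) 0 ω) 1) =
        ∑ A ∈ s.powerset, (ENNReal.ofReal (gammaTailInv θ u) ^ (∑ a ∈ A, e a) *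
          ENNReal.ofReal (Real.exp (-(t * gammaTailInv θ u)))) *
          ((∏ a ∈ s \ A, pointSum θ ω (e a)) * expNeg t (pointSum θ ω 1)) := by
      intro ω
      simp only [Pi.add_apply]
      rw [Finset.prod_add, show pointPow θ 1 u = ENNReal.ofReal (gammaTailInv θ u) by
        simp [pointPow], expNeg_ofReal_add t hG, Finset.sum_mul]
      refine Finset.sum_congr rfl fun A _ => ?_
      simp only [pointPow, Finset.prod_pow_eq_pow_sum, pointSum]
      ring
    simp_rw [h4]
    rw [lintegral_finsetSum _ fun A _ => ?_, Finset.mul_sum]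
    · refine Finset.sum_congr rfl fun A _ => ?_
      rw [lintegral_const_mul' _ _ (ENNReal.mul_ne_top (ENNReal.pow_ne_top ENNReal.ofReal_ne_top)
        ENNReal.ofReal_ne_top), pow_add, tiltedMoment, pointPow]
      ring
    · refine Measurable.const_mul (Measurable.mul ?_ ?_) _
      · exact Finset.measurable_prod _ fun a _ =>
          (measurable_pi_apply (e a)).comp (measurable_pointSum θ)
      · exact hexp.comp ((measurable_pi_apply 1).comp (measurable_pointSum θ))
  have hmG := measurable_gammaTailInv θ
  rw [setLIntegral_congr_fun measurableSet_Ioi h3, lintegral_finsetSum _ fun A _ => by fun_prop]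
  refine Finset.sum_congr rfl fun A _ => ?_
  rw [lintegral_mul_const _ (by fun_prop), lintegral_pow_mul_exp_gammaTailInv hθ ht]
  have := he i
  omega

lemma lintegral_pointSum_one (hθ : 0 < θ) : ∫⁻ ω, pointSum θ ω 1 ∂expSeq = ENNReal.ofReal θ := by
  have h := mecke (measurable_pointPow θ) (measurable_pointPow θ 1) (Ψ := fun _ => 1)
    measurable_const
  simp only [mul_one, lintegral_const, measure_univ] at h
  have h2 := lintegral_pow_mul_exp_gammaTailInv hθ le_rfl (m := 1) le_rfl
  simp only [zero_mul, neg_zero, Real.exp_zero, ENNReal.ofReal_one, mul_one, Nat.cast_one,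
    Real.Gamma_one, add_zero, Real.one_rpow] at h2
  rw [← h2]
  exact h

lemma ae_pointSum_one_lt_top (hθ : 0 < θ) : ∀ᵐ ω ∂expSeq, pointSum θ ω 1 < ∞ :=
  ae_lt_top ((measurable_pi_apply 1).comp (measurable_pointSum θ)) (by
    rw [lintegral_pointSum_one hθ]
    exact ENNReal.ofReal_ne_top)

lemma tiltedMoment_zero_empty (hθ : 0 < θ) : tiltedMoment θ 0 e ∅ = 1 := by
  have : ∀ᵐ ω ∂expSeq, (∏ i ∈ (∅ : Finset ι), pointSum θ ω (e i)) * expNeg 0 (pointSum θ ω 1) =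
      1 := by
    filter_upwards [ae_pointSum_one_lt_top hθ] with ω hω
    simp [expNeg, hω.ne]
  rw [tiltedMoment, lintegral_congr_ae this]
  simp

lemma tiltedMoment_zero_ne_top [DecidableEq ι] (hθ : 0 < θ) (he : ∀ i, 1 ≤ e i) (s : Finset ι) :
    tiltedMoment θ 0 e s ≠ ∞ := by
  induction s using Finset.strongInduction with
  | H s ih =>
    rcases s.eq_empty_or_nonempty with rfl | ⟨i, hi⟩
    · simp [tiltedMoment_zero_empty hθ]
    · rw [← Finset.insert_erase hi, tiltedMoment_insert hθ le_rfl he (Finset.notMem_erase i s)]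
      refine ENNReal.sum_ne_top.2 fun A _ => ENNReal.mul_ne_top ENNReal.ofReal_ne_top (ih _ ?_)
      exact lt_of_le_of_lt Finset.sdiff_subset (Finset.erase_ssubset hi)

/-- The joint moments of the power sums of the Poisson process. -/
def pointMoment (θ : ℝ) (e : ι → ℕ) (s : Finset ι) : ℝ := (tiltedMoment θ 0 e s).toReal

lemma isGammaMoment_pointMoment [DecidableEq ι] (hθ : 0 < θ) (he : ∀ i, 1 ≤ e i) :
    IsGammaMoment θ e (pointMoment θ e) := by
  refine ⟨by simp [pointMoment, tiltedMoment_zero_empty hθ], fun i s hi => ?_⟩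
  rw [pointMoment, tiltedMoment_insert hθ le_rfl he hi, ENNReal.toReal_sum fun A _ =>
    ENNReal.mul_ne_top ENNReal.ofReal_ne_top (tiltedMoment_zero_ne_top hθ he _)]
  refine Finset.sum_congr rfl fun A _ => ?_
  have hG : 0 < Real.Gamma ((e i + ∑ a ∈ A, e a : ℕ) : ℝ) := Real.Gamma_pos_of_pos (by
    have := he i
    exact_mod_cast (by omega : 0 < e i + ∑ a ∈ A, e a))
  rw [ENNReal.toReal_mul, ENNReal.toReal_ofReal (by simp; positivity)]
  simp [pointMoment]

end

/-! ### The Laplace transform of the total mass -/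

/-- The total mass of the Poisson process. -/
def totalMass (θ : ℝ) (ω : ℕ → ℝ) : ℝ := (pointSum θ ω 1).toReal

lemma totalMass_nonneg (θ : ℝ) (ω : ℕ → ℝ) : 0 ≤ totalMass θ ω := ENNReal.toReal_nonneg

lemma measurable_totalMass (θ : ℝ) : Measurable (totalMass θ) :=
  ((measurable_pi_apply 1).comp (measurable_pointSum θ)).ennreal_toReal

variable {θ : ℝ}

lemma integrable_totalMass (hθ : 0 < θ) : Integrable (totalMass θ) expSeq :=
  integrable_toReal_of_lintegral_ne_top
    ((measurable_pi_apply 1).comp (measurable_pointSum θ)).aemeasurable (by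
      have := lintegral_pointSum_one hθ
      exact this.trans_ne ENNReal.ofReal_ne_top)

lemma exp_neg_totalMass_le {t : ℝ} (ht : 0 ≤ t) (ω : ℕ → ℝ) :
    Real.exp (t * -totalMass θ ω) ≤ 1 :=
  Real.exp_le_one_iff.2 (by nlinarith [totalMass_nonneg θ ω])

lemma integrable_exp_totalMass {t : ℝ} (ht : 0 ≤ t) :
    Integrable (fun ω => Real.exp (t * -totalMass θ ω)) expSeq := by
  refine Integrable.of_bound (C := 1) ?_ (Eventually.of_forall fun ω => ?_)
  · exact (Real.measurable_exp.comp ((measurable_totalMass θ).neg.const_mul t)).aestronglyMeasurable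
  · rw [Real.norm_of_nonneg (Real.exp_pos _).le]
    exact exp_neg_totalMass_le ht ω

lemma ae_expNeg_pointSum (hθ : 0 < θ) (t : ℝ) : ∀ᵐ ω ∂expSeq,
    expNeg t (pointSum θ ω 1) = ENNReal.ofReal (Real.exp (t * -totalMass θ ω)) := by
  filter_upwards [ae_pointSum_one_lt_top hθ] with ω hω
  simp [expNeg, hω.ne, totalMass]

lemma tiltedMoment_empty_eq_mgf {ι : Type*} {e : ι → ℕ} (hθ : 0 < θ) {t : ℝ} (ht : 0 ≤ t) :
    tiltedMoment θ t e ∅ = ENNReal.ofReal (mgf (fun ω => -totalMass θ ω) expSeq t) := by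
  rw [mgf, ofReal_integral_eq_lintegral_ofReal (integrable_exp_totalMass ht)
    (Eventually.of_forall fun ω => (Real.exp_pos _).le)]
  refine lintegral_congr_ae ?_
  filter_upwards [ae_expNeg_pointSum hθ t] with ω hω
  simpa using hω

/-- The recursion for a single factor of exponent `1`. It is a differential equation for the Laplace
transform of the total mass. -/
lemma integral_totalMass_mul_exp (hθ : 0 < θ) {t : ℝ} (ht : 0 ≤ t) :
    ∫ ω, totalMass θ ω * Real.exp (t * -totalMass θ ω) ∂expSeq =
      θ * (1 + t)⁻¹ * mgf (fun ω => -totalMass θ ω) expSeq t := by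
  have hm0 : 0 ≤ mgf (fun ω => -totalMass θ ω) expSeq t := mgf_nonneg
  have h1 := tiltedMoment_insert (e := fun _ : Unit => 1) hθ ht (fun _ => le_rfl)
    (i := ()) (s := ∅) (Finset.notMem_empty _)
  rw [Finset.powerset_empty, Finset.sum_singleton, Finset.sdiff_empty,
    tiltedMoment_empty_eq_mgf hθ ht] at h1
  simp only [Finset.sum_empty, add_zero, Nat.cast_one, Real.Gamma_one, mul_one,
    Real.rpow_neg_one] at h1
  rw [← ENNReal.ofReal_mul (by positivity)] at h1
  have hint : Integrable (fun ω => totalMass θ ω * Real.exp (t * -totalMass θ ω)) expSeq := by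
    refine (integrable_totalMass hθ).mono' ?_ (Eventually.of_forall fun ω => ?_)
    · exact ((measurable_totalMass θ).mul (Real.measurable_exp.comp
        ((measurable_totalMass θ).neg.const_mul t))).aestronglyMeasurable
    · rw [Real.norm_of_nonneg (mul_nonneg (totalMass_nonneg θ ω) (Real.exp_pos _).le)]
      exact mul_le_of_le_one_right (totalMass_nonneg θ ω) (exp_neg_totalMass_le ht ω)
  have h2 : tiltedMoment θ t (fun _ : Unit => 1) (insert () ∅) =
      ENNReal.ofReal (∫ ω, totalMass θ ω * Real.exp (t * -totalMass θ ω) ∂expSeq) := by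
    rw [ofReal_integral_eq_lintegral_ofReal hint (Eventually.of_forall fun ω =>
      mul_nonneg (totalMass_nonneg θ ω) (Real.exp_pos _).le)]
    refine lintegral_congr_ae ?_
    filter_upwards [ae_expNeg_pointSum hθ t, ae_pointSum_one_lt_top hθ] with ω hω hω'
    rw [hω, ENNReal.ofReal_mul (totalMass_nonneg θ ω), totalMass, ENNReal.ofReal_toReal hω'.ne]
    simp
  rw [h2, ENNReal.ofReal_eq_ofReal_iff] at h1
  · exact h1
  · exact integral_nonneg fun ω => mul_nonneg (totalMass_nonneg θ ω) (Real.exp_pos _).le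
  · positivity

lemma hasDerivAt_mgf_totalMass (hθ : 0 < θ) {t : ℝ} (ht : 0 < t) :
    HasDerivAt (mgf (fun ω => -totalMass θ ω) expSeq)
      (-(θ * (1 + t)⁻¹ * mgf (fun ω => -totalMass θ ω) expSeq t)) t := by
  have h1 : t ∈ interior (integrableExpSet (fun ω => -totalMass θ ω) expSeq) := by
    refine mem_interior.2 ⟨Set.Ioi 0, fun u hu => ?_, isOpen_Ioi, ht⟩
    exact integrable_exp_totalMass (le_of_lt hu)
  have h2 := hasDerivAt_mgf h1
  rw [← integral_totalMass_mul_exp hθ ht.le, ← integral_neg]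
  simpa using h2

/-- The equation `(1 + t) L' = -θ L` makes `(1 + t) ^ θ L` constant, and `L 0 = 1`: the total mass
has the Gamma law. The derivative is available only for `t > 0`, so continuity at `0` is proved
separately and the mean value theorem is applied on `[0, t]`. -/
lemma mgf_totalMass (hθ : 0 < θ) {t : ℝ} (ht : 0 ≤ t) :
    mgf (fun ω => -totalMass θ ω) expSeq t = (1 + t) ^ (-θ) := by
  set L := mgf (fun ω => -totalMass θ ω) expSeq with hL
  have hcont : ContinuousOn L (Set.Ici 0) := by
    refine continuousOn_of_dominated (bound := fun _ => 1) (fun t ht => ?_) (fun t ht => ?_)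
      (integrable_const _) (Eventually.of_forall fun ω => ?_)
    · exact (integrable_exp_totalMass ht).aestronglyMeasurable
    · refine Eventually.of_forall fun ω => ?_
      rw [Real.norm_of_nonneg (Real.exp_pos _).le]
      exact exp_neg_totalMass_le ht ω
    · fun_prop
  have h0 : L 0 = 1 := by simp [hL]
  have hpos : ∀ u : ℝ, 0 ≤ u → 0 < 1 + u := fun u hu => by linarith
  rcases ht.eq_or_lt with rfl | ht'
  · simp [h0]
  obtain ⟨c, hc, hslope⟩ := exists_hasDerivAt_eq_slope (fun u => (1 + u) ^ θ * L u) (fun _ => 0) ht'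
    (ContinuousOn.mul (ContinuousOn.rpow_const (by fun_prop) fun u hu => Or.inl (hpos u hu.1).ne')
      (hcont.mono fun u hu => hu.1)) (fun u hu => by
      have h1 : HasDerivAt (fun u : ℝ => 1 + u) 1 u := (hasDerivAt_id u).const_add 1
      have h2 := (h1.rpow_const (p := θ) (Or.inl (hpos u hu.1.le).ne')).mul
        (hasDerivAt_mgf_totalMass hθ hu.1)
      refine h2.congr_deriv ?_
      rw [Real.rpow_sub_one (hpos u hu.1.le).ne']
      ring)
  rw [eq_comm, div_eq_zero_iff] at hslope
  have h3 : (1 + t) ^ θ * L t = 1 := by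
    rcases hslope with h | h
    · simp only [add_zero, Real.one_rpow, h0] at h
      linarith
    · linarith
  rw [Real.rpow_neg (hpos t ht).le]
  exact eq_inv_of_mul_eq_one_right h3

/-- In each term of the recursion the exponents of `1 + t` add up to the same total, so the
dependence on `t` factors out. -/
lemma tiltedMoment_eq {ι : Type*} [DecidableEq ι] {e : ι → ℕ} (hθ : 0 < θ) (he : ∀ i, 1 ≤ e i)
    {t : ℝ} (ht : 0 ≤ t) (s : Finset ι) :
    tiltedMoment θ t e s =
      ENNReal.ofReal (pointMoment θ e s * (1 + t) ^ (-(((∑ a ∈ s, e a : ℕ) : ℝ) + θ))) := by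
  have ht1 : 0 < 1 + t := by linarith
  have hζ := isGammaMoment_pointMoment hθ he
  induction s using finset_insert_induction with
  | h0 =>
    rw [tiltedMoment_empty_eq_mgf hθ ht, mgf_totalMass hθ ht, hζ.1]
    simp
  | h i s hi ih =>
    have hm : ∀ A : Finset ι, 0 < Real.Gamma ((e i + ∑ a ∈ A, e a : ℕ) : ℝ) := fun A =>
      Real.Gamma_pos_of_pos (by
        have := he i
        exact_mod_cast (by omega : 0 < e i + ∑ a ∈ A, e a))
    rw [tiltedMoment_insert hθ ht he hi, hζ.2 i s hi, Finset.sum_mul,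
      ENNReal.ofReal_sum_of_nonneg]
    · refine Finset.sum_congr rfl fun A hA => ?_
      have := hm A
      rw [ih A hA, ← ENNReal.ofReal_mul (by positivity), ← sum_insert_eq e hi hA]
      congr 1
      rw [Nat.cast_add (e i + ∑ a ∈ A, e a), show -((((e i + ∑ a ∈ A, e a : ℕ) : ℝ) +
        ((∑ a ∈ s \ A, e a : ℕ) : ℝ)) + θ) = -((e i + ∑ a ∈ A, e a : ℕ) : ℝ) +
        -(((∑ a ∈ s \ A, e a : ℕ) : ℝ) + θ) by ring, Real.rpow_add ht1]
      ring
    · intro A _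
      have := hm A
      have h0 : 0 ≤ pointMoment θ e (s \ A) := ENNReal.toReal_nonneg
      positivity

/-! ### Moments of the Poisson–Dirichlet distribution -/

lemma ae_poissonPoint_pos (hθ : 0 < θ) : ∀ᵐ ω ∂expSeq, ∀ n, 0 < poissonPoint θ ω n := by
  filter_upwards [ae_expSeq_pos] with ω hω n
  exact gammaTailInv_pos hθ (Finset.sum_pos (fun i _ => hω i) ⟨0, by simp⟩)

lemma ae_antitone_poissonPoint (hθ : 0 < θ) : ∀ᵐ ω ∂expSeq, Antitone (poissonPoint θ ω) := by
  filter_upwards [ae_expSeq_pos] with ω hω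
  refine antitone_nat_of_succ_le fun n => ?_
  refine (strictAntiOn_gammaTailInv hθ).antitoneOn
    (Finset.sum_pos (fun i _ => hω i) ⟨0, by simp⟩)
    (Finset.sum_pos (fun i _ => hω i) ⟨0, by simp⟩) ?_
  rw [Finset.sum_range_succ _ (n + 1)]
  linarith [hω (n + 1)]

lemma ae_hasSum_poissonPoint_pow (hθ : 0 < θ) : ∀ᵐ ω ∂expSeq, ∀ k, 1 ≤ k →
    pointSum θ ω k ≠ ∞ ∧ HasSum (fun n => poissonPoint θ ω n ^ k) (pointSum θ ω k).toReal := by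
  filter_upwards [ae_poissonPoint_pos hθ, ae_antitone_poissonPoint hθ,
    ae_pointSum_one_lt_top hθ] with ω hpos hanti h1 k hk
  have hfin : pointSum θ ω k ≠ ∞ := by
    have h2 : pointSum θ ω k ≤ ENNReal.ofReal (poissonPoint θ ω 0) ^ (k - 1) * pointSum θ ω 1 := by
      rw [pointSum_eq, pointSum_eq, ← ENNReal.tsum_mul_left]
      refine ENNReal.tsum_le_tsum fun n => ?_
      obtain ⟨j, rfl⟩ : ∃ j, k = j + 1 := ⟨k - 1, by omega⟩
      rw [pow_succ, pow_one, Nat.add_sub_cancel]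
      gcongr
      exact hanti (Nat.zero_le n)
    exact (h2.trans_lt (ENNReal.mul_lt_top (by simp) h1)).ne
  refine ⟨hfin, ?_⟩
  rw [pointSum_eq] at hfin ⊢
  rw [ENNReal.tsum_toReal_eq fun n => ENNReal.pow_ne_top ENNReal.ofReal_ne_top]
  have := ENNReal.hasSum_toReal hfin
  refine this.congr_fun ?_ |> id
  intro n
  simp [ENNReal.toReal_pow, ENNReal.toReal_ofReal (hpos n).le]

lemma ae_totalMass (hθ : 0 < θ) : ∀ᵐ ω ∂expSeq, 0 < totalMass θ ω ∧
    HasSum (poissonPoint θ ω) (totalMass θ ω) := by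
  filter_upwards [ae_hasSum_poissonPoint_pow hθ, ae_poissonPoint_pos hθ] with ω h hpos
  have h1 := (h 1 le_rfl).2
  simp only [pow_one] at h1
  refine ⟨?_, h1⟩
  exact (hpos 0).trans_le (le_hasSum h1 0 fun n _ => (hpos n).le)

lemma poissonDirichlet_eq_map (θ : ℝ) : poissonDirichlet θ =
    expSeq.map (fun e k => poissonPoint θ e k / ∑' i, poissonPoint θ e i) := rfl

lemma ae_tsum_normalized_pow (hθ : 0 < θ) : ∀ᵐ ω ∂expSeq, ∀ k, 1 ≤ k →
    ∑' n, (poissonPoint θ ω n / ∑' i, poissonPoint θ ω i) ^ k =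
      (pointSum θ ω k).toReal / totalMass θ ω ^ k := by
  filter_upwards [ae_hasSum_poissonPoint_pow hθ, ae_totalMass hθ] with ω h h1 k hk
  rw [h1.2.tsum_eq]
  simp_rw [div_pow]
  exact ((h k hk).2.div_const _).tsum_eq

lemma ae_poissonDirichlet (hθ : 0 < θ) : ∀ᵐ x ∂poissonDirichlet θ,
    Antitone x ∧ (∀ n, 0 ≤ x n) ∧ ∀ n, ∑ i ∈ Finset.range n, x i ≤ 1 := by
  have hm : MeasurableSet {x : ℕ → ℝ | Antitone x ∧ (∀ n, 0 ≤ x n) ∧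
      ∀ n, ∑ i ∈ Finset.range n, x i ≤ 1} := by
    have h1 : MeasurableSet {x : ℕ → ℝ | Antitone x} := by
      have : {x : ℕ → ℝ | Antitone x} = ⋂ n, {x : ℕ → ℝ | x (n + 1) ≤ x n} := by
        ext x
        simp only [Set.mem_ofPred_eq, Set.mem_iInter]
        exact ⟨fun h n => h (Nat.le_succ n), antitone_nat_of_succ_le⟩
      rw [this]
      exact MeasurableSet.iInter fun n => measurableSet_le (by fun_prop) (by fun_prop)
    have h2 : MeasurableSet {x : ℕ → ℝ | ∀ n, 0 ≤ x n} := by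
      simp only [Set.ofPred_forall]
      exact MeasurableSet.iInter fun n => measurableSet_le (by fun_prop) (by fun_prop)
    have h3 : MeasurableSet {x : ℕ → ℝ | ∀ n, ∑ i ∈ Finset.range n, x i ≤ 1} := by
      simp only [Set.ofPred_forall]
      exact MeasurableSet.iInter fun n => measurableSet_le (by fun_prop) (by fun_prop)
    exact h1.inter (h2.inter h3)
  rw [poissonDirichlet_eq_map, ae_map_iff (measurable_normalizedPoints θ).aemeasurable hm]
  filter_upwards [ae_totalMass hθ, ae_antitone_poissonPoint hθ, ae_poissonPoint_pos hθ]
    with ω h1 h2 h3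
  rw [h1.2.tsum_eq]
  refine ⟨fun m n hmn => ?_, fun n => (div_pos (h3 n) h1.1).le, fun n => ?_⟩
  · exact div_le_div_of_nonneg_right (h2 hmn) h1.1.le
  · rw [← Finset.sum_div, div_le_one h1.1]
    exact sum_le_hasSum _ (fun i _ => (h3 i).le) h1.2

/-- Division by the total mass `σ` is linearized by `Γ(M) σ ^ (-M) = ∫ t ^ (M - 1) e^{-t σ} dt`.
This turns the expectation into an integral of tilted moments over `t`, which is a beta integral.
Nonemptiness of `s` gives `M > 0`. -/
lemma lintegral_prod_pointSum_div (hθ : 0 < θ) {ι : Type*} [DecidableEq ι] {e : ι → ℕ}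
    (he : ∀ i, 1 ≤ e i) {s : Finset ι} (hs : s.Nonempty) :
    ∫⁻ ω, (∏ i ∈ s, pointSum θ ω (e i)) *
      ENNReal.ofReal (totalMass θ ω ^ (-((∑ a ∈ s, e a : ℕ) : ℝ))) ∂expSeq =
      ENNReal.ofReal (pointMoment θ e s * Real.Gamma θ /
        Real.Gamma (((∑ a ∈ s, e a : ℕ) : ℝ) + θ)) := by
  obtain ⟨i, hi⟩ := hs
  have hM : (0 : ℝ) < ((∑ a ∈ s, e a : ℕ) : ℝ) := by
    have h1 := Finset.single_le_sum (f := e) (fun a _ => Nat.zero_le _) hi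
    have h2 := he i
    exact_mod_cast (by omega : 0 < ∑ a ∈ s, e a)
  set M : ℝ := ((∑ a ∈ s, e a : ℕ) : ℝ) with hMd
  have hG := Real.Gamma_pos_of_pos hM
  have hζ : 0 ≤ pointMoment θ e s := ENNReal.toReal_nonneg
  have hprod : Measurable fun ω => ∏ i ∈ s, pointSum θ ω (e i) :=
    Finset.measurable_prod _ fun a _ => (measurable_pi_apply (e a)).comp (measurable_pointSum θ)
  have h1 : ENNReal.ofReal (Real.Gamma M) * ∫⁻ ω, (∏ i ∈ s, pointSum θ ω (e i)) *
      ENNReal.ofReal (totalMass θ ω ^ (-M)) ∂expSeq =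
      ENNReal.ofReal (pointMoment θ e s * (Real.Gamma M * Real.Gamma θ / Real.Gamma (M + θ))) := by
    rw [← lintegral_const_mul' _ _ ENNReal.ofReal_ne_top]
    have h2 : ∀ᵐ ω ∂expSeq, ENNReal.ofReal (Real.Gamma M) * ((∏ i ∈ s, pointSum θ ω (e i)) *
        ENNReal.ofReal (totalMass θ ω ^ (-M))) = ∫⁻ t in Set.Ioi 0,
          ENNReal.ofReal (t ^ (M - 1)) * ((∏ i ∈ s, pointSum θ ω (e i)) *
            expNeg t (pointSum θ ω 1)) := by
      filter_upwards [ae_hasSum_poissonPoint_pow hθ, ae_totalMass hθ] with ω h3 h4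
      rw [mul_left_comm, ← ENNReal.ofReal_mul hG.le, ← lintegral_rpow_mul_exp_neg hM h4.1,
        ← lintegral_const_mul']
      · refine setLIntegral_congr_fun measurableSet_Ioi fun t ht => ?_
        have ht : 0 < t := ht
        have h5 : expNeg t (pointSum θ ω 1) =
            ENNReal.ofReal (Real.exp (-(totalMass θ ω * t))) := by
          rw [expNeg, if_neg (h3 1 le_rfl).1, totalMass, mul_comm]
        rw [h5, ENNReal.ofReal_mul (by positivity)]
        ring
      · exact (ENNReal.prod_lt_top fun a _ => ((h3 (e a) (he a)).1).lt_top).ne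
    rw [lintegral_congr_ae h2, lintegral_lintegral_swap]
    · have h6 : ∀ t ∈ Set.Ioi (0 : ℝ), ∫⁻ ω, ENNReal.ofReal (t ^ (M - 1)) *
          ((∏ i ∈ s, pointSum θ ω (e i)) * expNeg t (pointSum θ ω 1)) ∂expSeq =
          ENNReal.ofReal (pointMoment θ e s) *
            ENNReal.ofReal (t ^ (M - 1) * (1 + t) ^ (-(M + θ))) := by
        intro t ht
        have ht : 0 < t := ht
        rw [lintegral_const_mul' _ _ ENNReal.ofReal_ne_top]
        have h7 := tiltedMoment_eq hθ he ht.le s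
        rw [tiltedMoment] at h7
        rw [h7, ← ENNReal.ofReal_mul (by positivity), ← ENNReal.ofReal_mul hζ]
        congr 1
        ring
      rw [setLIntegral_congr_fun measurableSet_Ioi h6,
        lintegral_const_mul' _ _ ENNReal.ofReal_ne_top, lintegral_beta hM hθ,
        ← ENNReal.ofReal_mul hζ]
    · refine Measurable.aemeasurable ?_
      have h8 : Measurable fun p : (ℕ → ℝ) × ℝ => expNeg p.2 (pointSum θ p.1 1) :=
        measurable_expNeg.comp (measurable_snd.prodMk
          (((measurable_pi_apply 1).comp (measurable_pointSum θ)).comp measurable_fst))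
      exact Measurable.mul (by fun_prop) ((hprod.comp measurable_fst).mul h8)
  have h9 : pointMoment θ e s * Real.Gamma θ / Real.Gamma (M + θ) =
      (Real.Gamma M)⁻¹ * (pointMoment θ e s *
        (Real.Gamma M * Real.Gamma θ / Real.Gamma (M + θ))) := by
    field_simp
  rw [h9, ENNReal.ofReal_mul (by positivity), ← h1, ← mul_assoc,
    ← ENNReal.ofReal_mul (by positivity), inv_mul_cancel₀ hG.ne', ENNReal.ofReal_one, one_mul]

/-- The value is the limit in `tendsto_permExpect_powSum` with `ζ = pointMoment θ e`. -/
lemma integral_prod_poissonDirichlet (hθ : 0 < θ) {ι : Type*} [DecidableEq ι] {e : ι → ℕ}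
    (he : ∀ i, 1 ≤ e i) (s : Finset ι) :
    ∫ x, ∏ i ∈ s, ∑' n, x n ^ e i ∂poissonDirichlet θ =
      pointMoment θ e s * Real.Gamma θ / Real.Gamma (((∑ a ∈ s, e a : ℕ) : ℝ) + θ) := by
  rcases s.eq_empty_or_nonempty with rfl | hs
  · have := (Real.Gamma_pos_of_pos hθ).ne'
    simp [(isGammaMoment_pointMoment hθ he).1, this]
  have hζ : 0 ≤ pointMoment θ e s := ENNReal.toReal_nonneg
  have hmeas : Measurable fun x : ℕ → ℝ => ∏ i ∈ s, ∑' n, x n ^ e i :=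
    Finset.measurable_prod _ fun i _ => Measurable.tsum fun n => by fun_prop
  rw [poissonDirichlet_eq_map, integral_map (measurable_normalizedPoints θ).aemeasurable
    hmeas.aestronglyMeasurable, integral_eq_lintegral_of_nonneg_ae]
  · have h1 : ∀ᵐ ω ∂expSeq, ENNReal.ofReal (∏ i ∈ s, ∑' n, (poissonPoint θ ω n /
        ∑' i, poissonPoint θ ω i) ^ e i) = (∏ i ∈ s, pointSum θ ω (e i)) *
        ENNReal.ofReal (totalMass θ ω ^ (-((∑ a ∈ s, e a : ℕ) : ℝ))) := by
      filter_upwards [ae_tsum_normalized_pow hθ, ae_hasSum_poissonPoint_pow hθ, ae_totalMass hθ]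
        with ω h2 h3 h4
      have h5 : ∏ i ∈ s, ∑' n, (poissonPoint θ ω n / ∑' i, poissonPoint θ ω i) ^ e i =
          (∏ i ∈ s, (pointSum θ ω (e i)).toReal) *
            totalMass θ ω ^ (-((∑ a ∈ s, e a : ℕ) : ℝ)) := by
        rw [Finset.prod_congr rfl fun i _ => h2 (e i) (he i), Finset.prod_div_distrib,
          Finset.prod_pow_eq_pow_sum, Real.rpow_neg h4.1.le, Real.rpow_natCast, div_eq_mul_inv]
      rw [h5, ENNReal.ofReal_mul (Finset.prod_nonneg fun i _ => ENNReal.toReal_nonneg),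
        ENNReal.ofReal_prod_of_nonneg fun i _ => ENNReal.toReal_nonneg]
      congr 1
      exact Finset.prod_congr rfl fun i _ => ENNReal.ofReal_toReal (h3 (e i) (he i)).1
    rw [lintegral_congr_ae h1, lintegral_prod_pointSum_div hθ he hs, ENNReal.toReal_ofReal]
    have h6 := Real.Gamma_pos_of_pos hθ
    have h7 : 0 < Real.Gamma (((∑ a ∈ s, e a : ℕ) : ℝ) + θ) := Real.Gamma_pos_of_pos (by positivity)
    positivity
  · filter_upwards [ae_tsum_normalized_pow hθ] with ω h2
    refine Finset.prod_nonneg fun i _ => ?_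
    rw [h2 (e i) (he i)]
    exact div_nonneg ENNReal.toReal_nonneg (pow_nonneg (totalMass_nonneg θ ω) _)
  · exact (hmeas.comp (measurable_normalizedPoints θ)).aestronglyMeasurable

/-! ### Polynomials in the power sums on decreasing summable sequences -/

/-- Decreasing non-negative sequences with sum at most `C`. -/
def decSeq (C : ℝ) : Set (ℕ → ℝ) :=
  {x | Antitone x ∧ (∀ n, 0 ≤ x n) ∧ ∀ n, ∑ i ∈ Finset.range n, x i ≤ C}

lemma decSeq_mono {C D : ℝ} (h : C ≤ D) : decSeq C ⊆ decSeq D :=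
  fun _ hx => ⟨hx.1, hx.2.1, fun n => (hx.2.2 n).trans h⟩

/-- The decay `C / (n + 1)` makes the power sums of order at least `2` converge uniformly on `decSeq
C`, hence continuous for the product topology. The sum of order `1` is not continuous there, since
mass can escape into many small terms. -/
lemma le_div_of_mem_decSeq {C : ℝ} {x : ℕ → ℝ} (hx : x ∈ decSeq C) (n : ℕ) :
    x n ≤ C / ((n + 1 : ℕ) : ℝ) := by
  rw [le_div_iff₀ (by positivity)]
  refine le_trans ?_ (hx.2.2 (n + 1))
  have := Finset.card_nsmul_le_sum (Finset.range (n + 1)) x (x n) fun i hi =>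
    hx.1 (Nat.lt_succ_iff.1 (Finset.mem_range.1 hi))
  simpa [mul_comm] using this

lemma isCompact_decSeq (C : ℝ) : IsCompact (decSeq C) := by
  refine (isCompact_univ_pi fun _ : ℕ => isCompact_Icc (a := (0 : ℝ)) (b := C)).of_isClosed_subset
    ?_ fun x hx => ?_
  · have h1 : IsClosed {x : ℕ → ℝ | Antitone x} := by
      simp only [Antitone, Set.ofPred_forall]
      exact isClosed_iInter fun a => isClosed_iInter fun b => isClosed_iInter fun _ =>
        isClosed_le (by fun_prop) (by fun_prop)
    have h2 : IsClosed {x : ℕ → ℝ | ∀ n, 0 ≤ x n} := by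
      simp only [Set.ofPred_forall]
      exact isClosed_iInter fun a => isClosed_le (by fun_prop) (by fun_prop)
    have h3 : IsClosed {x : ℕ → ℝ | ∀ n, ∑ i ∈ Finset.range n, x i ≤ C} := by
      simp only [Set.ofPred_forall]
      exact isClosed_iInter fun a => isClosed_le (by fun_prop) (by fun_prop)
    exact h1.inter (h2.inter h3)
  · refine Set.mem_univ_pi.2 fun n => ⟨hx.2.1 n, (hx.1 (Nat.zero_le n)).trans ?_⟩
    simpa using hx.2.2 1

lemma pow_le_of_mem_decSeq {C : ℝ} (hC : 0 ≤ C) {x : ℕ → ℝ} (hx : x ∈ decSeq C) {k : ℕ}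
    (hk : 2 ≤ k) (n : ℕ) : ‖x n ^ k‖ ≤ C ^ k * (((n + 1 : ℕ) : ℝ) ^ 2)⁻¹ := by
  rw [norm_pow, Real.norm_of_nonneg (hx.2.1 n)]
  refine (pow_le_pow_left₀ (hx.2.1 n) (le_div_of_mem_decSeq hx n) k).trans ?_
  rw [div_pow, div_eq_mul_inv]
  refine mul_le_mul_of_nonneg_left (inv_anti₀ (by positivity) ?_) (by positivity)
  exact pow_le_pow_right₀ (by simp) hk

lemma summable_pow_bound (C : ℝ) (k : ℕ) :
    Summable fun n : ℕ => C ^ k * (((n + 1 : ℕ) : ℝ) ^ 2)⁻¹ :=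
  ((summable_nat_add_iff 1).2 (Real.summable_nat_pow_inv.2 one_lt_two)).mul_left _

lemma summable_pow_of_mem_decSeq {C : ℝ} (hC : 0 ≤ C) {x : ℕ → ℝ} (hx : x ∈ decSeq C) {k : ℕ}
    (hk : 2 ≤ k) : Summable fun n => x n ^ k :=
  (summable_pow_bound C k).of_norm_bounded (pow_le_of_mem_decSeq hC hx hk)

/-- The power sum of order `k` as a continuous function on `decSeq C`. -/
def contPowSum {C : ℝ} (hC : 0 ≤ C) {k : ℕ} (hk : 2 ≤ k) : C(decSeq C, ℝ) where
  toFun x := ∑' n, (x : ℕ → ℝ) n ^ k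
  continuous_toFun := continuous_tsum
    (fun n => ((continuous_apply n).comp continuous_subtype_val).pow k) (summable_pow_bound C k)
    fun n x => pow_le_of_mem_decSeq hC x.2 hk n

/-- Large powers isolate the largest term. Once the common initial terms are cancelled, `y n ^ k ≤
∑_{i ≥ n} x i ^ k ≤ x n ^ (k - 1) * C`, which fails for large `k` if `y n > x n`. Hence the sums of
orders beyond any `k₀` determine the sequence. -/
lemma le_of_forall_tsum_pow_eq {C : ℝ} (hC : 0 ≤ C) {x y : ℕ → ℝ} (hx : x ∈ decSeq C)
    (hy : y ∈ decSeq C) {k₀ : ℕ} (hk₀ : 2 ≤ k₀)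
    (h : ∀ k, k₀ ≤ k → ∑' n, x n ^ k = ∑' n, y n ^ k) (n : ℕ) (hn : ∀ i < n, x i = y i) :
    y n ≤ x n := by
  by_contra hlt
  push Not at hlt
  have hy0 : 0 < y n := (hx.2.1 n).trans_lt hlt
  have key : ∀ k, k₀ ≤ k → y n ^ k ≤ x n ^ (k - 1) * C := by
    intro k hk
    have h2 : 2 ≤ k := hk₀.trans hk
    have hsx := summable_pow_of_mem_decSeq hC hx h2
    have hsy := summable_pow_of_mem_decSeq hC hy h2
    have h1 := h k hk
    rw [← hsx.sum_add_tsum_nat_add n, ← hsy.sum_add_tsum_nat_add n,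
      Finset.sum_congr rfl fun i hi => by rw [hn i (Finset.mem_range.1 hi)]] at h1
    have h3 := add_left_cancel h1
    have h4 : y n ^ k ≤ ∑' i, y (i + n) ^ k := by
      have := ((summable_nat_add_iff n).2 hsy).le_tsum 0 fun i _ => by
        have := hy.2.1 (i + n)
        positivity
      simpa using this
    have h5 : ∑' i, x (i + n) ^ k ≤ x n ^ (k - 1) * C := by
      refine Real.tsum_le_of_sum_range_le (fun i => by have := hx.2.1 (i + n); positivity)
        fun m => ?_
      have h6 : ∀ i ∈ Finset.range m, x (i + n) ^ k ≤ x n ^ (k - 1) * x (i + n) := by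
        intro i _
        obtain ⟨j, rfl⟩ : ∃ j, k = j + 1 := ⟨k - 1, by omega⟩
        rw [pow_succ, Nat.add_sub_cancel]
        have h7 := hx.1 (Nat.le_add_left n i)
        have h8 := hx.2.1 (i + n)
        gcongr
      refine (Finset.sum_le_sum h6).trans ?_
      rw [← Finset.mul_sum]
      have h9 := hx.2.1 n
      refine mul_le_mul_of_nonneg_left ?_ (by positivity)
      refine le_trans ?_ (hx.2.2 (n + m))
      rw [Finset.sum_range_add]
      have : 0 ≤ ∑ i ∈ Finset.range n, x i := Finset.sum_nonneg fun i _ => hx.2.1 i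
      simp_rw [add_comm n]
      linarith
    linarith
  rcases (hx.2.1 n).eq_or_lt with h0 | h0
  · have := key k₀ le_rfl
    rw [← h0, zero_pow (by omega), zero_mul] at this
    exact absurd this (not_le.2 (pow_pos hy0 _))
  · have h1 : 1 < y n / x n := (one_lt_div h0).2 hlt
    obtain ⟨k, hk, hk'⟩ := ((tendsto_pow_atTop_atTop_of_one_lt h1).eventually_gt_atTop
      (C / x n)).and (eventually_ge_atTop k₀) |>.exists
    have h2 := key k hk'
    obtain ⟨j, rfl⟩ : ∃ j, k = j + 1 := ⟨k - 1, by omega⟩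
    rw [div_pow, div_lt_div_iff₀ h0 (by positivity), Nat.add_sub_cancel] at *
    rw [pow_succ (x n)] at hk
    nlinarith

lemma eq_of_forall_tsum_pow_eq {C : ℝ} (hC : 0 ≤ C) {x y : ℕ → ℝ} (hx : x ∈ decSeq C)
    (hy : y ∈ decSeq C) {k₀ : ℕ} (hk₀ : 2 ≤ k₀)
    (h : ∀ k, k₀ ≤ k → ∑' n, x n ^ k = ∑' n, y n ^ k) : x = y := by
  ext n
  induction n using Nat.strong_induction_on with
  | h n ih =>
    exact le_antisymm
      (le_of_forall_tsum_pow_eq hC hy hx hk₀ (fun k hk => (h k hk).symm) n fun i hi => (ih i hi).symm)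
      (le_of_forall_tsum_pow_eq hC hx hy hk₀ h n ih)

/-- Polynomials in the power sums of order at least `k₀`. -/
def powSumPoly (k₀ : ℕ) : Submodule ℝ ((ℕ → ℝ) → ℝ) :=
  Submodule.span ℝ {g | ∃ (n : ℕ) (e : ℕ → ℕ), (∀ i, k₀ ≤ e i) ∧
    g = fun x => ∏ i ∈ Finset.range n, ∑' j, x j ^ e i}

/-- Stone–Weierstrass on the compact space `decSeq C`, where power sums of order at least `k₀`
separate points. The algebra they generate is spanned by their products; the empty product supplies
the constants. -/
lemma exists_powSumPoly_near {C : ℝ} (hC : 0 ≤ C) {k₀ : ℕ} (hk₀ : 2 ≤ k₀) (f : C(decSeq C, ℝ))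
    {ε : ℝ} (hε : 0 < ε) :
    ∃ g ∈ powSumPoly k₀, ∀ x : decSeq C, |f x - g x| < ε := by
  have : CompactSpace (decSeq C) := isCompact_iff_compactSpace.1 (isCompact_decSeq C)
  set S : Set C(decSeq C, ℝ) := {p | ∃ (k : ℕ) (hk : k₀ ≤ k), p = contPowSum hC (hk₀.trans hk)}
  have hsep : (Algebra.adjoin ℝ S).SeparatesPoints := by
    intro x y hxy
    by_contra hc
    push Not at hc
    refine hxy (Subtype.ext (eq_of_forall_tsum_pow_eq hC x.2 y.2 hk₀ fun k hk => ?_))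
    exact hc _ ⟨contPowSum hC (hk₀.trans hk), Algebra.subset_adjoin ⟨k, hk, rfl⟩, rfl⟩
  obtain ⟨⟨g, hg⟩, hgf⟩ := ContinuousMap.exists_mem_subalgebra_near_continuousMap_of_separatesPoints
    _ hsep f ε hε
  have hcl : ∀ p ∈ Submonoid.closure S, ∃ (n : ℕ) (e : ℕ → ℕ), (∀ i, k₀ ≤ e i) ∧
      ∀ x : decSeq C, p x = ∏ i ∈ Finset.range n, ∑' j, (x : ℕ → ℝ) j ^ e i := by
    intro p hp
    induction hp using Submonoid.closure_induction_right with
    | one => exact ⟨0, fun _ => k₀, fun _ => le_rfl, fun x => by simp⟩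
    | mul_right p hp q hq ih =>
      obtain ⟨n, e, he, hpe⟩ := ih
      obtain ⟨k, hk, rfl⟩ := hq
      refine ⟨n + 1, Function.update e n k, fun i => ?_, fun x => ?_⟩
      · by_cases hi : i = n
        · subst hi
          simpa using hk
        · simpa [hi] using he i
      · rw [ContinuousMap.mul_apply, hpe x, Finset.prod_range_succ]
        congr 1
        · refine Finset.prod_congr rfl fun i hi => ?_
          rw [Function.update_of_ne (Finset.mem_range.1 hi).ne]
        · simp [contPowSum]
  have hspan : ∀ p ∈ Submodule.span ℝ (Submonoid.closure S : Set C(decSeq C, ℝ)),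
      ∃ g ∈ powSumPoly k₀, ∀ x : decSeq C, p x = g x := by
    intro p hp
    induction hp using Submodule.span_induction with
    | mem p hp =>
      obtain ⟨n, e, he, hpe⟩ := hcl p hp
      exact ⟨_, Submodule.subset_span ⟨n, e, he, rfl⟩, hpe⟩
    | zero => exact ⟨0, zero_mem _, fun x => rfl⟩
    | add p q _ _ hp hq =>
      obtain ⟨g, hg, hpg⟩ := hp
      obtain ⟨g', hg', hpg'⟩ := hq
      exact ⟨g + g', add_mem hg hg', fun x => by simp [hpg, hpg']⟩
    | smul c p _ hp =>
      obtain ⟨g, hg, hpg⟩ := hp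
      exact ⟨c • g, Submodule.smul_mem _ c hg, fun x => by simp [hpg]⟩
  rw [← Subalgebra.mem_toSubmodule, Algebra.adjoin_eq_span] at hg
  obtain ⟨G, hG, hgG⟩ := hspan g hg
  refine ⟨G, hG, fun x => ?_⟩
  rw [← hgG, abs_sub_comm]
  exact (ContinuousMap.norm_coe_le_norm (g - f) x).trans_lt hgf

/-! ### Ordered cycle lengths -/

lemma sum_range_getD {α : Type*} [AddCommMonoid α] (f : ℕ → α) (l : List ℕ) :
    ∑ k ∈ Finset.range l.length, f (l.getD k 0) = (l.map f).sum := by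
  induction l with
  | nil => simp
  | cons a l ih =>
    rw [List.length_cons, Finset.sum_range_succ', add_comm]
    simp [← ih]

lemma hasSum_orderedCycleLength_pow {N : ℕ} (σ : Equiv.Perm (Fin N)) {m : ℕ} (hm : 1 ≤ m) :
    HasSum (fun k => (orderedCycleLength σ k : ℝ) ^ m) (powSum m σ.partition.parts) := by
  set l := σ.partition.parts.sort (· ≥ ·) with hl
  have h1 : powSum m σ.partition.parts = ∑ k ∈ Finset.range l.length,
      (orderedCycleLength σ k : ℝ) ^ m := by
    have h2 := sum_range_getD (fun a : ℕ => (a : ℝ) ^ m) l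
    have h3 : (l : Multiset ℕ) = σ.partition.parts := Multiset.sort_eq _ _
    rw [powSum, ← h3, Multiset.map_coe, Multiset.sum_coe, ← h2]
    rfl
  rw [h1]
  refine hasSum_sum_of_ne_finset_zero fun k hk => ?_
  have : l.length ≤ k := by simpa using hk
  rw [orderedCycleLength, ← hl, List.getD_eq_default _ _ this]
  simp
  omega

lemma antitone_orderedCycleLength {N : ℕ} (σ : Equiv.Perm (Fin N)) :
    Antitone (orderedCycleLength σ) := by
  refine antitone_nat_of_succ_le fun n => ?_
  unfold orderedCycleLength
  have hp : (σ.partition.parts.sort (· ≥ ·)).Pairwise (· ≥ ·) := Multiset.pairwise_sort _ _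
  set l := σ.partition.parts.sort (· ≥ ·)
  by_cases h : n + 1 < l.length
  · rw [List.getD_eq_getElem _ _ h, List.getD_eq_getElem _ _ (by omega)]
    exact List.pairwise_iff_getElem.1 hp n (n + 1) (by omega) h (by omega)
  · rw [List.getD_eq_default _ _ (by omega)]
    exact Nat.zero_le _

lemma powSum_one_partition {N : ℕ} (σ : Equiv.Perm (Fin N)) :
    powSum 1 σ.partition.parts = N := by
  have h := σ.partition.parts_sum
  simp only [Fintype.card_fin] at h
  conv_rhs => rw [← h]
  simp [powSum]

lemma orderedCycleLength_mem_decSeq {N : ℕ} (σ : Equiv.Perm (Fin N)) {ν : ℝ} (hν : 0 < ν) :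
    (fun k => (orderedCycleLength σ k : ℝ) / (N * ν)) ∈ decSeq (1 / ν) := by
  refine ⟨fun i j hij => ?_, fun n => by positivity, fun n => ?_⟩
  · have : (orderedCycleLength σ j : ℝ) ≤ orderedCycleLength σ i := by
      exact_mod_cast antitone_orderedCycleLength σ hij
    exact div_le_div_of_nonneg_right this (by positivity)
  · rw [← Finset.sum_div]
    have h1 := sum_le_hasSum (Finset.range n) (fun i _ => by positivity)
      (hasSum_orderedCycleLength_pow σ le_rfl)
    rw [powSum_one_partition] at h1
    simp only [pow_one] at h1
    rcases Nat.eq_zero_or_pos N with rfl | hN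
    · simp
      positivity
    · have hN' : (0 : ℝ) < N := by exact_mod_cast hN
      rw [div_le_div_iff₀ (by positivity) hν]
      nlinarith

/-! ### Convergence in law -/

lemma permProb_nonneg {θ κ : ℕ → ℝ} (hθ : ∀ j, 1 ≤ j → 0 ≤ θ j) (hκ : ∀ j, 1 ≤ j → 0 ≤ κ j)
    (N : ℕ) (σ : Equiv.Perm (Fin N)) : 0 ≤ permProb θ κ N σ := by
  have hw : ∀ σ : Equiv.Perm (Fin N), 0 ≤ cycleWeight θ κ N σ := fun σ =>
    Finset.prod_nonneg fun j hj => by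
      have h1 := (Finset.mem_Icc.1 hj).1
      have h2 := hθ j h1
      have h3 := hκ j h1
      positivity
  have h1 : 0 ≤ ∑ σ : Equiv.Perm (Fin N), cycleWeight θ κ N σ := Finset.sum_nonneg fun σ _ => hw σ
  have h2 := hw σ
  have h3 : 0 ≤ normConst θ κ N := mul_nonneg (by positivity) h1
  exact mul_nonneg (div_nonneg zero_le_one (mul_nonneg (Nat.cast_nonneg _) h3)) h2

section

variable {b k : ℕ → ℝ} {θ κ₁ s C : ℝ} {k₀ : ℕ}

/-- Both sides are linear in `g`; for a product of power sums both limits are expressed through the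
same `pointMoment`. -/
lemma tendsto_permExpect_powSumPoly (hb : ∀ j, 1 ≤ j → 0 ≤ b j) (hk : ∀ j, 1 ≤ j → 0 ≤ k j)
    (hθ : 0 < θ) (hbθ : Tendsto b atTop (𝓝 θ)) (hbs : Summable fun j : ℕ => |b j - θ| / j)
    (hκ : HasSum (dropZero k) κ₁) (hκ1 : κ₁ < 1) (hs : 1 < s)
    (hC : ∀ j : ℕ, 1 ≤ j → k j ≤ C * (j : ℝ) ^ (-s)) (hk₀ : s + 1 ≤ k₀) {g : (ℕ → ℝ) → ℝ}
    (hg : g ∈ powSumPoly k₀) :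
    Integrable g (poissonDirichlet θ) ∧ Tendsto (fun N => permExpect b k N fun σ =>
      g fun i => (orderedCycleLength σ i : ℝ) / (N * (1 - κ₁))) atTop
      (𝓝 (∫ x, g x ∂poissonDirichlet θ)) := by
  have hk₀1 : 1 ≤ k₀ := by
    have : (1 : ℝ) ≤ k₀ := by linarith
    exact_mod_cast this
  induction hg using Submodule.span_induction with
  | mem g hg =>
    obtain ⟨n, e, he, rfl⟩ := hg
    have he1 : ∀ i, 1 ≤ e i := fun i => hk₀1.trans (he i)
    constructor
    · refine Integrable.of_bound (C := 1) (Measurable.aestronglyMeasurable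
        (Finset.measurable_prod _ fun i _ => Measurable.tsum fun n => by fun_prop)) ?_
      filter_upwards [ae_poissonDirichlet hθ] with x hx
      have hx1 : ∀ j, x j ≤ 1 := fun j => (hx.1 (Nat.zero_le j)).trans (by simpa using hx.2.2 1)
      rw [norm_prod]
      refine Finset.prod_le_one (fun _ _ => norm_nonneg _) fun i _ => ?_
      rw [Real.norm_of_nonneg (tsum_nonneg fun j => pow_nonneg (hx.2.1 j) _)]
      refine Real.tsum_le_of_sum_range_le (fun j => pow_nonneg (hx.2.1 j) _) fun m => ?_
      refine (Finset.sum_le_sum fun j _ => ?_).trans (hx.2.2 m)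
      exact pow_le_of_le_one (hx.2.1 j) (hx1 j) (by have := he1 i; omega)
    · have h1 := tendsto_permExpect_powSum hb hk hθ hbθ hbs hκ hκ1 hs hC (e := e)
        (fun i => hk₀.trans (by exact_mod_cast he i)) (isGammaMoment_pointMoment hθ he1)
        (Finset.range n)
      rw [integral_prod_poissonDirichlet hθ he1]
      refine h1.congr fun N => ?_
      simp only [permExpect, Finset.sum_div]
      refine Finset.sum_congr rfl fun σ _ => ?_
      rw [mul_div_assoc, ← Finset.prod_pow_eq_pow_sum, ← Finset.prod_div_distrib]
      congr 1
      refine Finset.prod_congr rfl fun i _ => ?_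
      simp_rw [div_pow]
      exact ((hasSum_orderedCycleLength_pow σ (he1 i)).div_const _).tsum_eq.symm
  | zero =>
    refine ⟨integrable_zero _ _ _, ?_⟩
    simp [permExpect]
  | add g g' _ _ hg hg' =>
    refine ⟨hg.1.add hg'.1, ?_⟩
    simp only [Pi.add_apply]
    rw [integral_add hg.1 hg'.1]
    refine (hg.2.add hg'.2).congr fun N => ?_
    simp [permExpect, mul_add, Finset.sum_add_distrib]
  | smul c g _ hg =>
    refine ⟨hg.1.smul c, ?_⟩
    simp only [Pi.smul_apply, smul_eq_mul]
    rw [integral_const_mul]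
    refine (hg.2.const_mul c).congr fun N => ?_
    simp only [permExpect, Finset.mul_sum]
    exact Finset.sum_congr rfl fun σ _ => by ring

/-- The scaled cycle lengths lie in `decSeq (1 / ν)`, and `PD(θ)` is carried by `decSeq 1`, which is
contained in it. A uniform approximation of `F` on this set is therefore enough. -/
lemma tendsto_permExpect_continuous (hb : ∀ j, 1 ≤ j → 0 ≤ b j) (hk : ∀ j, 1 ≤ j → 0 ≤ k j)
    (hθ : 0 < θ) (hbθ : Tendsto b atTop (𝓝 θ)) (hbs : Summable fun j : ℕ => |b j - θ| / j)
    (hκ : HasSum (dropZero k) κ₁) (hκ1 : κ₁ < 1) (hs : 1 < s)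
    (hC : ∀ j : ℕ, 1 ≤ j → k j ≤ C * (j : ℝ) ^ (-s)) (F : (ℕ → ℝ) →ᵇ ℝ) :
    Tendsto (fun N => permExpect b k N fun σ =>
      F fun i => (orderedCycleLength σ i : ℝ) / (N * (1 - κ₁))) atTop
      (𝓝 (∫ x, F x ∂poissonDirichlet θ)) := by
  have hν : 0 < 1 - κ₁ := by linarith
  have hκ0 : 0 ≤ κ₁ := hκ.nonneg (dropZero_nonneg hk)
  have hC0 : 0 ≤ 1 / (1 - κ₁) := by positivity
  obtain ⟨k₀, hk₀⟩ := exists_nat_ge (s + 1)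
  have hk₂ : 2 ≤ k₀ := by
    have : (2 : ℝ) ≤ k₀ := by linarith
    exact_mod_cast this
  have hprob := permProb_nonneg hb hk
  -- The total mass is `1` once the normalization is nonzero. Here it is enough that it tends to
  -- `1`, the case of the empty product; the bound `2` accounts for `2 * (ε / 4)` of the error.
  have htot : ∀ᶠ N in atTop, ∑ σ : Equiv.Perm (Fin N), permProb b k N σ < 2 := by
    have h1 := (tendsto_permExpect_powSumPoly hb hk hθ hbθ hbs hκ hκ1 hs hC hk₀ (g := fun _ => 1)
      (Submodule.subset_span ⟨0, fun _ => k₀, fun _ => le_rfl, by simp⟩)).2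
    simp only [permExpect, mul_one, integral_const, probReal_univ, smul_eq_mul] at h1
    exact h1.eventually (gt_mem_nhds one_lt_two)
  rw [Metric.tendsto_nhds]
  intro ε hε
  obtain ⟨g, hg, hgF⟩ := exists_powSumPoly_near hC0 hk₂
    ⟨fun x : decSeq (1 / (1 - κ₁)) => F x, by fun_prop⟩ (show 0 < ε / 4 by positivity)
  simp only [ContinuousMap.coe_mk] at hgF
  obtain ⟨hint, hlim⟩ := tendsto_permExpect_powSumPoly hb hk hθ hbθ hbs hκ hκ1 hs hC hk₀ hg
  have hFint : Integrable F (poissonDirichlet θ) :=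
    Integrable.of_bound (C := ‖F‖) F.continuous.measurable.aestronglyMeasurable
      (Eventually.of_forall F.norm_coe_le_norm)
  have hI : |∫ x, F x ∂poissonDirichlet θ - ∫ x, g x ∂poissonDirichlet θ| ≤ ε / 4 := by
    rw [← integral_sub hFint hint]
    have h1 := norm_integral_le_of_norm_le_const (μ := poissonDirichlet θ)
      (f := fun x => F x - g x) (C := ε / 4) (by
        filter_upwards [ae_poissonDirichlet hθ] with x hx
        have hx' : x ∈ decSeq (1 / (1 - κ₁)) :=
          decSeq_mono ((one_le_div hν).2 (by linarith)) hx
        exact (hgF ⟨x, hx'⟩).le)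
    simpa using h1
  filter_upwards [htot, Metric.tendsto_nhds.1 hlim (ε / 4) (by positivity)] with N h1 h2
  rw [Real.dist_eq] at h2 ⊢
  have h3 : |(permExpect b k N fun σ => F fun i => (orderedCycleLength σ i : ℝ) / (N * (1 - κ₁))) -
      permExpect b k N fun σ => g fun i => (orderedCycleLength σ i : ℝ) / (N * (1 - κ₁))| ≤
      2 * (ε / 4) := by
    simp only [permExpect, ← Finset.sum_sub_distrib, ← mul_sub]
    refine (Finset.abs_sum_le_sum_abs _ _).trans ?_
    calc _ ≤ ∑ σ : Equiv.Perm (Fin N), permProb b k N σ * (ε / 4) := by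
          refine Finset.sum_le_sum fun σ _ => ?_
          rw [abs_mul, abs_of_nonneg (hprob N σ)]
          exact mul_le_mul_of_nonneg_left
            (hgF ⟨_, orderedCycleLength_mem_decSeq σ hν⟩).le (hprob N σ)
      _ ≤ _ := by
          rw [← Finset.sum_mul]
          gcongr
  rw [abs_le] at h3 hI
  rw [abs_lt] at h2 ⊢
  constructor <;> linarith

end

end SurrogateSpatial

end

/-! ### Conclusion: from the singular expansions to the limit law -/

open SurrogateSpatial in
theorem mainTheorem1
    (θ κ : ℕ → ℝ)
    (hθ : ∀ j, 1 ≤ j → 0 ≤ θ j) (hκ : ∀ j, 1 ≤ j → 0 ≤ κ j)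
    (hNA : NonArithmetic κ)
    -- common radius of convergence
    (R : ℝ) (hR : 0 < R)
    (hRθ : (cycleSeries θ).radius = ENNReal.ofReal R)
    (hRκ : (cycleSeries κ).radius = ENNReal.ofReal R)
    -- holomorphic extensions of the two generating functions to the indented disc
    (η φ : ℝ) (hη : 0 < η) (hφ : 0 < φ) (hφ' : φ < Real.pi / 2)
    (gθ gκ : ℂ → ℂ)
    (hgθ : IsGeneratingFunctionOn θ R gθ) (hgκ : IsGeneratingFunctionOn κ R gκ)
    (hgθ_hol : DifferentiableOn ℂ gθ (Delta0 R η φ))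
    (hgκ_hol : DifferentiableOn ℂ gκ (Delta0 R η φ))
    -- supercritical regime
    (hsuper : modDerivAt 1 gκ R < 1)
    -- asymptotics of the two functions at the singularity
    (θs δ : ℝ) (hθs : 0 < θs) (hδ : 0 < δ)
    (hgθ_as : (fun z : ℂ => gθ z - (-(θs : ℂ) * Complex.log (1 - z / R)))
      =O[𝓝[Delta0 R η φ] (R : ℂ)] (fun z : ℂ => ‖1 - z / (R : ℂ)‖ ^ δ))
    (hgκ_as : (fun z : ℂ => gκ z - (((modDerivAt 0 gκ R).toReal : ℂ)
        - ((modDerivAt 1 gκ R).toReal : ℂ) * (1 - z / R)))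
      =O[𝓝[Delta0 R η φ] (R : ℂ)] (fun z : ℂ => ‖1 - z / (R : ℂ)‖ ^ (1 + δ)))
    -- the non-integer singular exponent
    (s : ℝ) (hs : 1 < s) (hs_int : ∀ n : ℕ, (n : ℝ) ≠ s)
    (hfin : ∀ n : ℕ, (n : ℝ) < s → modDerivAt n gκ R < ⊤)
    (hinf : ∀ n : ℕ, s < (n : ℝ) → modDerivAt n gκ R = ⊤)
    (a : ℝ) (ha : a ≠ 0) (δs : ℕ → ℝ) (hδs : ∀ n, 0 < δs n)
    -- asymptotics of the modified derivatives at the singularity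
    (hlow : ∀ n : ℕ, (n : ℝ) < s →
      (fun z : ℂ => modDeriv n gκ z - ((modDerivAt n gκ R).toReal : ℂ))
        =O[𝓝[Delta0 R η φ] (R : ℂ)] (fun z : ℂ => ‖1 - z / (R : ℂ)‖ ^ (δs n)))
    (hhigh : ∀ n : ℕ, s < (n : ℝ) →
      (fun z : ℂ => modDeriv n gκ z
          - ((Real.Gamma (-s + n) * a / Real.Gamma (-s) : ℝ) : ℂ)
            * (1 - z / R) ^ ((s - n : ℝ) : ℂ))
        =O[𝓝[Delta0 R η φ] (R : ℂ)] (fun z : ℂ => ‖1 - z / (R : ℂ)‖ ^ (s - n + δs n)))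
    (hgθ_deriv : ∀ n : ℕ, 1 ≤ n →
      (fun z : ℂ => modDeriv n gθ z
          - (θs : ℂ) * ((n - 1).factorial : ℂ) / (1 - z / R) ^ n)
        =O[𝓝[Delta0 R η φ] (R : ℂ)] (fun z : ℂ => ‖1 - z / (R : ℂ)‖ ^ (δs n - n))) :
    -- convergence in law of `(L^{(1)}, …, L^{(m)}) / (N ν)`, where `ν = 1 - gκ^{1}(R)`, to the
    -- first `m` coordinates of the Poisson–Dirichlet distribution, for every `m`
    ∀ (m : ℕ) (F : (Fin m → ℝ) →ᵇ ℝ),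
      Tendsto
        (fun N : ℕ => permExpect θ κ N (fun σ => F (fun i : Fin m =>
          (orderedCycleLength σ i : ℝ) / (N * (1 - (modDerivAt 1 gκ R).toReal)))))
        atTop
        (𝓝 (∫ x, F (fun i : Fin m => x i) ∂(poissonDirichlet θs))) := by
  have hO3 := hgθ_deriv 3 (by norm_num)
  obtain ⟨C₁, d, hd, hC₁⟩ := exists_coeff_sub_le hR hη hφ hφ' hgθ hgθ_hol (hδs 3) hO3
  -- An order of differentiation high enough for `exists_coeff_le`.
  obtain ⟨n, hn⟩ := exists_nat_ge (s + 2)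
  obtain ⟨C, hC⟩ := exists_coeff_le hR hη hφ hφ' hκ hgκ hgκ_hol hn (hδs n)
    (hhigh n (by linarith))
  obtain ⟨hsum, hcoe⟩ := hasSum_of_coeff_le hR hκ hgκ hs hC
  have hκ1 : (modDerivAt 1 gκ R).toReal < 1 := by
    rw [hcoe] at hsuper
    exact_mod_cast hsuper
  intro m F
  -- The limit is taken for the rescaled weights, and `F` is composed with the projection to the
  -- first `m` coordinates; `permProb_scale` returns to the original measure.
  have h := tendsto_permExpect_continuous (b := fun j => θ j * R ^ j)
    (fun j hj => mul_nonneg (hθ j hj) (by positivity))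
    (fun j hj => mul_nonneg (hκ j hj) (by positivity)) hθs (tendsto_of_abs_sub_le hd hC₁)
    (summable_of_abs_sub_le hd hC₁) hsum hκ1 hs hC
    (F.compContinuous ⟨fun (x : ℕ → ℝ) (i : Fin m) => x i, by fun_prop⟩)
  refine h.congr fun N => ?_
  simp only [permExpect, permProb_scale θ κ hR]
  rfl
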